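/- Let $n\in\mathbb N$, $1<\gamma<n$, $\gamma'=\gamma/(\gamma-1)$, $q>\frac{n}{\gamma-1}$, $0<p<\infty$ and $0<\nu\le\Lambda<\infty$, and put $\delta=1-\frac{n}{q(\gamma-1)}$. Then $\delta>0$, and there is a constant $C>0$ depending only on $n,\nu,\Lambda,\gamma,q,p$ such that the following holds. Let $\Omega\subset\mathbb R^n$ be open and let $\rho:\Omega\times(\mathbb R^n\setminus\{0\})\to(0,\infty)$ satisfy (i) $\rho(x,\cdot)\in C^1(\mathbb R^n\setminus\{0\})$ for every $x\in\Omega$, and $\rho(\cdot,\xi)\in L^\infty(\Omega)$ for every $\xi\ne0$; (ii) $\rho(x,\lambda\xi)=\lambda\rho(x,\xi)$ for all $\lambda>0$, $x\in\Omega$, $\xi\neq0$; (iii) $\rho(x,\xi_1+\xi_2)<\rho(x,\xi_1)+\rho(x,\xi_2)$ for all $x\in\Omega$ and all $\xi_1,\xi_2\ne0$ that are not multiples of each other; (iv) $\nu\le\rho(x,\xi)\le\Lambda$ for all $x\in\Omega$ and $|\xi|=1$. Let $\rho_*(x,\zeta)=\sup\{\xi\cdot\zeta:\ \xi\neq 0,\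 \rho(x,\xi)<1\}$. Let $\vec F\in L^q_{\rm loc}(\Omega;\mathbb R^n)$ and $f\in L^{q/\gamma'}_{\rm loc}(\Omega)$, and let $u\in W^{1,\gamma}(\Omega)$ be a weak subsolution of the anisotropic equation with right-hand side $(\vec F,f)$, i.e. $$\int_\Omega\big\langle \rho(x,Du)^{\gamma-1}(D\rho(x,\cdot))(Du),D\varphi\big\rangle\,dx\le\int_\Omega\langle\vec F,D\varphi\rangle+f\varphi\,dx\qquad\text{for all } 0\le\varphi\in C_c^\infty(\Omega),$$ where the vector field $\rho(x,\xi)^{\gamma-1}(D\rho(x,\cdot))(\xi)$ is understood to be $0$ at $\xi=0$. Then for every $0<r<R<1$ and every ball $B_R=B_R(x_0)\subset\Omega$, with $B_r=B_r(x_0)$ and $u^+=\max\{u,0\}$, $$\operatorname*{ess\,sup}_{B_r}u^+\le C\Big[(R-r)^{-\frac np}\|u^+\|_{L^p(B_R)}+R^{\delta}\,\|\rho_*(\cdot,\vec F)\|_{L^q(B_R)}^{\frac1{\gamma-1}}+R^{\gamma'\delta}\,\|f\|_{L^{q/\gamma'}(B_R)}^{\frac1{\gamma-1}}\Big],$$ where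 norms on the right-hand side may be infinite. -/

import Mathlib

open MeasureTheory Set
open scoped ENNReal ContDiff

noncomputable section

/-- `φ` is a smooth function with compact support inside `Ω`, i.e. `φ ∈ C_c^∞(Ω)`. -/
structure IsTestFunction {n : ℕ} (Ω : Set (EuclideanSpace ℝ (Fin n)))
    (φ : EuclideanSpace ℝ (Fin n) → ℝ) : Prop where
  contDiff : ContDiff ℝ ∞ φ
  hasCompactSupport : HasCompactSupport φ
  tsupport_subset : tsupport φ ⊆ Ω

/-- `f ∈ L^p_loc(Ω)`: `f` is in `L^p` on every compact subset of `Ω`. -/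
def MemLpLoc {n : ℕ} {V : Type*} [NormedAddCommGroup V]
    (f : EuclideanSpace ℝ (Fin n) → V) (p : ℝ≥0∞)
    (Ω : Set (EuclideanSpace ℝ (Fin n))) : Prop :=
  ∀ K ⊆ Ω, IsCompact K → MemLp f p (volume.restrict K)

/-- `G` is the weak gradient of `u` on `Ω`:
`∫_Ω u ∂_v φ = - ∫_Ω ⟨G, v⟩ φ` for every test function `φ` and every direction `v`. -/
structure HasWeakGradient {n : ℕ} (Ω : Set (EuclideanSpace ℝ (Fin n)))
    (u : EuclideanSpace ℝ (Fin n) → ℝ)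
    (G : EuclideanSpace ℝ (Fin n) → EuclideanSpace ℝ (Fin n)) : Prop where
  memLpLoc : MemLpLoc u 1 Ω
  memLpLoc_grad : MemLpLoc G 1 Ω
  integral_eq : ∀ φ : EuclideanSpace ℝ (Fin n) → ℝ, IsTestFunction Ω φ →
    ∀ v : EuclideanSpace ℝ (Fin n),
      ∫ x in Ω, u x * fderiv ℝ φ x v = - ∫ x in Ω, inner ℝ (G x) v * φ x

/-- `u ∈ W^{1,γ}(Ω)` with weak gradient `G`. -/
structure MemSobolevW1 {n : ℕ} (Ω : Set (EuclideanSpace ℝ (Fin n))) (γ : ℝ)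
    (u : EuclideanSpace ℝ (Fin n) → ℝ)
    (G : EuclideanSpace ℝ (Fin n) → EuclideanSpace ℝ (Fin n)) : Prop where
  hasWeakGradient : HasWeakGradient Ω u G
  memLp : MemLp u (ENNReal.ofReal γ) (volume.restrict Ω)
  memLp_grad : MemLp G (ENNReal.ofReal γ) (volume.restrict Ω)

/-- The standing hypotheses on the integrand `ρ : Ω × (ℝⁿ ∖ {0}) → (0, ∞)`. The values of `ρ x ξ`
for `x ∉ Ω` or `ξ = 0` are irrelevant. -/
structure IsAnisotropicIntegrand {n : ℕ} (Ω : Set (EuclideanSpace ℝ (Fin n))) (ν Λ : ℝ)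
    (ρ : EuclideanSpace ℝ (Fin n) → EuclideanSpace ℝ (Fin n) → ℝ) : Prop where
  pos : ∀ x ∈ Ω, ∀ ξ, ξ ≠ 0 → 0 < ρ x ξ
  contDiffOn : ∀ x ∈ Ω, ContDiffOn ℝ 1 (ρ x) {0}ᶜ
  memLp_top : ∀ ξ, ξ ≠ 0 → MemLp (fun x => ρ x ξ) ∞ (volume.restrict Ω)
  homogeneous : ∀ x ∈ Ω, ∀ ξ, ξ ≠ 0 → ∀ t : ℝ, 0 < t → ρ x (t • ξ) = t * ρ x ξ
  strictly_subadditive : ∀ x ∈ Ω, ∀ ξ₁ ξ₂, ξ₁ ≠ 0 → ξ₂ ≠ 0 → (∀ t : ℝ, ξ₁ ≠ t • ξ₂) →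
    ρ x (ξ₁ + ξ₂) < ρ x ξ₁ + ρ x ξ₂
  lower_bound : ∀ x ∈ Ω, ∀ ξ, ‖ξ‖ = 1 → ν ≤ ρ x ξ
  upper_bound : ∀ x ∈ Ω, ∀ ξ, ‖ξ‖ = 1 → ρ x ξ ≤ Λ

/-- The convex dual `ρ_*(x, ζ) = sup { ξ · ζ : ρ(x, ξ) < 1 }`. -/
def convexDual {n : ℕ} (ρ : EuclideanSpace ℝ (Fin n) → EuclideanSpace ℝ (Fin n) → ℝ)
    (x ζ : EuclideanSpace ℝ (Fin n)) : ℝ :=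
  sSup {s : ℝ | ∃ ξ, ξ ≠ 0 ∧ ρ x ξ < 1 ∧ s = inner ℝ ξ ζ}

open Classical in
/-- The flux `ρ(x, ξ)^(γ-1) (D ρ(x, ·))(ξ)`, extended by its limit `0` to `ξ = 0`. -/
def anisotropicFlux {n : ℕ} (γ : ℝ)
    (ρ : EuclideanSpace ℝ (Fin n) → EuclideanSpace ℝ (Fin n) → ℝ)
    (x ξ : EuclideanSpace ℝ (Fin n)) : EuclideanSpace ℝ (Fin n) :=
  if ξ = 0 then 0 else (ρ x ξ) ^ (γ - 1) • gradient (ρ x) ξ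

/-- `u ∈ W^{1,γ}(Ω)` is a weak subsolution of
`∫ ⟨ρ(x, Du)^(γ-1) (D ρ(x, ·))(Du), Dφ⟩ = ∫ ⟨F, Dφ⟩ + f φ`. -/
def IsSubsolution {n : ℕ} (Ω : Set (EuclideanSpace ℝ (Fin n))) (γ : ℝ)
    (ρ : EuclideanSpace ℝ (Fin n) → EuclideanSpace ℝ (Fin n) → ℝ)
    (F : EuclideanSpace ℝ (Fin n) → EuclideanSpace ℝ (Fin n))
    (f : EuclideanSpace ℝ (Fin n) → ℝ)
    (u : EuclideanSpace ℝ (Fin n) → ℝ) : Prop :=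
  ∃ G : EuclideanSpace ℝ (Fin n) → EuclideanSpace ℝ (Fin n),
    MemSobolevW1 Ω γ u G ∧
    ∀ φ : EuclideanSpace ℝ (Fin n) → ℝ, IsTestFunction Ω φ → (∀ x, 0 ≤ φ x) →
      ∫ x in Ω, inner ℝ (anisotropicFlux γ ρ x (G x)) (gradient φ x) ≤
        ∫ x in Ω, (inner ℝ (F x) (gradient φ x) + f x * φ x)

end

/-!
The proof is De Giorgi's iteration, carried out for the truncations `(u - k)⁺` of a subsolution.

*Energy.* Homogeneity, convexity and the bounds `ν ≤ ρ ≤ Λ` on the unit sphere give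
`⟨A(x, ξ), ξ⟩ = ρ(x, ξ)^γ ≥ ν^γ |ξ|^γ` and `|A(x, ξ)| ≤ Λ^γ |ξ|^(γ-1)` for the flux `A`. The
inequality is tested with `ψ g(u)`, where `ψ` is a power of a cutoff and `g` is a smooth truncation.
Such a function is a `W_0^{1,γ}`-limit of nonnegative test functions
(`MemSobolevW1.isTestLimit_mul_comp`), because `u` can be mollified on compact subsets of `Ω`
(`MemSobolevW1.exists_smooth_approx`). Together with the Gagliardo-Nirenberg-Sobolev inequality this
bounds the `L^{γ*}` norm of `(u - k - d)⁺` on a ball by the right-hand side and the `L^γ` norm of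
`(u - k)⁺` on a larger concentric ball (`exists_energy_const`); the constant does not depend on
`k`, `d` and the radii.

*Iteration.* Let `s = q/γ'`. The source terms `|F|^γ'` and `f` are in `L^s` locally, so Hölder's
inequality leads to the norm of `(u - k)⁺` in `L^m`, where `1/m = (1 - 1/s)/γ`. The hypothesis
`q > n/(γ - 1)` says exactly that `m < γ*`, and the gap `α = 1 - m/γ*` between these exponents turns
the energy inequality into a superlinear recursion for the `L^m` norms at increasing levels on
shrinking balls (`DeGiorgiExponents.deGiorgi_step`). It starts as soon as the final level is a large
multiple of the averaged `L^m` norm of `u⁺` plus the scaled source terms, and forces `u` below this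
level on the half ball. The scaling of the source terms is governed by `n α / m = δ`.

*Small exponents.* For `p < m` the `L^m` norm is interpolated between `L^p` and `L^∞`, and the
`L^∞` norm is absorbed by a supremum over concentric balls weighted by a power of the distance to
the boundary (`DeGiorgiExponents.exists_sup_bound_of_lt`). The estimate on `B_r` results from the
estimates on the balls of radius `(R - r)/2` centred at points of `B_r`. Only at this point `|F|` is
replaced by `ρ_*(·, F)`, which dominates it up to the factor `2Λ`.
-/

section

open Filter Topology ContinuousLinearMap Convolution

/-! ### Mollification and local approximation of Sobolev functions -/

section Mollification

variable {E V : Type*} [NormedAddCommGroup E] [InnerProductSpace ℝ E] [FiniteDimensional ℝ E]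
  [MeasurableSpace E] [BorelSpace E] [NormedAddCommGroup V] [NormedSpace ℝ V]
  {μ : Measure E} [μ.IsAddHaarMeasure]

/-- Young's inequality for convolution with a probability density, from Jensen's inequality and
Tonelli's theorem. -/
theorem eLpNorm_normed_convolution_le (φ : ContDiffBump (0 : E)) {f : E → V}
    (hf : AEStronglyMeasurable f μ) {p : ℝ} (hp : 1 ≤ p) :
    eLpNorm (φ.normed μ ⋆[lsmul ℝ ℝ, μ] f) (ENNReal.ofReal p) μ
      ≤ eLpNorm f (ENNReal.ofReal p) μ := by
  wlog hfm : StronglyMeasurable f generalizing f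
  · have h := this hf.stronglyMeasurable_mk.aestronglyMeasurable hf.stronglyMeasurable_mk
    rwa [convolution_congr (lsmul ℝ ℝ) (ae_eq_refl _) hf.ae_eq_mk.symm,
      eLpNorm_congr_ae hf.ae_eq_mk.symm] at h
  have hp0 : 0 < p := by linarith
  have hp0' : ENNReal.ofReal p ≠ 0 := by simpa using hp0
  set P : Measure E := μ.withDensity fun t => ENNReal.ofReal (φ.normed μ t) with hP
  have hmeas : Measurable fun t => ENNReal.ofReal (φ.normed μ t) :=
    ENNReal.measurable_ofReal.comp φ.continuous_normed.measurable
  have hPuniv : P univ = 1 := by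
    rw [hP, withDensity_apply _ MeasurableSet.univ, Measure.restrict_univ,
      ← ofReal_integral_eq_lintegral_ofReal φ.integrable_normed
        (ae_of_all _ fun x => φ.nonneg_normed x), φ.integral_normed, ENNReal.ofReal_one]
  have : IsProbabilityMeasure P := ⟨hPuniv⟩
  have hpt : ∀ x, ‖(φ.normed μ ⋆[lsmul ℝ ℝ, μ] f) x‖ₑ ^ p ≤ ∫⁻ t, ‖f (x - t)‖ₑ ^ p ∂P := by
    intro x
    have hm : AEStronglyMeasurable (fun t => f (x - t)) P :=
      (hfm.comp_measurable (measurable_const.sub measurable_id)).aestronglyMeasurable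
    have hfx : Measurable fun t => ‖f (x - t)‖ₑ :=
      (hfm.comp_measurable (measurable_const.sub measurable_id)).enorm
    have h1 : ‖(φ.normed μ ⋆[lsmul ℝ ℝ, μ] f) x‖ₑ ≤ eLpNorm (fun t => f (x - t)) 1 P := by
      rw [eLpNorm_one_eq_lintegral_enorm, hP,
        lintegral_withDensity_eq_lintegral_mul _ hmeas hfx]
      refine (enorm_integral_le_lintegral_enorm _).trans (lintegral_mono fun t => ?_)
      simp only [lsmul_apply, enorm_smul, Pi.mul_apply]
      rw [Real.enorm_of_nonneg (φ.nonneg_normed t)]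
    have h2 := h1.trans (eLpNorm_le_eLpNorm_of_exponent_le (p := 1) (q := ENNReal.ofReal p)
      (by simpa using hp) hm)
    rw [eLpNorm_eq_lintegral_rpow_enorm_toReal hp0' ENNReal.ofReal_ne_top,
      ENNReal.toReal_ofReal hp0.le] at h2
    calc _ ≤ _ := ENNReal.rpow_le_rpow h2 hp0.le
      _ = _ := by rw [← ENNReal.rpow_mul, one_div, inv_mul_cancel₀ hp0.ne', ENNReal.rpow_one]
  rw [eLpNorm_eq_lintegral_rpow_enorm_toReal hp0' ENNReal.ofReal_ne_top,
    eLpNorm_eq_lintegral_rpow_enorm_toReal hp0' ENNReal.ofReal_ne_top,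
      ENNReal.toReal_ofReal hp0.le]
  refine ENNReal.rpow_le_rpow ((lintegral_mono hpt).trans ?_) (by positivity)
  rw [lintegral_lintegral_swap]
  · have : ∀ t, ∫⁻ x, ‖f (x - t)‖ₑ ^ p ∂μ = ∫⁻ x, ‖f x‖ₑ ^ p ∂μ := fun t =>
      lintegral_sub_right_eq_self (fun x => ‖f x‖ₑ ^ p) t
    simp [this, hPuniv]
  · exact ((hfm.comp_measurable (measurable_fst.sub measurable_snd)).enorm.pow_const p).aemeasurable

/-- Mollifications converge in `L^p`, `1 ≤ p < ∞`. -/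
theorem tendsto_eLpNorm_normed_convolution_sub [CompleteSpace V] {f : E → V} {p : ℝ} (hp : 1 ≤ p)
    (hf : MemLp f (ENNReal.ofReal p) μ) {φ : ℕ → ContDiffBump (0 : E)}
    (hφ : Tendsto (fun i => (φ i).rOut) atTop (𝓝 0)) :
    Tendsto (fun i => eLpNorm ((φ i).normed μ ⋆[lsmul ℝ ℝ, μ] f - f) (ENNReal.ofReal p) μ)
      atTop (𝓝 0) := by
  have hp1 : 1 ≤ ENNReal.ofReal p := by simpa using hp
  have hp0' : ENNReal.ofReal p ≠ 0 := (zero_lt_one.trans_le hp1).ne'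
  refine ENNReal.tendsto_nhds_zero.2 fun ε hε => ?_
  by_cases hεt : ε = ⊤
  · simp [hεt]
  have hε3 : ε / 3 ≠ 0 := (ENNReal.div_pos hε.ne' (by simp)).ne'
  obtain ⟨g, hgs, hfg, hgc, hgm⟩ :=
    hf.exists_hasCompactSupport_eLpNorm_sub_le ENNReal.ofReal_ne_top hε3
  set K := Metric.cthickening 1 (tsupport g)
  have hK : IsCompact K := hgs.isCompact.cthickening
  have hKμ : μ K ≠ ⊤ := hK.measure_ne_top
  have hKpos : μ K ^ (ENNReal.ofReal p).toReal⁻¹ ≠ ⊤ :=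
    ENNReal.rpow_ne_top_of_nonneg (by positivity) hKμ
  obtain ⟨η, hη0, hη⟩ : ∃ η : ℝ, 0 < η ∧
      μ K ^ (ENNReal.ofReal p).toReal⁻¹ * ENNReal.ofReal η ≤ ε / 3 := by
    have : Tendsto (fun η : ℝ => μ K ^ (ENNReal.ofReal p).toReal⁻¹ * ENNReal.ofReal η)
        (𝓝[>] 0) (𝓝 (μ K ^ (ENNReal.ofReal p).toReal⁻¹ * ENNReal.ofReal 0)) :=
      ENNReal.Tendsto.const_mul
        ((ENNReal.continuous_ofReal.tendsto 0).mono_left nhdsWithin_le_nhds) (Or.inr hKpos)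
    rw [ENNReal.ofReal_zero, mul_zero] at this
    obtain ⟨η, h1, h2⟩ := ((ENNReal.tendsto_nhds_zero.1 this (ε / 3) (pos_iff_ne_zero.2 hε3)).and
      self_mem_nhdsWithin).exists
    exact ⟨η, h2, h1⟩
  obtain ⟨d, hd0, hd⟩ := Metric.uniformContinuous_iff.1
    (hgs.uniformContinuous_of_continuous hgc) η hη0
  filter_upwards [hφ.eventually (gt_mem_nhds (lt_min hd0 one_pos))] with i hi
  have hid : (φ i).rOut < d := hi.trans_le (min_le_left _ _)
  have hi1 : (φ i).rOut < 1 := hi.trans_le (min_le_right _ _)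
  have hfl := hf.locallyIntegrable hp1
  have hgl := hgm.locallyIntegrable hp1
  have hsplit : (φ i).normed μ ⋆[lsmul ℝ ℝ, μ] f - f =
      ((φ i).normed μ ⋆[lsmul ℝ ℝ, μ] (f - g)) + (-(f - g)) +
        ((φ i).normed μ ⋆[lsmul ℝ ℝ, μ] g - g) := by
    have h := ConvolutionExists.distrib_add (f := (φ i).normed μ)
      ((φ i).hasCompactSupport_normed.convolutionExists_left (lsmul ℝ ℝ)
        (φ i).continuous_normed (hfl.sub hgl))
      ((φ i).hasCompactSupport_normed.convolutionExists_left (lsmul ℝ ℝ)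
        (φ i).continuous_normed hgl)
    rw [sub_add_cancel] at h
    rw [h]
    abel
  have hAE : ∀ h : E → V, LocallyIntegrable h μ →
      AEStronglyMeasurable ((φ i).normed μ ⋆[lsmul ℝ ℝ, μ] h) μ := fun h hh =>
    ((φ i).hasCompactSupport_normed.continuous_convolution_left (lsmul ℝ ℝ)
      (φ i).continuous_normed hh).aestronglyMeasurable
  have h1 : eLpNorm ((φ i).normed μ ⋆[lsmul ℝ ℝ, μ] (f - g)) (ENNReal.ofReal p) μ ≤ ε / 3 :=
    (eLpNorm_normed_convolution_le (φ i) (hf.1.sub hgm.1) hp).trans hfg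
  have h2 : eLpNorm (-(f - g)) (ENNReal.ofReal p) μ ≤ ε / 3 := by rwa [eLpNorm_neg]
  have h3 : eLpNorm ((φ i).normed μ ⋆[lsmul ℝ ℝ, μ] g - g) (ENNReal.ofReal p) μ ≤ ε / 3 := by
    have hsupp : ∀ x ∉ K, ((φ i).normed μ ⋆[lsmul ℝ ℝ, μ] g - g) x = 0 := by
      intro x hx
      have hz : ∀ y ∈ Metric.ball x (φ i).rOut, g y = g x := by
        intro y hy
        have hgx : ∀ z, dist z x ≤ 1 → g z = 0 := fun z hz => by
          by_contra hne
          exact hx (Metric.mem_cthickening_of_dist_le x z 1 _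
            (subset_tsupport _ hne) (by rwa [dist_comm]))
        rw [hgx y ((Metric.mem_ball.1 hy).le.trans hi1.le), hgx x (by simp)]
      simp [(φ i).normed_convolution_eq_right hz]
    have hb : ∀ᵐ x ∂(μ.restrict K), ‖((φ i).normed μ ⋆[lsmul ℝ ℝ, μ] g - g) x‖ ≤ η := by
      refine ae_of_all _ fun x => ?_
      rw [Pi.sub_apply, ← dist_eq_norm]
      exact (φ i).dist_normed_convolution_le hgc.aestronglyMeasurable fun y hy =>
        (hd ((Metric.mem_ball.1 hy).trans hid)).le
    have := eLpNorm_le_of_ae_bound (p := ENNReal.ofReal p) hb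
    rw [eLpNorm_restrict_eq_of_support_subset
      (fun x hx => by by_contra hxK; exact hx (hsupp x hxK))] at this
    rw [Measure.restrict_apply_univ] at this
    exact this.trans hη
  rw [hsplit]
  calc _ ≤ ε / 3 + ε / 3 + ε / 3 :=
        (eLpNorm_add_le ((hAE _ (hfl.sub hgl)).add (hf.1.sub hgm.1).neg)
          ((hAE _ hgl).sub hgm.1) hp1).trans (add_le_add ((eLpNorm_add_le (hAE _ (hfl.sub hgl))
            (hf.1.sub hgm.1).neg hp1).trans (add_le_add h1 h2)) h3)
    _ = ε := ENNReal.add_thirds ε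

end Mollification

/-- Local Meyers-Serrin approximation: a Sobolev function is the `W^{1,γ}`-limit of smooth
functions near a compact subset of `Ω`. -/
theorem MemSobolevW1.exists_smooth_approx {n : ℕ} {Ω : Set (EuclideanSpace ℝ (Fin n))}
    (hΩ : IsOpen Ω) {γ : ℝ} (hγ : 1 ≤ γ) {u : EuclideanSpace ℝ (Fin n) → ℝ}
    {G : EuclideanSpace ℝ (Fin n) → EuclideanSpace ℝ (Fin n)} (h : MemSobolevW1 Ω γ u G)
    {K : Set (EuclideanSpace ℝ (Fin n))} (hK : IsCompact K) (hKΩ : K ⊆ Ω) :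
    ∃ v : ℕ → EuclideanSpace ℝ (Fin n) → ℝ, (∀ j, ContDiff ℝ ∞ (v j)) ∧
      Tendsto (fun j => eLpNorm (v j - u) (ENNReal.ofReal γ) (volume.restrict K)) atTop (𝓝 0) ∧
      Tendsto (fun j => eLpNorm (fun x => gradient (v j) x - G x) (ENNReal.ofReal γ)
        (volume.restrict K)) atTop (𝓝 0) := by
  have hγ1 : 1 ≤ ENNReal.ofReal γ := by simpa using hγ
  obtain ⟨d, hd0, hd⟩ := hK.exists_cthickening_subset_open hΩ hKΩ
  set U := Ω.indicator u with hU
  set H := Ω.indicator G with hH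
  have hUm : MemLp U (ENNReal.ofReal γ) volume := (memLp_indicator_iff_restrict hΩ.measurableSet).2 h.memLp
  have hHm : MemLp H (ENNReal.ofReal γ) volume :=
    (memLp_indicator_iff_restrict hΩ.measurableSet).2 h.memLp_grad
  have hUl := hUm.locallyIntegrable hγ1
  have hHl := hHm.locallyIntegrable hγ1
  let φ : ℕ → ContDiffBump (0 : EuclideanSpace ℝ (Fin n)) := fun j =>
    { rIn := d / (2 * (j + 2)), rOut := d / (j + 2), rIn_pos := by positivity,
      rIn_lt_rOut := by
        apply div_lt_div_of_pos_left hd0 (by positivity)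
        linarith [(Nat.cast_nonneg j : (0 : ℝ) ≤ j)] }
  have hφ : Tendsto (fun i => (φ i).rOut) atTop (𝓝 0) := by
    refine Tendsto.div_atTop tendsto_const_nhds ?_
    exact tendsto_atTop_add_const_right _ _ tendsto_natCast_atTop_atTop
  have hφd : ∀ j, (φ j).rOut ≤ d := fun j => by
    apply div_le_self hd0.le
    linarith [(Nat.cast_nonneg j : (0 : ℝ) ≤ j)]
  have hgrad : ∀ j, ∀ x ∈ K, gradient ((φ j).normed volume ⋆[lsmul ℝ ℝ, volume] U) x =
      ((φ j).normed volume ⋆[lsmul ℝ ℝ, volume] H) x := by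
    intro j x hx
    set ψ := (φ j).normed volume with hψ
    have hψs : ContDiff ℝ ∞ ψ := (φ j).contDiff_normed
    have hψc : HasCompactSupport ψ := (φ j).hasCompactSupport_normed
    refine HasGradientAt.gradient ?_
    rw [hasGradientAt_iff_hasFDerivAt]
    have h1 := hψc.hasFDerivAt_convolution_left (lsmul ℝ ℝ) (hψs.of_le (by simp)) hUl x
    refine h1.congr_fderiv (ContinuousLinearMap.ext fun w => Eq.symm ?_)
    -- `t ↦ ψ (x - t)` is an admissible test function because `x` stays away from `∂Ω`
    have htest : IsTestFunction Ω (fun t => ψ (x - t)) := by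
      have hts : tsupport (fun t => ψ (x - t)) ⊆ Metric.closedBall x d := by
        refine closure_minimal (fun t ht => ?_) Metric.isClosed_closedBall
        have : x - t ∈ Function.support ψ := ht
        rw [hψ, (φ j).support_normed_eq] at this
        rw [Metric.mem_closedBall, dist_comm, dist_eq_norm]
        rw [mem_ball_zero_iff] at this
        exact this.le.trans (hφd j)
      refine ⟨hψs.comp (contDiff_const.sub contDiff_id),
        HasCompactSupport.of_support_subset_isCompact (isCompact_closedBall x d)
          ((subset_tsupport _).trans hts), hts.trans fun t ht => hd ?_⟩
      exact Metric.mem_cthickening_of_dist_le t x d K hx ht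
    have h2 := h.hasWeakGradient.integral_eq _ htest w
    have h3 : ∀ t, fderiv ℝ (fun t => ψ (x - t)) t w = - fderiv ℝ ψ (x - t) w := by
      intro t
      have := ((hψs.differentiable (by simp)).differentiableAt (x := x - t)).hasFDerivAt.comp t
        ((hasFDerivAt_id t).const_sub x)
      have e := this.fderiv
      simp only [Function.comp_def] at e
      rw [e]; simp
    simp only [h3] at h2
    have e1 : (ψ ⋆[lsmul ℝ ℝ, volume] H) x = ∫ t, ψ (x - t) • H t := by
      rw [convolution_eq_swap]; rfl
    have e2 : ((fderiv ℝ ψ ⋆[(lsmul ℝ ℝ).precompL (EuclideanSpace ℝ (Fin n)), volume] U) x) w =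
        ∫ t, fderiv ℝ ψ (x - t) w * U t := by
      rw [convolution_eq_swap]
      rw [ContinuousLinearMap.integral_apply]
      · simp [precompL_apply]
      · exact convolutionExistsAt_iff_integrable_swap.1
          ((hψc.fderiv ℝ).convolutionExists_left _ (hψs.continuous_fderiv (by simp)) hUl x)
    have hint : Integrable (fun t => ψ (x - t) • H t) :=
      (convolutionExistsAt_iff_integrable_swap (L := lsmul ℝ ℝ)).1
          (hψc.convolutionExists_left _ hψs.continuous hHl x)
    have e3 : inner ℝ (∫ t, ψ (x - t) • H t) w = ∫ t, inner ℝ (ψ (x - t) • H t) w := by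
      simp only [real_inner_comm w]
      exact (integral_inner hint w).symm
    rw [e2, e1, InnerProductSpace.toDual_apply_apply, e3]
    have e4 : ∫ t, fderiv ℝ ψ (x - t) w * U t = ∫ t in Ω, fderiv ℝ ψ (x - t) w * u t := by
      rw [← integral_indicator hΩ.measurableSet]
      congr 1; ext t; by_cases ht : t ∈ Ω <;> simp [hU, ht]
    have e5 : ∫ t, inner ℝ (ψ (x - t) • H t) w = ∫ t in Ω, inner ℝ (G t) w * ψ (x - t) := by
      rw [← integral_indicator hΩ.measurableSet]
      congr 1; ext t; by_cases ht : t ∈ Ω <;> simp [hH, ht, inner_smul_left, mul_comm]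
    rw [e4, e5]
    simp only [mul_neg, integral_neg, neg_inj] at h2
    rw [← h2]
    simp only [mul_comm]
  refine ⟨fun j => (φ j).normed volume ⋆[lsmul ℝ ℝ, volume] U, fun j => ?_, ?_, ?_⟩
  · exact (φ j).hasCompactSupport_normed.contDiff_convolution_left _ (φ j).contDiff_normed hUl
  · refine tendsto_of_tendsto_of_tendsto_of_le_of_le tendsto_const_nhds
      (tendsto_eLpNorm_normed_convolution_sub hγ hUm hφ) (fun _ => zero_le) fun j => ?_
    refine le_trans (le_of_eq ?_) (eLpNorm_mono_measure _ (Measure.restrict_le_self (s := K)))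
    refine eLpNorm_congr_ae ((ae_restrict_iff' hK.measurableSet).2 (ae_of_all _ fun x hx => ?_))
    simp [hU, hKΩ hx]
  · refine tendsto_of_tendsto_of_tendsto_of_le_of_le tendsto_const_nhds
      (tendsto_eLpNorm_normed_convolution_sub hγ hHm hφ) (fun _ => zero_le) fun j => ?_
    refine le_trans (le_of_eq ?_) (eLpNorm_mono_measure _ (Measure.restrict_le_self (s := K)))
    refine eLpNorm_congr_ae ((ae_restrict_iff' hK.measurableSet).2 (ae_of_all _ fun x hx => ?_))
    simp [hH, hKΩ hx, hgrad j x hx]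

/-! ### Limits of test functions and Sobolev's inequality -/

section TestLimits

variable {n : ℕ}
local notation "𝔼" => EuclideanSpace ℝ (Fin n)

theorem norm_gradient_eq_norm_fderiv (φ : 𝔼 → ℝ) (x : 𝔼) : ‖gradient φ x‖ = ‖fderiv ℝ φ x‖ :=
  LinearIsometryEquiv.norm_map _ _

theorem continuous_gradient {φ : 𝔼 → ℝ} (h : ContDiff ℝ 1 φ) : Continuous (gradient φ) :=
  (LinearIsometryEquiv.continuous _).comp (h.continuous_fderiv one_ne_zero)

theorem gradient_eq_zero_of_notMem_tsupport {φ : 𝔼 → ℝ} {x : 𝔼} (hx : x ∉ tsupport φ) :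
    gradient φ x = 0 := by
  rw [← norm_eq_zero, norm_gradient_eq_norm_fderiv, norm_eq_zero]
  exact image_eq_zero_of_notMem_tsupport fun h => hx (tsupport_fderiv_subset ℝ h)

theorem IsTestFunction.continuous_gradient {Ω : Set 𝔼} {φ : 𝔼 → ℝ} (h : IsTestFunction Ω φ) :
    Continuous (gradient φ) :=
  _root_.continuous_gradient (h.contDiff.of_le (by simp))

theorem IsTestFunction.exists_bound {Ω : Set 𝔼} {φ : 𝔼 → ℝ} (h : IsTestFunction Ω φ) :
    ∃ M, 0 ≤ M ∧ ∀ x, |φ x| ≤ M ∧ ‖gradient φ x‖ ≤ M := by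
  obtain ⟨M₁, h1⟩ := h.contDiff.continuous.bounded_above_of_compact_support h.hasCompactSupport
  obtain ⟨M₂, h2⟩ := (h.contDiff.continuous_fderiv (by simp)).bounded_above_of_compact_support
    (h.hasCompactSupport.fderiv ℝ)
  refine ⟨max M₁ M₂, (norm_nonneg _).trans ((h1 0).trans (le_max_left _ _)), fun x =>
    ⟨(h1 x).trans (le_max_left _ _), ?_⟩⟩
  rw [norm_gradient_eq_norm_fderiv]
  exact (h2 x).trans (le_max_right _ _)

theorem IsTestFunction.memLp_gradient {Ω : Set 𝔼} {φ : 𝔼 → ℝ} (h : IsTestFunction Ω φ)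
    (p : ℝ≥0∞) : MemLp (gradient φ) p volume :=
  h.continuous_gradient.memLp_of_hasCompactSupport <|
    HasCompactSupport.of_support_subset_isCompact h.hasCompactSupport fun x hx => by
      by_contra hc
      exact hx (gradient_eq_zero_of_notMem_tsupport hc)

/-- The Sobolev conjugate exponent `γ* = (1/γ - 1/n)⁻¹ = nγ/(n-γ)`. -/
noncomputable def sobolevExponent (n : ℕ) (γ : ℝ) : ℝ := (γ⁻¹ - (n : ℝ)⁻¹)⁻¹

theorem sobolevExponent_inv (n : ℕ) (γ : ℝ) : (sobolevExponent n γ)⁻¹ = γ⁻¹ - (n : ℝ)⁻¹ :=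
  inv_inv _

theorem lt_sobolevExponent {γ : ℝ} (hγ : 1 < γ) (hγn : γ < n) : γ < sobolevExponent n γ := by
  have hγ0 : 0 < γ := by linarith
  have hn : (0 : ℝ) < n := hγ0.trans hγn
  have h1 : (n : ℝ)⁻¹ < γ⁻¹ := inv_strictAnti₀ hγ0 hγn
  rw [sobolevExponent, lt_inv_comm₀ hγ0 (by linarith)]
  have : 0 < (n : ℝ)⁻¹ := by positivity
  linarith

/-- `(φ, Φ)` is a limit of pairs `(φ_j, ∇φ_j)` with nonnegative test functions `φ_j` supported
in `K`: `φ_j → φ` almost everywhere and `∇φ_j → Φ` in `L^γ`. So `φ` is a nonnegative element of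
`W_0^{1,γ}(K)` with gradient `Φ`. -/
def IsTestLimit (Ω : Set (EuclideanSpace ℝ (Fin n))) (γ : ℝ) (K : Set (EuclideanSpace ℝ (Fin n)))
    (φ : EuclideanSpace ℝ (Fin n) → ℝ)
    (Φ : EuclideanSpace ℝ (Fin n) → EuclideanSpace ℝ (Fin n)) : Prop :=
  MemLp Φ (ENNReal.ofReal γ) volume ∧ ∃ w : ℕ → EuclideanSpace ℝ (Fin n) → ℝ,
    (∀ j, IsTestFunction Ω (w j)) ∧ (∀ j x, 0 ≤ w j x) ∧ (∀ j, tsupport (w j) ⊆ K) ∧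
    (∀ᵐ x, Tendsto (fun j => w j x) atTop (𝓝 (φ x))) ∧
    Tendsto (fun j => eLpNorm (fun x => gradient (w j) x - Φ x) (ENNReal.ofReal γ) volume)
      atTop (𝓝 0)

/-- The constant in the Gagliardo-Nirenberg-Sobolev inequality. -/
noncomputable def gnsConst (n : ℕ) (γ : ℝ) : ℝ≥0∞ :=
  SNormLESNormFDerivOfEqConst ℝ (volume : Measure (EuclideanSpace ℝ (Fin n))) γ.toNNReal

theorem gnsConst_ne_top (n : ℕ) (γ : ℝ) : gnsConst n γ ≠ ⊤ := ENNReal.coe_ne_top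

theorem eLpNorm_le_gnsConst_mul {γ : ℝ} (hγ : 1 < γ) (hγn : γ < n) {φ : 𝔼 → ℝ}
    (h1 : ContDiff ℝ 1 φ) (h2 : HasCompactSupport φ) :
    eLpNorm φ (ENNReal.ofReal (sobolevExponent n γ)) volume ≤
      gnsConst n γ * eLpNorm (gradient φ) (ENNReal.ofReal γ) volume := by
  have hs := (hγ.trans (lt_sobolevExponent hγ hγn))
  have hn : (0 : ℝ) < n := by linarith
  have h := eLpNorm_le_eLpNorm_fderiv_of_eq (volume : Measure 𝔼) h1 h2
    (p := γ.toNNReal) (p' := (sobolevExponent n γ).toNNReal)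
    (by simpa using hγ.le) (by simpa using hn)
    (by rw [NNReal.coe_inv, Real.coe_toNNReal γ (by linarith), Real.coe_toNNReal _ (by linarith),
          sobolevExponent_inv, finrank_euclideanSpace_fin])
  refine h.trans (le_of_eq ?_)
  congr 1
  exact eLpNorm_congr_norm_ae (ae_of_all _ fun x => (norm_gradient_eq_norm_fderiv φ x).symm)

/-- Sobolev's inequality for limits of test functions, together with the convergence of the
approximating functions in `L^{γ*}`. -/
theorem eLpNorm_sub_le_of_tendsto_gradient {γ : ℝ} (hγ : 1 < γ) (hγn : γ < n) {Ω : Set 𝔼}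
    {w : ℕ → 𝔼 → ℝ} {φ : 𝔼 → ℝ} {Φ : 𝔼 → 𝔼} (hΦ : MemLp Φ (ENNReal.ofReal γ) volume)
    (hw : ∀ j, IsTestFunction Ω (w j))
    (hae : ∀ᵐ x, Tendsto (fun j => w j x) atTop (𝓝 (φ x)))
    (hgr : Tendsto (fun j => eLpNorm (fun x => gradient (w j) x - Φ x) (ENNReal.ofReal γ) volume)
      atTop (𝓝 0)) (j : ℕ) :
    eLpNorm (fun x => w j x - φ x) (ENNReal.ofReal (sobolevExponent n γ)) volume ≤
      gnsConst n γ * eLpNorm (fun x => gradient (w j) x - Φ x) (ENNReal.ofReal γ) volume := by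
  have hγ1 : 1 ≤ ENNReal.ofReal γ := by simpa using hγ.le
  set a := fun j => eLpNorm (fun x => gradient (w j) x - Φ x) (ENNReal.ofReal γ) volume
  have hdiff : ∀ i x, gradient (fun x => w j x - w i x) x = gradient (w j) x - gradient (w i) x := by
    intro i x
    simp only [gradient]
    rw [fderiv_fun_sub ((hw j).contDiff.differentiable (by simp) x)
      ((hw i).contDiff.differentiable (by simp) x), map_sub]
  have hmeas : ∀ i, AEStronglyMeasurable (fun x => gradient (w i) x - Φ x) volume := fun i =>
    (hw i).continuous_gradient.aestronglyMeasurable.sub hΦ.1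
  have h1 : ∀ i, eLpNorm (fun x => w j x - w i x) (ENNReal.ofReal (sobolevExponent n γ)) volume ≤
      gnsConst n γ * (a j + a i) := by
    intro i
    refine (eLpNorm_le_gnsConst_mul hγ hγn
      (((hw j).contDiff.sub (hw i).contDiff).of_le (by simp))
      ((hw j).hasCompactSupport.sub (hw i).hasCompactSupport)).trans ?_
    gcongr
    calc _ = eLpNorm ((fun x => gradient (w j) x - Φ x) - (fun x => gradient (w i) x - Φ x))
          (ENNReal.ofReal γ) volume := by
          congr 1; ext1 x; simp [hdiff]
      _ ≤ _ := eLpNorm_sub_le (hmeas j) (hmeas i) hγ1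
  have h2 : Tendsto (fun i => gnsConst n γ * (a j + a i)) atTop (𝓝 (gnsConst n γ * (a j + 0))) :=
    ENNReal.Tendsto.const_mul (tendsto_const_nhds.add hgr) (Or.inr (gnsConst_ne_top n γ))
  rw [add_zero] at h2
  refine (Lp.eLpNorm_lim_le_liminf_eLpNorm (f := fun i x => w j x - w i x) (fun i =>
    ((hw j).contDiff.continuous.sub (hw i).contDiff.continuous).aestronglyMeasurable) _ ?_).trans ?_
  · filter_upwards [hae] with x hx using tendsto_const_nhds.sub hx
  · exact (liminf_le_liminf (Eventually.of_forall h1)).trans h2.liminf_eq.le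

theorem IsTestLimit.aestronglyMeasurable {Ω K : Set 𝔼} {γ : ℝ} {φ : 𝔼 → ℝ} {Φ : 𝔼 → 𝔼}
    (h : IsTestLimit Ω γ K φ Φ) : AEStronglyMeasurable φ volume := by
  obtain ⟨-, w, hw, -, -, hae, -⟩ := h
  exact aestronglyMeasurable_of_tendsto_ae atTop
    (fun j => (hw j).contDiff.continuous.aestronglyMeasurable) hae

/-- Sobolev's inequality in `W_0^{1,γ}`. -/
theorem IsTestLimit.eLpNorm_le {Ω K : Set 𝔼} {γ : ℝ} (hγ : 1 < γ) (hγn : γ < n) {φ : 𝔼 → ℝ}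
    {Φ : 𝔼 → 𝔼} (h : IsTestLimit Ω γ K φ Φ) :
    eLpNorm φ (ENNReal.ofReal (sobolevExponent n γ)) volume ≤
      gnsConst n γ * eLpNorm Φ (ENNReal.ofReal γ) volume := by
  have hγ1 : 1 ≤ ENNReal.ofReal γ := by simpa using hγ.le
  obtain ⟨hΦ, w, hw, -, -, hae, hgr⟩ := h
  set a := fun j => eLpNorm (fun x => gradient (w j) x - Φ x) (ENNReal.ofReal γ) volume
  have h1 : ∀ i, eLpNorm (w i) (ENNReal.ofReal (sobolevExponent n γ)) volume ≤
      gnsConst n γ * (a i + eLpNorm Φ (ENNReal.ofReal γ) volume) := by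
    intro i
    refine (eLpNorm_le_gnsConst_mul hγ hγn ((hw i).contDiff.of_le (by simp))
      (hw i).hasCompactSupport).trans ?_
    gcongr
    calc _ = eLpNorm ((fun x => gradient (w i) x - Φ x) + Φ) (ENNReal.ofReal γ) volume := by
          congr 1; ext1 x; simp
      _ ≤ _ := eLpNorm_add_le
        ((hw i).continuous_gradient.aestronglyMeasurable.sub hΦ.1) hΦ.1 hγ1
  have h2 : Tendsto (fun i => gnsConst n γ * (a i + eLpNorm Φ (ENNReal.ofReal γ) volume)) atTop
      (𝓝 (gnsConst n γ * (0 + eLpNorm Φ (ENNReal.ofReal γ) volume))) :=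
    ENNReal.Tendsto.const_mul (hgr.add tendsto_const_nhds) (Or.inr (gnsConst_ne_top n γ))
  rw [zero_add] at h2
  refine (Lp.eLpNorm_lim_le_liminf_eLpNorm (fun i =>
    (hw i).contDiff.continuous.aestronglyMeasurable) _ hae).trans ?_
  exact (liminf_le_liminf (Eventually.of_forall h1)).trans h2.liminf_eq.le

theorem IsTestLimit.memLp {Ω K : Set 𝔼} {γ : ℝ} (hγ : 1 < γ) (hγn : γ < n) {φ : 𝔼 → ℝ}
    {Φ : 𝔼 → 𝔼} (h : IsTestLimit Ω γ K φ Φ) :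
    MemLp φ (ENNReal.ofReal (sobolevExponent n γ)) volume :=
  ⟨h.aestronglyMeasurable, (h.eLpNorm_le hγ hγn).trans_lt
    (ENNReal.mul_lt_top (gnsConst_ne_top n γ).lt_top h.1.2)⟩

end TestLimits

theorem MeasureTheory.MemLp.integrable_real_inner {α V : Type*} [MeasurableSpace α] {μ : Measure α}
    [NormedAddCommGroup V] [InnerProductSpace ℝ V] {p q : ℝ≥0∞} [p.HolderConjugate q]
    {A Φ : α → V} (hA : MemLp A p μ) (hΦ : MemLp Φ q μ) :
    Integrable (fun x => inner ℝ (A x) (Φ x)) μ :=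
  memLp_one_iff_integrable.1 <| MemLp.of_bilin (p := p) (q := q) (fun a b : V => inner ℝ a b) 1 hA hΦ
    (hA.1.inner (𝕜 := ℝ) hΦ.1) (ae_of_all _ fun x => by
      simpa using nnnorm_inner_le_nnnorm (𝕜 := ℝ) (A x) (Φ x))

theorem tendsto_integral_inner_of_tendsto_eLpNorm {α V : Type*} [MeasurableSpace α] {μ : Measure α}
    [NormedAddCommGroup V] [InnerProductSpace ℝ V] {p q : ℝ≥0∞} [p.HolderConjugate q]
    {A Φ : α → V} {W : ℕ → α → V} (hA : MemLp A p μ) (hΦ : MemLp Φ q μ)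
    (hW : ∀ j, MemLp (W j) q μ)
    (h : Tendsto (fun j => eLpNorm (fun x => W j x - Φ x) q μ) atTop (𝓝 0)) :
    Tendsto (fun j => ∫ x, inner ℝ (A x) (W j x) ∂μ) atTop (𝓝 (∫ x, inner ℝ (A x) (Φ x) ∂μ)) := by
  refine tendsto_integral_of_L1' _ (hA.1.inner hΦ.1)
    (Eventually.of_forall fun j => hA.integrable_real_inner (hW j)) ?_
  have h2 : Tendsto (fun j => eLpNorm A p μ * eLpNorm (fun x => W j x - Φ x) q μ) atTop
      (𝓝 (eLpNorm A p μ * 0)) := ENNReal.Tendsto.const_mul h (Or.inr hA.2.ne)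
  rw [mul_zero] at h2
  refine tendsto_of_tendsto_of_tendsto_of_le_of_le tendsto_const_nhds h2 (fun _ => zero_le)
    fun j => ?_
  have h3 := eLpNorm_le_eLpNorm_mul_eLpNorm'_of_norm (p := p) (q := q) (r := 1) hA.1
    ((hW j).1.sub hΦ.1) (fun a b : V => inner ℝ a b) 1
    (ae_of_all _ fun x => by
      simpa using norm_inner_le_norm (𝕜 := ℝ) (A x) (W j x - Φ x))
  simp only [ENNReal.coe_one, one_mul] at h3
  refine le_trans (le_of_eq ?_) h3
  congr 1
  ext1 x
  simp [inner_sub_right]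

section Testing

variable {n : ℕ}
local notation "𝔼" => EuclideanSpace ℝ (Fin n)

/-- A differential inequality that holds for test functions extends to their `W_0^{1,γ}`-limits. -/
theorem IsTestLimit.integral_le {Ω K : Set 𝔼} (hΩ : IsOpen Ω) (hKΩ : K ⊆ Ω)
    {γ γ' σ : ℝ} (hγ : 1 < γ) (hγn : γ < n) (hγ' : γ'.HolderConjugate γ)
    (hσ : σ.HolderConjugate (sobolevExponent n γ)) {φ : 𝔼 → ℝ}
    {Φ : 𝔼 → 𝔼} (h : IsTestLimit Ω γ K φ Φ) {A F : 𝔼 → 𝔼} {f : 𝔼 → ℝ}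
    (hA : MemLp A (ENNReal.ofReal γ') (volume.restrict K))
    (hF : MemLp F (ENNReal.ofReal γ') (volume.restrict K))
    (hf : MemLp f (ENNReal.ofReal σ) (volume.restrict K))
    (hsub : ∀ φ : 𝔼 → ℝ, IsTestFunction Ω φ → (∀ x, 0 ≤ φ x) →
      ∫ x in Ω, inner ℝ (A x) (gradient φ x) ≤
        ∫ x in Ω, (inner ℝ (F x) (gradient φ x) + f x * φ x)) :
    IntegrableOn (fun x => inner ℝ (A x) (Φ x)) K ∧ IntegrableOn (fun x => inner ℝ (F x) (Φ x)) K ∧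
    IntegrableOn (fun x => f x * φ x) K ∧
    ∫ x in K, inner ℝ (A x) (Φ x) ≤ (∫ x in K, inner ℝ (F x) (Φ x)) + ∫ x in K, f x * φ x := by
  have : (ENNReal.ofReal γ').HolderConjugate (ENNReal.ofReal γ) := hγ'.ennrealOfReal
  have : (ENNReal.ofReal σ).HolderConjugate (ENNReal.ofReal (sobolevExponent n γ)) :=
    hσ.ennrealOfReal
  have hφm := (h.memLp hγ hγn).restrict K
  obtain ⟨hΦ, w, hw, hw0, hwK, hae, hgr⟩ := h
  have hΦm := hΦ.restrict K
  have hi : ∀ a b : ℝ, a * b = inner ℝ a b := fun a b => by simp [mul_comm]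
  have i3 : IntegrableOn (fun x => f x * φ x) K := by
    simp only [hi]
    exact hf.integrable_real_inner hφm
  refine ⟨hA.integrable_real_inner hΦm, hF.integrable_real_inner hΦm, i3, ?_⟩
  have hwm : ∀ j, MemLp (w j) (ENNReal.ofReal (sobolevExponent n γ)) (volume.restrict K) :=
    fun j => ((hw j).contDiff.continuous.memLp_of_hasCompactSupport
      (hw j).hasCompactSupport).restrict K
  have hgm : ∀ j, MemLp (gradient (w j)) (ENNReal.ofReal γ) (volume.restrict K) :=
    fun j => ((hw j).memLp_gradient _).restrict K
  have hgrK : Tendsto (fun j => eLpNorm (fun x => gradient (w j) x - Φ x) (ENNReal.ofReal γ)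
      (volume.restrict K)) atTop (𝓝 0) :=
    tendsto_of_tendsto_of_tendsto_of_le_of_le tendsto_const_nhds hgr (fun _ => zero_le)
      fun j => eLpNorm_mono_measure _ Measure.restrict_le_self
  have hwK' : Tendsto (fun j => eLpNorm (fun x => w j x - φ x)
      (ENNReal.ofReal (sobolevExponent n γ)) (volume.restrict K)) atTop (𝓝 0) := by
    have h2 := ENNReal.Tendsto.const_mul hgr (Or.inr (gnsConst_ne_top n γ))
    rw [mul_zero] at h2
    exact tendsto_of_tendsto_of_tendsto_of_le_of_le tendsto_const_nhds h2 (fun _ => zero_le)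
      fun j => (eLpNorm_mono_measure _ Measure.restrict_le_self).trans
        (eLpNorm_sub_le_of_tendsto_gradient hγ hγn hΦ hw hae hgr j)
  have t1 := tendsto_integral_inner_of_tendsto_eLpNorm hA hΦm hgm hgrK
  have t2 := tendsto_integral_inner_of_tendsto_eLpNorm hF hΦm hgm hgrK
  have t3 := tendsto_integral_inner_of_tendsto_eLpNorm hf hφm hwm hwK'
  simp only [← hi] at t3
  refine le_of_tendsto_of_tendsto' t1 (t2.add t3) fun j => ?_
  have hz : ∀ x ∈ Ω \ K, gradient (w j) x = 0 ∧ w j x = 0 := fun x hx =>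
    ⟨gradient_eq_zero_of_notMem_tsupport fun hc => hx.2 (hwK j hc),
      image_eq_zero_of_notMem_tsupport fun hc => hx.2 (hwK j hc)⟩
  have := hsub (w j) (hw j) (hw0 j)
  rw [setIntegral_eq_of_subset_of_forall_sdiff_eq_zero hΩ.measurableSet hKΩ
    (fun x hx => by rw [(hz x hx).1, inner_zero_right]),
    setIntegral_eq_of_subset_of_forall_sdiff_eq_zero hΩ.measurableSet hKΩ
    (fun x hx => by rw [(hz x hx).1, (hz x hx).2, inner_zero_right, mul_zero, add_zero])] at this
  refine this.trans (le_of_eq (integral_add (hF.integrable_real_inner (hgm j)) ?_))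
  simp only [hi]
  exact hf.integrable_real_inner (hwm j)

/-- The composition `ψ · g(u)` of a Sobolev function with a smooth contraction `g ≥ 0`, cut off by
a test function `ψ ≥ 0`, is a limit of test functions, with the expected gradient. -/
theorem MemSobolevW1.isTestLimit_mul_comp {Ω : Set 𝔼} (hΩ : IsOpen Ω) {γ : ℝ} (hγ : 1 < γ)
    {u : 𝔼 → ℝ} {G : 𝔼 → 𝔼} (h : MemSobolevW1 Ω γ u G) {ψ : 𝔼 → ℝ} (hψ : IsTestFunction Ω ψ)
    (hψ0 : ∀ x, 0 ≤ ψ x) {g : ℝ → ℝ} (hg : ContDiff ℝ ∞ g) (hg0 : ∀ t, 0 ≤ g t)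
    (hg' : ∀ t, |deriv g t| ≤ 1) :
    IsTestLimit Ω γ (tsupport ψ) (fun x => ψ x * g (u x))
      (fun x => g (u x) • gradient ψ x + (ψ x * deriv g (u x)) • G x) := by
  have hγ1 : 1 ≤ ENNReal.ofReal γ := by simpa using hγ.le
  have hγ0 : ENNReal.ofReal γ ≠ 0 := (zero_lt_one.trans_le hγ1).ne'
  set K := tsupport ψ with hKdef
  have hK : IsCompact K := hψ.hasCompactSupport
  have hKm : MeasurableSet K := hK.measurableSet
  have hKΩ : K ⊆ Ω := hψ.tsupport_subset
  obtain ⟨v₀, hv₀s, hv₀u, hv₀G⟩ := h.exists_smooth_approx hΩ hγ.le hK hKΩ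
  have huK : MemLp u (ENNReal.ofReal γ) (volume.restrict K) :=
    h.memLp.mono_measure (Measure.restrict_mono hKΩ le_rfl)
  have hGK : MemLp G (ENNReal.ofReal γ) (volume.restrict K) :=
    h.memLp_grad.mono_measure (Measure.restrict_mono hKΩ le_rfl)
  obtain ⟨ns, hns, hae⟩ := (tendstoInMeasure_of_tendsto_eLpNorm hγ0
    (fun j => (hv₀s j).continuous.aestronglyMeasurable) huK.1 hv₀u).exists_seq_tendsto_ae
  set v : ℕ → 𝔼 → ℝ := fun j => v₀ (ns j) with hv
  have hvs : ∀ j, ContDiff ℝ ∞ (v j) := fun j => hv₀s _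
  have hvu : Tendsto (fun j => eLpNorm (v j - u) (ENNReal.ofReal γ) (volume.restrict K)) atTop
    (𝓝 0) := hv₀u.comp hns.tendsto_atTop
  have hvG : Tendsto (fun j => eLpNorm (fun x => gradient (v j) x - G x) (ENNReal.ofReal γ)
    (volume.restrict K)) atTop (𝓝 0) := hv₀G.comp hns.tendsto_atTop
  obtain ⟨M, hM0, hM⟩ := hψ.exists_bound
  have hdg : Continuous (deriv g) := hg.continuous_deriv (by simp)
  have hlip : ∀ a b, |g a - g b| ≤ |a - b| := by
    intro a b
    have := Convex.norm_image_sub_le_of_norm_deriv_le (s := univ) (C := 1)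
      (fun x _ => hg.differentiable (by simp) x) (fun x _ => hg' x) convex_univ (mem_univ b)
      (mem_univ a)
    simpa using this
  set w : ℕ → 𝔼 → ℝ := fun j x => ψ x * g (v j x) with hw
  set Φ : 𝔼 → 𝔼 := fun x => g (u x) • gradient ψ x + (ψ x * deriv g (u x)) • G x with hΦ
  have hws : ∀ j, tsupport (w j) ⊆ K := fun j => closure_mono fun x hx => by
    simp only [hw, Function.mem_support] at hx ⊢
    exact left_ne_zero_of_mul hx
  have hwt : ∀ j, IsTestFunction Ω (w j) := fun j =>
    ⟨hψ.contDiff.mul (hg.comp (hvs j)), hψ.hasCompactSupport.mul_right, (hws j).trans hKΩ⟩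
  have hwg : ∀ j x, gradient (w j) x =
      g (v j x) • gradient ψ x + (ψ x * deriv g (v j x)) • gradient (v j) x := by
    intro j x
    have d1 : HasFDerivAt ψ (fderiv ℝ ψ x) x :=
      (hψ.contDiff.differentiable (by simp) x).hasFDerivAt
    have d2 : HasFDerivAt (v j) (fderiv ℝ (v j) x) x :=
      ((hvs j).differentiable (by simp) x).hasFDerivAt
    have d3 : HasDerivAt g (deriv g (v j x)) (v j x) :=
      (hg.differentiable (by simp) _).hasDerivAt
    have d4 := d1.mul (d3.comp_hasFDerivAt x d2)
    have e : fderiv ℝ (w j) x = _ := d4.fderiv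
    simp only [gradient, e, map_add, map_smul, Function.comp_apply, smul_smul]
    rw [add_comm]
  have hΦ0 : ∀ x ∉ K, Φ x = 0 := fun x hx => by
    simp [hΦ, gradient_eq_zero_of_notMem_tsupport hx, image_eq_zero_of_notMem_tsupport hx]
  have hΦind : Φ = K.indicator Φ := by
    ext1 x; by_cases hx : x ∈ K <;> simp [hx, hΦ0]
  have hΦm : AEStronglyMeasurable Φ volume := by
    rw [hΦind, aestronglyMeasurable_indicator_iff hKm]
    refine ((hg.continuous.comp_aestronglyMeasurable huK.1).smul
      hψ.continuous_gradient.aestronglyMeasurable).add (AEStronglyMeasurable.smul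
      (hψ.contDiff.continuous.aestronglyMeasurable.mul
        (hdg.comp_aestronglyMeasurable huK.1)) hGK.1)
  -- the part of `∇w_j - Φ` where only the argument of `g'` changes: dominated convergence
  have hdom : Tendsto (fun j => eLpNorm (fun x => (deriv g (v j x) - deriv g (u x)) • G x)
      (ENNReal.ofReal γ) (volume.restrict K)) atTop (𝓝 0) := by
    have hγr : 0 < γ := by linarith
    have hl : Tendsto (fun j => ∫⁻ x in K, ‖(deriv g (v j x) - deriv g (u x)) • G x‖ₑ ^ γ) atTop
        (𝓝 (∫⁻ _ in K, 0)) := by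
      refine tendsto_lintegral_of_dominated_convergence' (fun x => (2 * ‖G x‖ₑ) ^ γ)
        (fun j => ?_) (fun j => ae_of_all _ fun x => ?_) ?_ ?_
      · exact (((hdg.comp_aestronglyMeasurable (hvs j).continuous.aestronglyMeasurable).sub
          (hdg.comp_aestronglyMeasurable huK.1)).smul hGK.1).enorm.pow_const γ
      · refine ENNReal.rpow_le_rpow ?_ hγr.le
        rw [enorm_smul]
        gcongr
        rw [← ofReal_norm, ENNReal.ofReal_le_iff_le_toReal (by simp)]
        have h1 := abs_le.1 (hg' (v j x))
        have h2 := abs_le.1 (hg' (u x))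
        rw [Real.norm_eq_abs, ENNReal.toReal_ofNat]
        exact abs_le.2 ⟨by linarith, by linarith⟩
      · simp_rw [ENNReal.mul_rpow_of_nonneg _ _ hγr.le]
        rw [lintegral_const_mul'' _ (hGK.1.enorm.pow_const γ)]
        refine ENNReal.mul_ne_top (by simp) ?_
        have := (eLpNorm_lt_top_iff_lintegral_rpow_enorm_lt_top hγ0 ENNReal.ofReal_ne_top).1 hGK.2
        rw [ENNReal.toReal_ofReal hγr.le] at this
        exact this.ne
      · filter_upwards [hae] with x hx
        have h1 : Tendsto (fun j => (deriv g (v j x) - deriv g (u x)) • G x) atTop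
            (𝓝 ((deriv g (u x) - deriv g (u x)) • G x)) :=
          (((hdg.tendsto _).comp hx).sub_const _).smul_const _
        rw [sub_self, zero_smul] at h1
        have h2 := (ENNReal.continuous_rpow_const (y := γ)).tendsto 0 |>.comp
          ((continuous_enorm.tendsto (0 : 𝔼)).comp h1 |>.congr (fun _ => rfl) |>.trans
            (by rw [enorm_zero]))
        rwa [ENNReal.zero_rpow_of_pos hγr] at h2
    rw [lintegral_zero] at hl
    have h2 := ((ENNReal.continuous_rpow_const (y := 1 / γ)).tendsto 0).comp hl
    rw [ENNReal.zero_rpow_of_pos (by positivity)] at h2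
    refine h2.congr fun j => ?_
    rw [eLpNorm_eq_lintegral_rpow_enorm_toReal hγ0 ENNReal.ofReal_ne_top,
      ENNReal.toReal_ofReal hγr.le]
    rfl
  have hconv : Tendsto (fun j => eLpNorm (fun x => gradient (w j) x - Φ x) (ENNReal.ofReal γ)
      volume) atTop (𝓝 0) := by
    have hb : Tendsto (fun j => ENNReal.ofReal M *
        eLpNorm (v j - u) (ENNReal.ofReal γ) (volume.restrict K) + ENNReal.ofReal M *
        eLpNorm (fun x => gradient (v j) x - G x) (ENNReal.ofReal γ) (volume.restrict K) +
        ENNReal.ofReal M * eLpNorm (fun x => (deriv g (v j x) - deriv g (u x)) • G x)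
          (ENNReal.ofReal γ) (volume.restrict K)) atTop
        (𝓝 (ENNReal.ofReal M * 0 + ENNReal.ofReal M * 0 + ENNReal.ofReal M * 0)) :=
      ((ENNReal.Tendsto.const_mul hvu (Or.inr ENNReal.ofReal_ne_top)).add
        (ENNReal.Tendsto.const_mul hvG (Or.inr ENNReal.ofReal_ne_top))).add
        (ENNReal.Tendsto.const_mul hdom (Or.inr ENNReal.ofReal_ne_top))
    simp only [mul_zero, add_zero] at hb
    refine tendsto_of_tendsto_of_tendsto_of_le_of_le tendsto_const_nhds hb (fun _ => zero_le)
      fun j => ?_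
    have hsupp : Function.support (fun x => gradient (w j) x - Φ x) ⊆ K := fun x hx => by
      by_contra hc
      exact hx (by simp [hΦ0 x hc, gradient_eq_zero_of_notMem_tsupport fun h => hc (hws j h)])
    rw [← eLpNorm_restrict_eq_of_support_subset hsupp]
    have hvc := (hvs j).continuous
    have m1 : AEStronglyMeasurable (fun x => (g (v j x) - g (u x)) • gradient ψ x)
        (volume.restrict K) :=
      ((hg.continuous.comp hvc).aestronglyMeasurable.sub
        (hg.continuous.comp_aestronglyMeasurable huK.1)).smul
        hψ.continuous_gradient.aestronglyMeasurable
    have m2 : AEStronglyMeasurable (fun x => (ψ x * deriv g (v j x)) • (gradient (v j) x - G x))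
        (volume.restrict K) :=
      AEStronglyMeasurable.smul (hψ.contDiff.continuous.mul (hdg.comp hvc)).aestronglyMeasurable
        ((continuous_gradient ((hvs j).of_le (by simp))).aestronglyMeasurable.sub hGK.1)
    have m3 : AEStronglyMeasurable (fun x => ψ x • ((deriv g (v j x) - deriv g (u x)) • G x))
        (volume.restrict K) :=
      hψ.contDiff.continuous.aestronglyMeasurable.smul
        (((hdg.comp hvc).aestronglyMeasurable.sub
          (hdg.comp_aestronglyMeasurable huK.1)).smul hGK.1)
    have hsplit : (fun x => gradient (w j) x - Φ x) =
        (fun x => (g (v j x) - g (u x)) • gradient ψ x) +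
        (fun x => (ψ x * deriv g (v j x)) • (gradient (v j) x - G x)) +
        (fun x => ψ x • ((deriv g (v j x) - deriv g (u x)) • G x)) := by
      ext1 x
      simp only [Pi.add_apply, hwg, hΦ, smul_sub, sub_smul, mul_smul]
      abel
    rw [hsplit]
    refine (eLpNorm_add_le (m1.add m2) m3 hγ1).trans (add_le_add ((eLpNorm_add_le m1 m2 hγ1).trans
      (add_le_add ?_ ?_)) ?_)
    · refine eLpNorm_le_mul_eLpNorm_of_ae_le_mul (ae_of_all _ fun x => ?_) _
      rw [norm_smul, mul_comm]
      exact mul_le_mul (hM x).2 (hlip _ _) (abs_nonneg _) hM0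
    · refine eLpNorm_le_mul_eLpNorm_of_ae_le_mul (ae_of_all _ fun x => ?_) _
      rw [norm_smul, norm_mul]
      refine mul_le_mul_of_nonneg_right ?_ (norm_nonneg _)
      calc _ ≤ M * 1 := mul_le_mul (hM x).1 (hg' _) (abs_nonneg _) hM0
        _ = M := mul_one M
    · refine eLpNorm_le_mul_eLpNorm_of_ae_le_mul (ae_of_all _ fun x => ?_) _
      rw [norm_smul]
      exact mul_le_mul_of_nonneg_right (hM x).1 (norm_nonneg _)
  refine ⟨⟨hΦm, ?_⟩, w, hwt, fun j x => mul_nonneg (hψ0 x) (hg0 _), hws, ?_, hconv⟩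
  · obtain ⟨j, hj⟩ := (hconv.eventually (gt_mem_nhds zero_lt_one)).exists
    have hd : MemLp (fun x => gradient (w j) x - Φ x) (ENNReal.ofReal γ) volume :=
      ⟨(hwt j).continuous_gradient.aestronglyMeasurable.sub hΦm, hj.trans ENNReal.one_lt_top⟩
    have := ((hwt j).memLp_gradient (ENNReal.ofReal γ)).sub hd
    refine (this.ae_eq (ae_of_all _ fun x => ?_)).2
    simp
  · have hae' := (ae_restrict_iff' hKm).1 hae
    filter_upwards [hae'] with x hx
    by_cases hxK : x ∈ K
    · exact ((hg.continuous.tendsto _).comp (hx hxK)).const_mul _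
    · simp only [hw, image_eq_zero_of_notMem_tsupport hxK, zero_mul]
      exact tendsto_const_nhds

end Testing

/-! ### Bounds for the anisotropic integrand and its flux -/

namespace IsAnisotropicIntegrand

variable {n : ℕ}
local notation "𝔼" => EuclideanSpace ℝ (Fin n)
variable {Ω : Set (EuclideanSpace ℝ (Fin n))} {ν Λ : ℝ}
  {ρ : EuclideanSpace ℝ (Fin n) → EuclideanSpace ℝ (Fin n) → ℝ}

theorem eq_norm_mul (h : IsAnisotropicIntegrand Ω ν Λ ρ) {x ξ : 𝔼} (hx : x ∈ Ω) (hξ : ξ ≠ 0) :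
    ρ x ξ = ‖ξ‖ * ρ x (‖ξ‖⁻¹ • ξ) := by
  have hn : 0 < ‖ξ‖ := norm_pos_iff.2 hξ
  rw [← h.homogeneous x hx (‖ξ‖⁻¹ • ξ) (smul_ne_zero (inv_pos.2 hn).ne' hξ) _ hn,
    smul_inv_smul₀ hn.ne']

theorem norm_unit {ξ : 𝔼} (hξ : ξ ≠ 0) : ‖‖ξ‖⁻¹ • ξ‖ = 1 := by
  rw [norm_smul, norm_inv, norm_norm, inv_mul_cancel₀ (norm_ne_zero_iff.2 hξ)]

theorem mul_norm_le (h : IsAnisotropicIntegrand Ω ν Λ ρ) {x ξ : 𝔼} (hx : x ∈ Ω) (hξ : ξ ≠ 0) :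
    ν * ‖ξ‖ ≤ ρ x ξ := by
  rw [h.eq_norm_mul hx hξ, mul_comm]
  exact mul_le_mul_of_nonneg_left (h.lower_bound x hx _ (norm_unit hξ)) (norm_nonneg _)

theorem le_mul_norm (h : IsAnisotropicIntegrand Ω ν Λ ρ) {x ξ : 𝔼} (hx : x ∈ Ω) (hξ : ξ ≠ 0) :
    ρ x ξ ≤ Λ * ‖ξ‖ := by
  rw [h.eq_norm_mul hx hξ, mul_comm Λ]
  exact mul_le_mul_of_nonneg_left (h.upper_bound x hx _ (norm_unit hξ)) (norm_nonneg _)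

theorem hasFDerivAt (h : IsAnisotropicIntegrand Ω ν Λ ρ) {x ξ : 𝔼} (hx : x ∈ Ω) (hξ : ξ ≠ 0) :
    HasFDerivAt (ρ x) (fderiv ℝ (ρ x) ξ) ξ :=
  (((h.contDiffOn x hx).differentiableOn one_ne_zero).differentiableAt
    (isOpen_compl_singleton.mem_nhds hξ)).hasFDerivAt

theorem hasDerivAt_line (h : IsAnisotropicIntegrand Ω ν Λ ρ) {x ξ : 𝔼} (hx : x ∈ Ω) (hξ : ξ ≠ 0)
    (η : 𝔼) : HasDerivAt (fun t : ℝ => ρ x (ξ + t • η)) (inner ℝ (gradient (ρ x) ξ) η) 0 := by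
  rw [inner_gradient_left]
  have h1 : HasDerivAt (fun t : ℝ => ξ + t • η) η 0 := by
    simpa using ((hasDerivAt_id (0 : ℝ)).smul_const η).const_add ξ
  have h2 : HasFDerivAt (ρ x) (fderiv ℝ (ρ x) ξ) (ξ + (0 : ℝ) • η) := by
    simpa using h.hasFDerivAt hx hξ
  exact h2.comp_hasDerivAt 0 h1

/-- Euler's identity for the homogeneous function `ρ x`. -/
theorem inner_gradient_self (h : IsAnisotropicIntegrand Ω ν Λ ρ) {x ξ : 𝔼} (hx : x ∈ Ω)
    (hξ : ξ ≠ 0) : inner ℝ (gradient (ρ x) ξ) ξ = ρ x ξ := by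
  refine (h.hasDerivAt_line hx hξ ξ).unique ?_
  have h1 : HasDerivAt (fun t : ℝ => (1 + t) * ρ x ξ) (ρ x ξ) 0 := by
    simpa using ((hasDerivAt_id (0 : ℝ)).const_add 1).mul_const (ρ x ξ)
  refine h1.congr_of_eventuallyEq ?_
  filter_upwards [lt_mem_nhds (show (-1 : ℝ) < 0 by norm_num)] with t ht
  rw [← h.homogeneous x hx ξ hξ (1 + t) (by linarith), add_smul, one_smul]

/-- By subadditivity the difference quotients of `ρ x` in direction `η` are at most `ρ x η`. -/
theorem inner_gradient_le (h : IsAnisotropicIntegrand Ω ν Λ ρ) {x ξ : 𝔼} (hx : x ∈ Ω)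
    (hξ : ξ ≠ 0) (η : 𝔼) : inner ℝ (gradient (ρ x) ξ) η ≤ Λ * ‖η‖ := by
  have hρ := h.pos x hx ξ hξ
  by_cases hm : ∃ s : ℝ, η = s • ξ
  · obtain ⟨s, rfl⟩ := hm
    rw [inner_smul_right, h.inner_gradient_self hx hξ, norm_smul]
    calc s * ρ x ξ ≤ ‖s‖ * ρ x ξ := mul_le_mul_of_nonneg_right (le_abs_self s) hρ.le
      _ ≤ ‖s‖ * (Λ * ‖ξ‖) := mul_le_mul_of_nonneg_left (h.le_mul_norm hx hξ) (norm_nonneg _)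
      _ = _ := by ring
  · push Not at hm
    have hη : η ≠ 0 := by simpa using hm 0
    refine le_trans ?_ (h.le_mul_norm hx hη)
    have hd := (h.hasDerivAt_line hx hξ η).tendsto_slope_zero_right
    refine le_of_tendsto hd ?_
    filter_upwards [self_mem_nhdsWithin] with t ht
    have ht : (0 : ℝ) < t := ht
    have := h.strictly_subadditive x hx ξ (t • η) hξ (smul_ne_zero ht.ne' hη) (fun s hs => by
      rw [smul_smul] at hs
      have hst : s * t ≠ 0 := fun h0 => hξ (by rw [hs, h0, zero_smul])
      exact hm (s * t)⁻¹ (by rw [hs, smul_smul, inv_mul_cancel₀ hst, one_smul]))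
    rw [h.homogeneous x hx η hη t ht] at this
    simp only [zero_add, zero_smul, add_zero, smul_eq_mul]
    rw [inv_mul_le_iff₀ ht]
    linarith

theorem norm_gradient_le (h : IsAnisotropicIntegrand Ω ν Λ ρ) {x ξ : 𝔼} (hx : x ∈ Ω)
    (hξ : ξ ≠ 0) : ‖gradient (ρ x) ξ‖ ≤ Λ := by
  rcases (norm_nonneg (gradient (ρ x) ξ)).eq_or_lt with h0 | h0
  · rw [← h0]
    have := h.le_mul_norm hx hξ
    exact (pos_of_mul_pos_left ((h.pos x hx ξ hξ).trans_le this) (norm_nonneg ξ)).le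
  · have := h.inner_gradient_le hx hξ (gradient (ρ x) ξ)
    rw [real_inner_self_eq_norm_mul_norm] at this
    exact le_of_mul_le_mul_right this h0

theorem norm_flux_le (h : IsAnisotropicIntegrand Ω ν Λ ρ) {γ : ℝ} (hγ : 1 < γ) {x : 𝔼} (hx : x ∈ Ω)
    (hΛ : 0 < Λ) (ξ : 𝔼) : ‖anisotropicFlux γ ρ x ξ‖ ≤ Λ ^ γ * ‖ξ‖ ^ (γ - 1) := by
  unfold anisotropicFlux
  split_ifs with hξ
  · rw [norm_zero]; positivity
  · rw [norm_smul, Real.norm_of_nonneg (Real.rpow_nonneg (h.pos x hx ξ hξ).le _)]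
    calc _ ≤ (Λ * ‖ξ‖) ^ (γ - 1) * Λ :=
          mul_le_mul (Real.rpow_le_rpow (h.pos x hx ξ hξ).le (h.le_mul_norm hx hξ) (by linarith))
            (h.norm_gradient_le hx hξ) (norm_nonneg _) (by positivity)
      _ = Λ ^ (γ - 1) * Λ * ‖ξ‖ ^ (γ - 1) := by
          rw [Real.mul_rpow hΛ.le (norm_nonneg _)]; ring
      _ = _ := by rw [Real.rpow_sub_one hΛ.ne', div_mul_cancel₀ _ hΛ.ne']

theorem le_inner_flux (h : IsAnisotropicIntegrand Ω ν Λ ρ) {γ : ℝ} (hγ : 1 < γ) (hν : 0 < ν)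
    {x : 𝔼} (hx : x ∈ Ω) (ξ : 𝔼) : ν ^ γ * ‖ξ‖ ^ γ ≤ inner ℝ (anisotropicFlux γ ρ x ξ) ξ := by
  unfold anisotropicFlux
  split_ifs with hξ
  · simp [hξ, Real.zero_rpow (show γ ≠ 0 by linarith)]
  · have hρ := h.pos x hx ξ hξ
    rw [inner_smul_left, h.inner_gradient_self hx hξ, ← Real.mul_rpow hν.le (norm_nonneg _)]
    simp only [conj_trivial]
    rw [Real.rpow_sub_one hρ.ne', div_mul_cancel₀ _ hρ.ne']
    exact Real.rpow_le_rpow (by positivity) (h.mul_norm_le hx hξ) (by linarith)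

/-- The Euclidean norm is controlled by the dual norm, tested with `ξ = ζ / (2 Λ |ζ|)`. The set in the supremum is bounded because
`ν‖ξ‖ ≤ ρ x ξ`. -/
theorem norm_le_convexDual (h : IsAnisotropicIntegrand Ω ν Λ ρ) (hν : 0 < ν) (hΛ : 0 < Λ)
    {x : 𝔼} (hx : x ∈ Ω) (ζ : 𝔼) : ‖ζ‖ ≤ 2 * Λ * convexDual ρ x ζ := by
  by_cases hζ : ζ = 0
  · have : 0 ≤ convexDual ρ x ζ := Real.sSup_nonneg fun s => by
      rintro ⟨ξ, -, -, rfl⟩; simp [hζ]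
    rw [hζ] at this ⊢
    rw [norm_zero]; positivity
  have hζ0 : 0 < ‖ζ‖ := norm_pos_iff.2 hζ
  have hbdd : BddAbove {s : ℝ | ∃ ξ, ξ ≠ 0 ∧ ρ x ξ < 1 ∧ s = inner ℝ ξ ζ} := by
    refine ⟨ν⁻¹ * ‖ζ‖, ?_⟩
    rintro s ⟨ξ, hξ, h1, rfl⟩
    refine (real_inner_le_norm _ _).trans (mul_le_mul_of_nonneg_right ?_ (norm_nonneg _))
    rw [← one_div, le_div_iff₀' hν]
    exact ((h.mul_norm_le hx hξ).trans h1.le)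
  have hs0 : 0 < (2 * Λ)⁻¹ * ‖ζ‖⁻¹ := by positivity
  have hle : inner ℝ (((2 * Λ)⁻¹ * ‖ζ‖⁻¹) • ζ) ζ ≤ convexDual ρ x ζ := by
    refine le_csSup hbdd ⟨_, smul_ne_zero hs0.ne' hζ, ?_, rfl⟩
    rw [h.homogeneous x hx ζ hζ _ hs0]
    calc _ ≤ (2 * Λ)⁻¹ * ‖ζ‖⁻¹ * (Λ * ‖ζ‖) :=
          mul_le_mul_of_nonneg_left (h.le_mul_norm hx hζ) hs0.le
      _ = 1 / 2 := by field_simp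
      _ < 1 := by norm_num
  rw [inner_smul_left, real_inner_self_eq_norm_mul_norm] at hle
  simp only [conj_trivial] at hle
  have e : (2 * Λ)⁻¹ * ‖ζ‖⁻¹ * (‖ζ‖ * ‖ζ‖) = ‖ζ‖ / (2 * Λ) := by field_simp
  rw [e, div_le_iff₀ (by positivity)] at hle
  linarith

theorem continuous_ite_zero (h : IsAnisotropicIntegrand Ω ν Λ ρ) {x : 𝔼} (hx : x ∈ Ω) :
    Continuous (fun ξ : 𝔼 => if ξ = 0 then 0 else ρ x ξ) := by
  rw [continuous_iff_continuousAt]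
  intro ξ
  by_cases hξ : ξ = 0
  · subst hξ
    have : Tendsto (fun ξ : 𝔼 => Λ * ‖ξ‖) (𝓝 0) (𝓝 0) := by
      have h0 : Continuous fun ξ : 𝔼 => Λ * ‖ξ‖ := by fun_prop
      simpa using h0.tendsto 0
    simp only [ContinuousAt, if_true]
    refine tendsto_of_tendsto_of_tendsto_of_le_of_le tendsto_const_nhds this (fun ξ => ?_)
      (fun ξ => ?_)
    · dsimp only; split_ifs with h0
      · exact le_rfl
      · exact (h.pos x hx ξ h0).le
    · dsimp only; split_ifs with h0
      · simp [h0]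
      · exact h.le_mul_norm hx h0
  · refine (h.hasFDerivAt hx hξ).continuousAt.congr ?_
    filter_upwards [isOpen_compl_singleton.mem_nhds hξ] with η hη
    exact (if_neg hη).symm

/-- The hypotheses give measurability in `x` and continuity in `ξ`, so `ρ(·, H)` is a limit of
compositions with simple functions. -/
theorem aemeasurable_comp (h : IsAnisotropicIntegrand Ω ν Λ ρ) (hΩ : MeasurableSet Ω)
    {H : 𝔼 → 𝔼} (hH : AEMeasurable H (volume.restrict Ω)) :
    AEMeasurable (fun x => if H x = 0 then 0 else ρ x (H x)) (volume.restrict Ω) := by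
  wlog hm : Measurable H generalizing H
  · refine (this hH.measurable_mk.aemeasurable hH.measurable_mk).congr ?_
    filter_upwards [hH.ae_eq_mk] with x hx
    rw [hx]
  have hsm := hm.stronglyMeasurable
  have hc : ∀ ξ : 𝔼, AEMeasurable (fun x => if ξ = 0 then 0 else ρ x ξ) (volume.restrict Ω) := by
    intro ξ
    by_cases hξ : ξ = 0
    · simp [hξ]
    · simpa [hξ] using (h.memLp_top ξ hξ).1.aemeasurable
  refine aemeasurable_of_tendsto_metrizable_ae atTop
    (f := fun k x => if hsm.approx k x = 0 then 0 else ρ x (hsm.approx k x)) (fun k => ?_) ?_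
  · refine ⟨fun x => (hc (hsm.approx k x)).mk _ x,
      SimpleFunc.measurable_bind (hsm.approx k) (fun ξ => (hc ξ).mk _)
        (fun ξ => (hc ξ).measurable_mk), ?_⟩
    have := (ae_ball_iff (hsm.approx k).finite_range.countable).2
      (fun ξ _ => (hc ξ).ae_eq_mk)
    filter_upwards [this] with x hx
    exact hx _ ⟨x, rfl⟩
  · filter_upwards [ae_restrict_mem hΩ] with x hx
    exact ((h.continuous_ite_zero hx).tendsto (H x)).comp (hsm.tendsto_approx x)

/-- The components of the gradient are limits of difference quotients of `ρ x`, along the sequence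
`1 / (k + 1)`. -/
theorem aestronglyMeasurable_flux (h : IsAnisotropicIntegrand Ω ν Λ ρ) (hΩ : MeasurableSet Ω)
    (γ : ℝ) {G : 𝔼 → 𝔼} (hG : AEStronglyMeasurable G (volume.restrict Ω)) :
    AEStronglyMeasurable (fun x => anisotropicFlux γ ρ x (G x)) (volume.restrict Ω) := by
  let b := EuclideanSpace.basisFun (Fin n) ℝ
  have hGm := hG.aemeasurable
  have hdir : ∀ e : 𝔼, AEMeasurable
      (fun x => if G x = 0 then 0 else inner ℝ (gradient (ρ x) (G x)) e) (volume.restrict Ω) := by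
    intro e
    refine aemeasurable_of_tendsto_metrizable_ae atTop (f := fun (k : ℕ) x =>
      (G ⁻¹' {0})ᶜ.indicator (fun x => ((1 : ℝ) / (k + 1))⁻¹ *
        ((if G x + ((1 : ℝ) / (k + 1)) • e = 0 then 0 else ρ x (G x + ((1 : ℝ) / (k + 1)) • e)) -
          (if G x = 0 then 0 else ρ x (G x)))) x) (fun k => ?_) ?_
    · refine AEMeasurable.indicator₀ ?_ (hGm.nullMeasurable (measurableSet_singleton 0)).compl
      exact ((h.aemeasurable_comp hΩ (hGm.add_const _)).sub (h.aemeasurable_comp hΩ hGm)).const_mul _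
    · filter_upwards [ae_restrict_mem hΩ] with x hx
      by_cases h0 : G x = 0
      · simp [h0]
      · simp only [if_neg h0]
        have h1 : Tendsto (fun k : ℕ => (1 : ℝ) / (k + 1)) atTop (𝓝[>] 0) :=
          tendsto_nhdsWithin_iff.2 ⟨tendsto_one_div_add_atTop_nhds_zero_nat,
            Eventually.of_forall fun k => by simp only [mem_Ioi]; positivity⟩
        have hd := ((h.hasDerivAt_line hx h0 e).tendsto_slope_zero_right).comp h1
        have hne : Tendsto (fun k : ℕ => G x + ((1 : ℝ) / (k + 1)) • e) atTop (𝓝 (G x)) := by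
          have := (tendsto_one_div_add_atTop_nhds_zero_nat (𝕜 := ℝ)).smul_const e |>.const_add (G x)
          simpa using this
        refine hd.congr' ?_
        filter_upwards [hne.eventually (isOpen_compl_singleton.mem_nhds h0)] with k hk
        have hk : G x + ((1 : ℝ) / (k + 1)) • e ≠ 0 := hk
        rw [indicator_of_mem (by simpa using h0), if_neg hk, if_neg h0]
        simp
  have hexp : (fun x => anisotropicFlux γ ρ x (G x)) = fun x => ∑ i,
      ((if G x = 0 then 0 else ρ x (G x)) ^ (γ - 1) *
        (if G x = 0 then 0 else inner ℝ (gradient (ρ x) (G x)) (b i))) • b i := by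
    ext1 x
    rw [← b.sum_repr' (anisotropicFlux γ ρ x (G x))]
    refine Finset.sum_congr rfl fun i _ => ?_
    unfold anisotropicFlux
    by_cases h0 : G x = 0
    · simp [h0]
    · simp only [if_neg h0, inner_smul_right, real_inner_comm]
  rw [hexp]
  refine AEMeasurable.aestronglyMeasurable ?_
  refine Finset.aemeasurable_fun_sum _ fun i _ => ?_
  exact (((h.aemeasurable_comp hΩ hGm).pow_const _).mul (hdir (b i))).smul_const _

end IsAnisotropicIntegrand

/-! ### Truncations, cutoffs and the pointwise energy inequality -/

/-- A smooth convex replacement `g` for the truncation `t ↦ (t - k)⁺`, which it matches up to a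
shift by `d`. Convexity enters as `g t ≤ (t - k)⁺ g' t`. -/
theorem exists_smooth_truncation (k : ℝ) {d : ℝ} (hd : 0 < d) :
    ∃ g : ℝ → ℝ, ContDiff ℝ ∞ g ∧ (∀ t, 0 ≤ g t) ∧ (∀ t, 0 ≤ deriv g t) ∧ (∀ t, deriv g t ≤ 1) ∧
      (∀ t, t - (k + d) ≤ g t) ∧ (∀ t, g t ≤ max (t - k) 0 * deriv g t) ∧
      (∀ t ≤ k, deriv g t = 0) := by
  have hcont : Continuous Real.smoothTransition := Real.smoothTransition.continuous
  set g₀ : ℝ → ℝ := fun t => ∫ s in (0 : ℝ)..t, Real.smoothTransition s with hg₀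
  have hder₀ : ∀ t, HasDerivAt g₀ (Real.smoothTransition t) t := fun t =>
    intervalIntegral.integral_hasDerivAt_right (hcont.intervalIntegrable _ _)
      hcont.aestronglyMeasurable.stronglyMeasurableAtFilter hcont.continuousAt
  have hsm₀ : ContDiff ℝ ∞ g₀ := by
    rw [contDiff_infty_iff_deriv]
    refine ⟨fun t => (hder₀ t).differentiableAt, ?_⟩
    rw [show deriv g₀ = Real.smoothTransition from funext fun t => (hder₀ t).deriv]
    exact Real.smoothTransition.contDiff
  have hneg : ∀ t ≤ 0, g₀ t = 0 := by
    intro t ht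
    have : ∫ s in (0 : ℝ)..t, Real.smoothTransition s = ∫ s in (0 : ℝ)..t, (0 : ℝ) := by
      refine intervalIntegral.integral_congr fun s hs => ?_
      rw [uIcc_of_ge ht] at hs
      exact Real.smoothTransition.zero_of_nonpos hs.2
    simpa [hg₀] using this
  have hnn : ∀ t, 0 ≤ g₀ t := by
    intro t
    rcases le_total t 0 with ht | ht
    · rw [hneg t ht]
    · exact intervalIntegral.integral_nonneg ht fun s _ => Real.smoothTransition.nonneg s
  have hup : ∀ t, g₀ t ≤ max t 0 * Real.smoothTransition t := by
    intro t
    rcases le_total t 0 with ht | ht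
    · rw [hneg t ht, max_eq_right ht, zero_mul]
    · rw [max_eq_left ht]
      have := intervalIntegral.integral_mono_on (f := Real.smoothTransition)
        (g := fun _ => Real.smoothTransition t) (μ := volume) ht (hcont.intervalIntegrable _ _)
        (continuous_const.intervalIntegrable _ _)
        (fun s hs => Real.smoothTransition.monotone hs.2)
      simpa [hg₀] using this
  have hlow : ∀ t, t - 1 ≤ g₀ t := by
    intro t
    rcases le_total t 1 with ht | ht
    · linarith [hnn t]
    · have h1 : g₀ t = g₀ 1 + ∫ s in (1 : ℝ)..t, Real.smoothTransition s :=
        (intervalIntegral.integral_add_adjacent_intervals (hcont.intervalIntegrable _ _)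
          (hcont.intervalIntegrable _ _)).symm
      have h2 : ∫ s in (1 : ℝ)..t, Real.smoothTransition s = ∫ s in (1 : ℝ)..t, (1 : ℝ) := by
        refine intervalIntegral.integral_congr fun s hs => ?_
        rw [uIcc_of_le ht] at hs
        exact Real.smoothTransition.one_of_one_le hs.1
      rw [h2] at h1
      simp only [intervalIntegral.integral_const, smul_eq_mul, mul_one] at h1
      linarith [hnn 1]
  set g : ℝ → ℝ := fun t => d * g₀ ((t - k) / d) with hg
  have hder : ∀ t, HasDerivAt g (Real.smoothTransition ((t - k) / d)) t := by
    intro t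
    have h1 : HasDerivAt (fun t : ℝ => (t - k) / d) (1 / d) t :=
      ((hasDerivAt_id t).sub_const k).div_const d
    have h2 := ((hder₀ ((t - k) / d)).comp t h1).const_mul d
    refine h2.congr_deriv ?_
    field_simp
  have hdg : ∀ t, deriv g t = Real.smoothTransition ((t - k) / d) := fun t => (hder t).deriv
  refine ⟨g, contDiff_const.mul (hsm₀.comp ((contDiff_id.sub contDiff_const).div_const d)),
    fun t => mul_nonneg hd.le (hnn _), fun t => ?_, fun t => ?_, fun t => ?_, fun t => ?_,
    fun t ht => ?_⟩
  · rw [hdg]; exact Real.smoothTransition.nonneg _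
  · rw [hdg]; exact Real.smoothTransition.le_one _
  · have := mul_le_mul_of_nonneg_left (hlow ((t - k) / d)) hd.le
    have e : d * ((t - k) / d - 1) = t - (k + d) := by field_simp; ring
    linarith
  · rw [hdg]
    have := mul_le_mul_of_nonneg_left (hup ((t - k) / d)) hd.le
    rw [← mul_assoc, mul_max_of_nonneg _ _ hd.le, mul_zero, mul_div_cancel₀ _ hd.ne'] at this
    exact this
  · rw [hdg]
    exact Real.smoothTransition.zero_of_nonpos (div_nonpos_of_nonpos_of_nonneg (by linarith) hd.le)

/-- Cutoff functions whose gradient is controlled by a power of the cutoff itself: the `N`-th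
power of a cutoff, `N ≥ γ`. -/
theorem exists_cutoff (n : ℕ) {γ : ℝ} (hγ : 1 < γ) :
    ∃ M : ℝ, 0 < M ∧ ∀ (y : EuclideanSpace ℝ (Fin n)) (r R : ℝ), 0 < r → r < R →
      ∀ Ω : Set (EuclideanSpace ℝ (Fin n)), Metric.closedBall y R ⊆ Ω →
      ∃ ψ : EuclideanSpace ℝ (Fin n) → ℝ, IsTestFunction Ω ψ ∧
        tsupport ψ ⊆ Metric.closedBall y R ∧ (∀ x, 0 ≤ ψ x) ∧ (∀ x, ψ x ≤ 1) ∧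
        (∀ x ∈ Metric.closedBall y r, ψ x = 1) ∧
        ∀ x, ‖gradient ψ x‖ ≤ M * (R - r)⁻¹ * ψ x ^ ((γ - 1) / γ) := by
  have hsm : ContDiff ℝ ∞ Real.smoothTransition := Real.smoothTransition.contDiff
  obtain ⟨M₀, hM₀⟩ : ∃ M₀ : ℝ, ∀ t, |deriv Real.smoothTransition t| ≤ M₀ := by
    have hc : Continuous (deriv Real.smoothTransition) := hsm.continuous_deriv (by simp)
    have hs : HasCompactSupport (deriv Real.smoothTransition) := by
      refine HasCompactSupport.of_support_subset_isCompact (isCompact_Icc (a := (0 : ℝ)) (b := 1))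
        fun t ht => ?_
      by_contra hcon
      apply ht
      rcases lt_or_ge t 0 with h | h
      · have : Real.smoothTransition =ᶠ[𝓝 t] fun _ => 0 := by
          filter_upwards [gt_mem_nhds h] with s hs
          exact Real.smoothTransition.zero_of_nonpos hs.le
        rw [this.deriv_eq]; simp
      · have h1 : 1 < t := by
          by_contra h1
          exact hcon ⟨h, not_lt.1 h1⟩
        have : Real.smoothTransition =ᶠ[𝓝 t] fun _ => 1 := by
          filter_upwards [lt_mem_nhds h1] with s hs
          exact Real.smoothTransition.one_of_one_le hs.le
        rw [this.deriv_eq]; simp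
    exact hc.bounded_above_of_compact_support hs
  have hM₀0 : 0 ≤ M₀ := (abs_nonneg _).trans (hM₀ 0)
  set N := ⌈γ⌉₊ with hN
  have hNγ : γ ≤ N := Nat.le_ceil γ
  have hN1 : 1 ≤ N := Nat.one_le_iff_ne_zero.2 fun h => by
    rw [h] at hNγ; norm_num at hNγ; linarith
  refine ⟨N * (2 * M₀) + 1, by positivity, fun y r R hr hrR Ω hΩ => ?_⟩
  have hR : 0 < R := hr.trans hrR
  have hD : 0 < R ^ 2 - r ^ 2 := by nlinarith
  set s : EuclideanSpace ℝ (Fin n) → ℝ := fun x => (R ^ 2 - ‖x - y‖ ^ 2) / (R ^ 2 - r ^ 2) with hs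
  have hss : ContDiff ℝ ∞ s :=
    (contDiff_const.sub ((contDiff_id.sub contDiff_const).norm_sq ℝ)).div_const _
  set η : EuclideanSpace ℝ (Fin n) → ℝ := fun x => Real.smoothTransition (s x) with hη
  have hηs : ContDiff ℝ ∞ η := hsm.comp hss
  have hη0 : ∀ x, 0 ≤ η x := fun x => Real.smoothTransition.nonneg _
  have hη1 : ∀ x, η x ≤ 1 := fun x => Real.smoothTransition.le_one _
  have hηout : ∀ x ∉ Metric.closedBall y R, η x = 0 := by
    intro x hx
    rw [Metric.mem_closedBall, dist_eq_norm, not_le] at hx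
    refine Real.smoothTransition.zero_of_nonpos (div_nonpos_of_nonpos_of_nonneg ?_ hD.le)
    nlinarith
  have hηgrad : ∀ x, ‖fderiv ℝ η x‖ ≤ 2 * M₀ * (R - r)⁻¹ := by
    intro x
    by_cases hx : x ∈ Metric.closedBall y R
    · have h1 : HasFDerivAt s ((R ^ 2 - r ^ 2)⁻¹ •
        -((2 : ℕ) • (innerSL ℝ (x - y)) : EuclideanSpace ℝ (Fin n) →L[ℝ] ℝ)) x := by
        have h0 : HasFDerivAt (fun x : EuclideanSpace ℝ (Fin n) => x - y)
          (ContinuousLinearMap.id ℝ _) x := (hasFDerivAt_id x).sub_const y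
        have := (h0.norm_sq.const_sub (R ^ 2)).const_smul (R ^ 2 - r ^ 2)⁻¹
        refine (this.congr_of_eventuallyEq (Eventually.of_forall fun z => ?_)).congr_fderiv ?_
        · simp only [hs, smul_eq_mul, Pi.smul_apply]; rw [div_eq_inv_mul]
        · ext z; simp
      have h2 : HasFDerivAt η _ x :=
        (hsm.differentiable (by simp) (s x)).hasDerivAt.comp_hasFDerivAt x h1
      rw [h2.fderiv, norm_smul, norm_smul, norm_neg]
      have h3 : ‖((2 : ℕ) • (innerSL ℝ (x - y)) : EuclideanSpace ℝ (Fin n) →L[ℝ] ℝ)‖ ≤ 2 * R := by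
        rw [two_nsmul]
        refine (norm_add_le _ _).trans ?_
        rw [innerSL_apply_norm]
        rw [Metric.mem_closedBall, dist_eq_norm] at hx
        linarith
      rw [norm_inv, Real.norm_of_nonneg hD.le]
      calc _ ≤ M₀ * ((R ^ 2 - r ^ 2)⁻¹ * (2 * R)) := by
            refine mul_le_mul (hM₀ _) (mul_le_mul_of_nonneg_left h3 (by positivity))
              (by positivity) hM₀0
        _ ≤ 2 * M₀ * (R - r)⁻¹ := by
            have e : (R ^ 2 - r ^ 2)⁻¹ * R ≤ (R - r)⁻¹ := by
              rw [inv_mul_le_iff₀ hD, ← div_eq_mul_inv, le_div_iff₀ (by linarith)]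
              nlinarith
            calc _ = 2 * M₀ * ((R ^ 2 - r ^ 2)⁻¹ * R) := by ring
              _ ≤ _ := mul_le_mul_of_nonneg_left e (by positivity)
    · have : fderiv ℝ η x = 0 := by
        have h0 : η =ᶠ[𝓝 x] fun _ => 0 := by
          filter_upwards [Metric.isClosed_closedBall.isOpen_compl.mem_nhds hx] with z hz
          exact hηout z hz
        rw [h0.fderiv_eq]; simp
      rw [this, norm_zero]
      have : 0 < R - r := by linarith
      positivity
  have hts : tsupport (fun x => η x ^ N) ⊆ Metric.closedBall y R :=
    closure_minimal (fun x hx => by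
      by_contra hc
      exact hx (by simp only [hηout x hc]; exact zero_pow (by lia))) Metric.isClosed_closedBall
  refine ⟨fun x => η x ^ N, ⟨hηs.pow N, HasCompactSupport.of_support_subset_isCompact
    (isCompact_closedBall y R) ((subset_tsupport _).trans hts), hts.trans hΩ⟩, hts,
    fun x => pow_nonneg (hη0 x) N, fun x => pow_le_one₀ (hη0 x) (hη1 x), fun x hx => ?_,
    fun x => ?_⟩
  · have : η x = 1 := by
      refine Real.smoothTransition.one_of_one_le ((one_le_div hD).2 ?_)
      rw [Metric.mem_closedBall, dist_eq_norm] at hx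
      nlinarith [norm_nonneg (x - y)]
    simp [this]
  · rw [norm_gradient_eq_norm_fderiv]
    have h1 : HasFDerivAt (fun x => η x ^ N) _ x :=
      ((hηs.differentiable (by simp) x).hasFDerivAt).pow N
    rw [h1.fderiv, norm_smul]
    have hrr : 0 < (R - r)⁻¹ := inv_pos.2 (by linarith)
    have h2 : η x ^ (N - 1) ≤ (η x ^ N) ^ ((γ - 1) / γ) := by
      rw [← Real.rpow_natCast, ← Real.rpow_natCast, ← Real.rpow_mul (hη0 x)]
      rcases (hη0 x).eq_or_lt with h0 | h0
      · rw [← h0]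
        by_cases hN' : N - 1 = 0
        · have : (N : ℝ) = 1 := by
            have : N = 1 := by lia
            exact_mod_cast this
          rw [this] at hNγ; linarith
        · rw [Real.zero_rpow (by exact_mod_cast hN')]
          exact Real.rpow_nonneg le_rfl _
      · refine Real.rpow_le_rpow_of_exponent_ge h0 (hη1 x) ?_
        rw [Nat.cast_sub hN1, Nat.cast_one, mul_div_assoc', div_le_iff₀ (by linarith)]
        nlinarith
    have h0 : 0 ≤ (η x ^ N) ^ ((γ - 1) / γ) := Real.rpow_nonneg (pow_nonneg (hη0 x) N) _
    have h3 : ‖(N • η x ^ (N - 1) : ℝ)‖ ≤ N * (η x ^ N) ^ ((γ - 1) / γ) := by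
      rw [nsmul_eq_mul, Real.norm_of_nonneg (by have := hη0 x; positivity)]
      exact mul_le_mul_of_nonneg_left h2 (by positivity)
    calc _ ≤ (N * (η x ^ N) ^ ((γ - 1) / γ)) * (2 * M₀ * (R - r)⁻¹) :=
          mul_le_mul h3 (hηgrad x) (norm_nonneg _) (by positivity)
      _ = (N * (2 * M₀)) * (R - r)⁻¹ * (η x ^ N) ^ ((γ - 1) / γ) := by ring
      _ ≤ _ := by gcongr; linarith

/-- Young's inequality with a small parameter. -/
theorem exists_young_const {p q : ℝ} (hpq : p.HolderConjugate q) {ε : ℝ} (hε : 0 < ε) :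
    ∃ C : ℝ, 0 < C ∧ ∀ x y : ℝ, 0 ≤ x → 0 ≤ y → x * y ≤ ε * x ^ p + C * y ^ q := by
  set c := ε ^ p⁻¹ with hc
  have hc0 : 0 < c := Real.rpow_pos_of_pos hε _
  have hp := hpq.pos
  have hq := hpq.symm.pos
  refine ⟨(c⁻¹) ^ q, by positivity, fun x y hx hy => ?_⟩
  have h := Real.young_inequality_of_nonneg (a := c * x) (b := c⁻¹ * y) (by positivity)
    (by positivity) hpq
  rw [Real.mul_rpow hc0.le hx, Real.mul_rpow (by positivity) hy, hc, ← Real.rpow_mul hε.le,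
    inv_mul_cancel₀ hp.ne', Real.rpow_one, ← hc] at h
  have e : c * x * (c⁻¹ * y) = x * y := by field_simp
  rw [e] at h
  refine h.trans (add_le_add (div_le_self (by positivity) hpq.lt.le)
    (div_le_self (by positivity) hpq.symm.lt.le))

theorem add_rpow_le_two_rpow_mul {p x y : ℝ} (hp : 0 ≤ p) (hx : 0 ≤ x) (hy : 0 ≤ y) :
    (x + y) ^ p ≤ 2 ^ p * (x ^ p + y ^ p) := by
  have h1 : x + y ≤ 2 * max x y := by
    rw [two_mul]; exact add_le_add (le_max_left _ _) (le_max_right _ _)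
  refine (Real.rpow_le_rpow (by positivity) h1 hp).trans ?_
  rw [Real.mul_rpow (by norm_num) (by positivity)]
  refine mul_le_mul_of_nonneg_left ?_ (by positivity)
  rcases max_choice x y with h | h <;> rw [h]
  · linarith [Real.rpow_nonneg hy p]
  · linarith [Real.rpow_nonneg hx p]

/-- The pointwise form of Caccioppoli's inequality. Here `A = ρ^{γ-1} Dρ` is the flux, `θ = g'(u)`,
`g = g(u)` and `τ = (u - k)⁺`, so that `Φ = g ∇ψ + ψ θ G` is the gradient of `ψ g(u)`. -/
theorem exists_pointwise_energy_const {V : Type*} [NormedAddCommGroup V] [InnerProductSpace ℝ V]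
    {γ γ' a b : ℝ} (hγ : γ.HolderConjugate γ') (ha : 0 < a) (hb : 0 < b) :
    ∃ C D : ℝ, 0 < C ∧ 0 < D ∧ ∀ (A G F P : V) (f ψ θ g τ L : ℝ), a * ‖G‖ ^ γ ≤ inner ℝ A G →
      ‖A‖ ≤ b * ‖G‖ ^ (γ - 1) → 0 ≤ ψ → ψ ≤ 1 → 0 ≤ θ → θ ≤ 1 → 0 ≤ g → 0 ≤ τ → g ≤ τ * θ → 0 ≤ L →
      ‖P‖ ≤ L * ψ ^ ((γ - 1) / γ) →
      ‖g • P + (ψ * θ) • G‖ ^ γ ≤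
        C * (inner ℝ A (g • P + (ψ * θ) • G) - inner ℝ F (g • P + (ψ * θ) • G) - f * (ψ * g)) +
        D * ((L * τ) ^ γ + θ * ‖F‖ ^ γ' + |f| * τ) := by
  have hγ1 : 1 < γ := hγ.lt
  have hγ0 : 0 < γ := by linarith
  have hγ'0 : 0 < γ' := hγ.symm.pos
  have hconj : γ' * ((γ - 1) / γ) = 1 := by
    rw [hγ.conjugate_eq]; field_simp; exact div_self (by linarith)
  have hconj' : (γ - 1) * γ' = γ := by rw [hγ.conjugate_eq, mul_div_cancel₀ _ (by linarith)]
  obtain ⟨C₁, hC₁, h1⟩ := exists_young_const hγ.symm (ε := a / (4 * b)) (by positivity)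
  obtain ⟨C₂, hC₂, h2⟩ := exists_young_const hγ (ε := a / 4) (by positivity)
  obtain ⟨C₃, hC₃, h3⟩ := exists_young_const hγ.symm (ε := 1) one_pos
  set B := b * C₁ + C₂ + C₃ + 2 with hB
  refine ⟨2 ^ γ * (2 / a), 2 ^ γ * (2 / a * B + 1), by positivity, by positivity, ?_⟩
  intro A G F P f ψ θ g τ L hA1 hA2 hψ0 hψ1 hθ0 hθ1 hg0 hτ0 hgτ hL hP
  set Φ := g • P + (ψ * θ) • G with hΦ
  set w := ψ ^ ((γ - 1) / γ) with hw
  have hw0 : 0 ≤ w := Real.rpow_nonneg hψ0 _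
  have hw1 : w ≤ 1 := Real.rpow_le_one hψ0 hψ1 (div_nonneg (by linarith) hγ0.le)
  have hwγ : w ^ γ' = ψ := by
    rw [hw, ← Real.rpow_mul hψ0, mul_comm, hconj, Real.rpow_one]
  set m := ‖G‖ with hm
  have hm0 : 0 ≤ m := norm_nonneg _
  set E := ψ * θ * m ^ γ with hE
  have hE0 : 0 ≤ E := by positivity
  set T := (L * τ) ^ γ with hT
  have hT0 : 0 ≤ T := by positivity
  set S := θ * ‖F‖ ^ γ' with hS
  have hS0 : 0 ≤ S := by positivity
  have hgP : g * ‖P‖ ≤ θ * ((L * τ) * w) := by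
    calc _ ≤ (τ * θ) * (L * w) := mul_le_mul hgτ hP (norm_nonneg _) (by positivity)
      _ = _ := by ring
  -- the flux term
  have k1 : a * E - (a / 4 * E + b * C₁ * T) ≤ inner ℝ A Φ := by
    have e1 : inner ℝ A Φ = g * inner ℝ A P + ψ * θ * inner ℝ A G := by
      rw [hΦ, inner_add_right, inner_smul_right, inner_smul_right]
    have e2 : -(g * (‖A‖ * ‖P‖)) ≤ g * inner ℝ A P := by
      rw [← mul_neg]
      exact mul_le_mul_of_nonneg_left (neg_le_of_abs_le (abs_real_inner_le_norm A P)) hg0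
    have e3 : a * E ≤ ψ * θ * inner ℝ A G := by
      calc a * E = ψ * θ * (a * m ^ γ) := by rw [hE]; ring
        _ ≤ _ := mul_le_mul_of_nonneg_left hA1 (by positivity)
    have e4 : g * (‖A‖ * ‖P‖) ≤ a / 4 * E + b * C₁ * T := by
      have y1 := h1 (m ^ (γ - 1) * w) (L * τ) (by positivity) (by positivity)
      rw [Real.mul_rpow (by positivity) hw0, hwγ, ← Real.rpow_mul hm0, hconj'] at y1
      calc g * (‖A‖ * ‖P‖) = ‖A‖ * (g * ‖P‖) := by ring
        _ ≤ (b * m ^ (γ - 1)) * (θ * ((L * τ) * w)) :=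
            mul_le_mul hA2 hgP (by positivity) (by positivity)
        _ = b * θ * (m ^ (γ - 1) * w * (L * τ)) := by ring
        _ ≤ b * θ * (a / (4 * b) * (m ^ γ * ψ) + C₁ * T) :=
            mul_le_mul_of_nonneg_left y1 (by positivity)
        _ = a / 4 * E + θ * (b * C₁ * T) := by rw [hE]; field_simp
        _ ≤ a / 4 * E + 1 * (b * C₁ * T) := by gcongr
        _ = _ := by ring
    linarith only [e1, e2, e3, e4]
  -- the divergence part of the right-hand side
  have k2 : inner ℝ F Φ ≤ a / 4 * E + C₂ * S + S + C₃ * T := by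
    have e1 : inner ℝ F Φ ≤ ‖F‖ * (g * ‖P‖ + ψ * θ * m) := by
      refine (real_inner_le_norm F Φ).trans (mul_le_mul_of_nonneg_left ?_ (norm_nonneg _))
      refine (norm_add_le _ _).trans (le_of_eq ?_)
      rw [norm_smul, norm_smul, Real.norm_of_nonneg hg0, Real.norm_of_nonneg (by positivity)]
    have e2 : ‖F‖ * (g * ‖P‖) ≤ S + C₃ * T := by
      have y3 := h3 (‖F‖ * w) (L * τ) (by positivity) (by positivity)
      rw [Real.mul_rpow (norm_nonneg _) hw0, hwγ, one_mul] at y3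
      calc _ ≤ ‖F‖ * (θ * ((L * τ) * w)) := mul_le_mul_of_nonneg_left hgP (norm_nonneg _)
        _ = θ * (‖F‖ * w * (L * τ)) := by ring
        _ ≤ θ * (‖F‖ ^ γ' * ψ + C₃ * T) := mul_le_mul_of_nonneg_left y3 hθ0
        _ = S * ψ + θ * (C₃ * T) := by rw [hS]; ring
        _ ≤ S * 1 + 1 * (C₃ * T) := by gcongr
        _ = _ := by ring
    have e3 : ‖F‖ * (ψ * θ * m) ≤ a / 4 * E + C₂ * S := by
      have y2 := h2 m ‖F‖ hm0 (norm_nonneg _)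
      calc _ = ψ * θ * (m * ‖F‖) := by ring
        _ ≤ ψ * θ * (a / 4 * m ^ γ + C₂ * ‖F‖ ^ γ') :=
            mul_le_mul_of_nonneg_left y2 (by positivity)
        _ = a / 4 * E + ψ * (C₂ * S) := by rw [hE, hS]; ring
        _ ≤ a / 4 * E + 1 * (C₂ * S) := by gcongr
        _ = _ := by ring
    rw [mul_add] at e1
    linarith only [e1, e2, e3]
  have k3 : f * (ψ * g) ≤ |f| * τ := by
    refine (mul_le_mul_of_nonneg_right (le_abs_self f) (by positivity)).trans
      (mul_le_mul_of_nonneg_left ?_ (abs_nonneg _))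
    calc ψ * g ≤ 1 * (τ * 1) := mul_le_mul hψ1 (hgτ.trans (by gcongr)) hg0 zero_le_one
      _ = τ := by ring
  have hfτ : 0 ≤ |f| * τ := by positivity
  have k4 : ‖Φ‖ ^ γ ≤ 2 ^ γ * (T + E) := by
    have e1 : ‖Φ‖ ≤ L * τ + ψ * θ * m := by
      refine (norm_add_le _ _).trans ?_
      rw [norm_smul, norm_smul, Real.norm_of_nonneg hg0, Real.norm_of_nonneg (by positivity)]
      refine add_le_add (hgP.trans ?_) le_rfl
      calc θ * (L * τ * w) ≤ 1 * (L * τ * 1) := by gcongr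
        _ = _ := by ring
    refine (Real.rpow_le_rpow (norm_nonneg _) e1 hγ0.le).trans
      ((add_rpow_le_two_rpow_mul hγ0.le (by positivity) (by positivity)).trans ?_)
    refine mul_le_mul_of_nonneg_left (add_le_add le_rfl ?_) (by positivity)
    rw [Real.mul_rpow (by positivity) hm0]
    refine mul_le_mul_of_nonneg_right ?_ (by positivity)
    calc (ψ * θ) ^ γ ≤ (ψ * θ) ^ (1 : ℝ) :=
          Real.rpow_le_rpow_of_exponent_ge' (by positivity) (mul_le_one₀ hψ1 hθ0 hθ1)
            zero_le_one hγ1.le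
      _ = _ := Real.rpow_one _
  have hB0 : 0 < b * C₁ := mul_pos hb hC₁
  have hB1 : b * C₁ + C₃ ≤ B := by rw [hB]; linarith only [hC₂]
  have hB2 : C₂ + 1 ≤ B := by rw [hB]; linarith only [hB0, hC₃]
  have hB3 : 1 ≤ B := by linarith only [hB2, hC₂]
  set X := inner ℝ A Φ - inner ℝ F Φ - f * (ψ * g) with hX
  set Q := T + S + |f| * τ with hQ
  have k5 : a / 2 * E ≤ X + B * Q := by
    have p0 : a / 2 * E ≤ X + (b * C₁ + C₃) * T + (C₂ + 1) * S + |f| * τ := by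
      rw [hX]; linarith only [k1, k2, k3]
    have p1 := mul_le_mul_of_nonneg_right hB1 hT0
    have p2 := mul_le_mul_of_nonneg_right hB2 hS0
    have p3 := mul_le_mul_of_nonneg_right hB3 hfτ
    rw [hQ, mul_add, mul_add]
    linarith only [p0, p1, p2, p3]
  have k6 : E ≤ 2 / a * X + 2 / a * B * Q := by
    have := mul_le_mul_of_nonneg_left k5 (show 0 ≤ 2 / a by positivity)
    calc E = 2 / a * (a / 2 * E) := by field_simp
      _ ≤ _ := this
      _ = _ := by ring
  have hQT : T ≤ Q := by rw [hQ]; linarith only [hS0, hfτ]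
  calc _ ≤ _ := k4
    _ ≤ 2 ^ γ * (Q + (2 / a * X + 2 / a * B * Q)) :=
      mul_le_mul_of_nonneg_left (add_le_add hQT k6) (by positivity)
    _ = _ := by ring

/-! ### Caccioppoli's inequality -/

section Energy

variable {n : ℕ}
local notation "𝔼" => EuclideanSpace ℝ (Fin n)

theorem IsAnisotropicIntegrand.memLp_flux {Ω : Set 𝔼} {ν Λ : ℝ} {ρ : 𝔼 → 𝔼 → ℝ}
    (h : IsAnisotropicIntegrand Ω ν Λ ρ) (hΩ : MeasurableSet Ω) (hΛ : 0 < Λ) {γ γ' : ℝ}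
    (hγ : γ.HolderConjugate γ') {G : 𝔼 → 𝔼}
    (hG : MemLp G (ENNReal.ofReal γ) (volume.restrict Ω)) :
    MemLp (fun x => anisotropicFlux γ ρ x (G x)) (ENNReal.ofReal γ') (volume.restrict Ω) := by
  have hγ1 : 1 < γ := hγ.lt
  have h1 := (hG.norm_rpow_div (ENNReal.ofReal (γ - 1))).const_mul (Λ ^ γ)
  rw [ENNReal.toReal_ofReal (by linarith), ← ENNReal.ofReal_div_of_pos (by linarith),
    ← hγ.conjugate_eq] at h1
  refine h1.of_le (h.aestronglyMeasurable_flux hΩ γ hG.1) ?_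
  filter_upwards [ae_restrict_mem hΩ] with x hx
  refine (h.norm_flux_le hγ1 hx hΛ (G x)).trans (le_abs_self _)

/-- The truncation of a Sobolev function is locally in `L^{γ*}`. -/
theorem MemSobolevW1.eLpNorm_pos_part_lt_top {Ω : Set 𝔼} (hΩ : IsOpen Ω) {γ : ℝ} (hγ : 1 < γ)
    (hγn : γ < n) {u : 𝔼 → ℝ} {G : 𝔼 → 𝔼} (h : MemSobolevW1 Ω γ u G) {y : 𝔼} {r R : ℝ}
    (hr : 0 < r) (hrR : r < R) (hB : Metric.closedBall y R ⊆ Ω) :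
    eLpNorm (fun x => max (u x) 0) (ENNReal.ofReal (sobolevExponent n γ))
      (volume.restrict (Metric.closedBall y r)) < ⊤ := by
  obtain ⟨M, -, hcut⟩ := exists_cutoff n hγ
  obtain ⟨ψ, hψ, -, hψ0, -, hψr, -⟩ := hcut y r R hr hrR Ω hB
  obtain ⟨g, hgs, hg0, hg'0, hg'1, hglow, -, -⟩ := exists_smooth_truncation 0 one_pos
  have tl := h.isTestLimit_mul_comp hΩ hγ hψ hψ0 hgs hg0
    (fun t => by rw [abs_of_nonneg (hg'0 t)]; exact hg'1 t)
  have hm : MemLp (fun x => ψ x * g (u x) + 1) (ENNReal.ofReal (sobolevExponent n γ))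
      (volume.restrict (Metric.closedBall y r)) := by
    have : IsFiniteMeasure (volume.restrict (Metric.closedBall y r)) :=
      ⟨by rw [Measure.restrict_apply_univ]; exact measure_closedBall_lt_top⟩
    exact ((tl.memLp hγ hγn).restrict _).add (memLp_const 1)
  refine lt_of_le_of_lt (eLpNorm_mono_ae ?_) hm.2
  filter_upwards [ae_restrict_mem Metric.isClosed_closedBall.measurableSet] with x hx
  have h1 := hglow (u x)
  have h2 := hg0 (u x)
  rw [hψr x hx, one_mul, Real.norm_of_nonneg (le_max_right _ _),
    Real.norm_of_nonneg (by linarith)]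
  exact max_le (by linarith) (by linarith)

/-- Caccioppoli's inequality combined with Sobolev's: the `L^{γ*}` norm of a truncation of a
subsolution on a ball is controlled by lower-order quantities of a lower truncation on a larger
ball. -/
theorem exists_energy_const (n : ℕ) {γ γ' σ ν Λ : ℝ} (hγn : γ < n) (hγ : γ.HolderConjugate γ')
    (hσ : σ.HolderConjugate (sobolevExponent n γ)) (hν : 0 < ν) (hΛ : 0 < Λ) :
    ∃ C : ℝ, 0 < C ∧ ∀ (Ω : Set (EuclideanSpace ℝ (Fin n))), IsOpen Ω →
      ∀ (ρ : EuclideanSpace ℝ (Fin n) → EuclideanSpace ℝ (Fin n) → ℝ),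
        IsAnisotropicIntegrand Ω ν Λ ρ →
      ∀ (u : EuclideanSpace ℝ (Fin n) → ℝ)
        (F : EuclideanSpace ℝ (Fin n) → EuclideanSpace ℝ (Fin n))
        (f : EuclideanSpace ℝ (Fin n) → ℝ), IsSubsolution Ω γ ρ F f u →
      ∀ (y : EuclideanSpace ℝ (Fin n)) (r R : ℝ), 0 < r → r < R → Metric.closedBall y R ⊆ Ω →
        MemLp F (ENNReal.ofReal γ') (volume.restrict (Metric.closedBall y R)) →
        MemLp f (ENNReal.ofReal σ) (volume.restrict (Metric.closedBall y R)) →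
      ∀ (k d : ℝ), 0 < d →
        eLpNorm (fun x => max (u x - (k + d)) 0) (ENNReal.ofReal (sobolevExponent n γ))
            (volume.restrict (Metric.closedBall y r)) ^ γ ≤
          ENNReal.ofReal C * ∫⁻ x in Metric.closedBall y R, ENNReal.ofReal
            (((R - r)⁻¹ * max (u x - k) 0) ^ γ + (if k < u x then ‖F x‖ ^ γ' else 0) +
              |f x| * max (u x - k) 0) := by
  have hγ1 : 1 < γ := hγ.lt
  have hγ0 : 0 < γ := by linarith
  have hE0 : ENNReal.ofReal γ ≠ 0 := by simpa using hγ0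
  obtain ⟨M, hM, hcut⟩ := exists_cutoff n hγ1
  obtain ⟨C₀, D₀, hC₀, hD₀, hpt⟩ := exists_pointwise_energy_const
    (V := EuclideanSpace ℝ (Fin n)) hγ (a := ν ^ γ) (b := Λ ^ γ) (by positivity) (by positivity)
  set N := M ^ γ + 1 with hN
  refine ⟨(gnsConst n γ).toReal ^ γ * (D₀ * N) + 1, by positivity, ?_⟩
  intro Ω hΩ ρ hρ u F f ⟨G, hu, hsub⟩ y r R hr hrR hB hF hf k d hd
  obtain ⟨ψ, hψ, hψB, hψ0, hψ1, hψr, hψg⟩ := hcut y r R hr hrR Ω hB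
  obtain ⟨g, hgs, hg0, hg'0, hg'1, hglow, hgup, hgk⟩ := exists_smooth_truncation k hd
  have tl := hu.isTestLimit_mul_comp hΩ hγ1 hψ hψ0 hgs hg0
    (fun t => by rw [abs_of_nonneg (hg'0 t)]; exact hg'1 t)
  set K := tsupport ψ with hK
  have hKΩ : K ⊆ Ω := hψ.tsupport_subset
  have hKm : MeasurableSet K := (isClosed_tsupport ψ).measurableSet
  have hRr : 0 < (R - r)⁻¹ := inv_pos.2 (by linarith)
  set Φ := fun x => g (u x) • gradient ψ x + (ψ x * deriv g (u x)) • G x with hΦ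
  set A := fun x => anisotropicFlux γ ρ x (G x) with hA
  have hAm : MemLp A (ENNReal.ofReal γ') (volume.restrict K) :=
    (hρ.memLp_flux hΩ.measurableSet hΛ hγ hu.memLp_grad).mono_measure
      (Measure.restrict_mono hKΩ le_rfl)
  have hFK := hF.mono_measure (Measure.restrict_mono hψB le_rfl)
  have hfK := hf.mono_measure (Measure.restrict_mono hψB le_rfl)
  obtain ⟨i1, i2, i3, hle⟩ := tl.integral_le hΩ hKΩ hγ1 hγn hγ.symm hσ hAm hFK hfK hsub
  set H := fun x => (M * (R - r)⁻¹ * max (u x - k) 0) ^ γ + deriv g (u x) * ‖F x‖ ^ γ' +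
    |f x| * max (u x - k) 0 with hH
  set H' := fun x => ((R - r)⁻¹ * max (u x - k) 0) ^ γ + (if k < u x then ‖F x‖ ^ γ' else 0) +
    |f x| * max (u x - k) 0 with hH'
  have hτ : ∀ x, 0 ≤ max (u x - k) 0 := fun x => le_max_right _ _
  have hH0 : ∀ x, 0 ≤ H x := fun x => by
    have := hτ x
    have := hg'0 (u x)
    simp only [hH]; positivity
  have hHH' : ∀ x, H x ≤ N * H' x := by
    intro x
    have h1 := hτ x
    have hM1 : 0 < M ^ γ := by positivity
    have e1 : (M * (R - r)⁻¹ * max (u x - k) 0) ^ γ ≤ N * ((R - r)⁻¹ * max (u x - k) 0) ^ γ := by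
      rw [mul_assoc, Real.mul_rpow hM.le (by positivity)]
      exact mul_le_mul_of_nonneg_right (by linarith) (by positivity)
    have e2 : deriv g (u x) * ‖F x‖ ^ γ' ≤ N * (if k < u x then ‖F x‖ ^ γ' else 0) := by
      split_ifs with hku
      · exact mul_le_mul_of_nonneg_right ((hg'1 _).trans (by linarith)) (by positivity)
      · rw [hgk _ (not_lt.1 hku)]; simp
    have e3 : 1 * (|f x| * max (u x - k) 0) ≤ N * (|f x| * max (u x - k) 0) :=
      mul_le_mul_of_nonneg_right (by linarith) (by positivity)
    simp only [hH, hH', mul_add]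
    linarith
  have hpt' : ∀ x ∈ K, ‖Φ x‖ ^ γ ≤ C₀ * (inner ℝ (A x) (Φ x) - inner ℝ (F x) (Φ x) -
      f x * (ψ x * g (u x))) + D₀ * H x := fun x hx =>
    hpt (A x) (G x) (F x) (gradient ψ x) (f x) (ψ x) (deriv g (u x)) (g (u x)) (max (u x - k) 0)
      (M * (R - r)⁻¹) (hρ.le_inner_flux hγ1 hν (hKΩ hx) (G x))
      (hρ.norm_flux_le hγ1 (hKΩ hx) hΛ (G x)) (hψ0 x) (hψ1 x) (hg'0 _) (hg'1 _) (hg0 _) (hτ x)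
      (hgup _) (by positivity) (hψg x)
  have hHm : AEStronglyMeasurable H (volume.restrict K) := by
    have huK : AEMeasurable u (volume.restrict K) :=
      (hu.memLp.1.mono_measure (Measure.restrict_mono hKΩ le_rfl)).aemeasurable
    have hτm : AEMeasurable (fun x => max (u x - k) 0) (volume.restrict K) :=
      (huK.sub_const k).max aemeasurable_const
    have hdg : Measurable (deriv g) := (hgs.continuous_deriv (by simp)).measurable
    refine AEMeasurable.aestronglyMeasurable ?_
    exact (((hτm.const_mul _).pow_const γ).add ((hdg.comp_aemeasurable huK).mul
      (hFK.1.norm.aemeasurable.pow_const γ'))).add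
      ((continuous_abs.measurable.comp_aemeasurable hfK.1.aemeasurable).mul hτm)
  have hkey : ∫⁻ x, ‖Φ x‖ₑ ^ γ ≤ ENNReal.ofReal D₀ * ∫⁻ x in K, ENNReal.ofReal (H x) := by
    have hΦK : ∫⁻ x, ‖Φ x‖ₑ ^ γ = ∫⁻ x in K, ‖Φ x‖ₑ ^ γ := by
      refine (setLIntegral_eq_of_support_subset fun x hx => ?_).symm
      by_contra hc
      apply hx
      simp only [hΦ, gradient_eq_zero_of_notMem_tsupport hc, image_eq_zero_of_notMem_tsupport hc]
      simp [hγ0]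
    rw [hΦK]
    by_cases hfin : ∫⁻ x in K, ENNReal.ofReal (H x) = ⊤
    · rw [hfin, ENNReal.mul_top (by simpa using hD₀)]; exact le_top
    have hHi : IntegrableOn H K :=
      (lintegral_ofReal_ne_top_iff_integrable hHm (ae_of_all _ hH0)).1 hfin
    have hΦi : IntegrableOn (fun x => ‖Φ x‖ ^ γ) K := by
      have := (tl.1.restrict K).integrable_norm_rpow hE0 ENNReal.ofReal_ne_top
      rwa [ENNReal.toReal_ofReal hγ0.le] at this
    have i12 : IntegrableOn (fun x => inner ℝ (A x) (Φ x) - inner ℝ (F x) (Φ x)) K := i1.sub i2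
    have i123 : IntegrableOn (fun x => C₀ * (inner ℝ (A x) (Φ x) - inner ℝ (F x) (Φ x) -
        f x * (ψ x * g (u x)))) K := (i12.sub i3).const_mul _
    have hI : ∫ x in K, ‖Φ x‖ ^ γ ≤ D₀ * ∫ x in K, H x := by
      have h1 : ∫ x in K, ‖Φ x‖ ^ γ ≤ ∫ x in K, (C₀ * (inner ℝ (A x) (Φ x) -
          inner ℝ (F x) (Φ x) - f x * (ψ x * g (u x))) + D₀ * H x) :=
        setIntegral_mono_on hΦi (i123.add (hHi.const_mul _)) hKm hpt'
      rw [integral_add i123 (hHi.const_mul _),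
        integral_const_mul, integral_const_mul, integral_sub i12 i3,
        integral_sub i1 i2] at h1
      have h2 : C₀ * ((∫ x in K, inner ℝ (A x) (Φ x)) - (∫ x in K, inner ℝ (F x) (Φ x)) -
          ∫ x in K, f x * (ψ x * g (u x))) ≤ 0 :=
        mul_nonpos_of_nonneg_of_nonpos hC₀.le (by linarith)
      linarith
    have e1 : ∫⁻ x in K, ‖Φ x‖ₑ ^ γ = ENNReal.ofReal (∫ x in K, ‖Φ x‖ ^ γ) := by
      rw [ofReal_integral_eq_lintegral_ofReal hΦi (ae_of_all _ fun x => by positivity)]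
      refine lintegral_congr fun x => ?_
      rw [← ENNReal.ofReal_rpow_of_nonneg (norm_nonneg _) hγ0.le, ofReal_norm]
    rw [e1, ← ofReal_integral_eq_lintegral_ofReal hHi (ae_of_all _ hH0),
      ← ENNReal.ofReal_mul hD₀.le]
    exact ENNReal.ofReal_le_ofReal hI
  have hHB : ∫⁻ x in K, ENNReal.ofReal (H x) ≤
      ENNReal.ofReal N * ∫⁻ x in Metric.closedBall y R, ENNReal.ofReal (H' x) := by
    rw [← lintegral_const_mul' _ _ ENNReal.ofReal_ne_top]
    refine (lintegral_mono_set hψB).trans (lintegral_mono fun x => ?_)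
    rw [← ENNReal.ofReal_mul (by positivity)]
    exact ENNReal.ofReal_le_ofReal (hHH' x)
  have hT : eLpNorm (fun x => max (u x - (k + d)) 0) (ENNReal.ofReal (sobolevExponent n γ))
      (volume.restrict (Metric.closedBall y r)) ≤
      gnsConst n γ * eLpNorm Φ (ENNReal.ofReal γ) volume := by
    refine le_trans ?_ (tl.eLpNorm_le hγ1 hγn)
    refine le_trans (eLpNorm_mono_ae ?_) (eLpNorm_mono_measure _ Measure.restrict_le_self)
    filter_upwards [ae_restrict_mem Metric.isClosed_closedBall.measurableSet] with x hx
    rw [hψr x hx, one_mul, Real.norm_of_nonneg (le_max_right _ _), Real.norm_of_nonneg (hg0 _)]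
    exact max_le (hglow _) (hg0 _)
  have hΦγ : eLpNorm Φ (ENNReal.ofReal γ) volume ^ γ = ∫⁻ x, ‖Φ x‖ₑ ^ γ := by
    rw [eLpNorm_eq_lintegral_rpow_enorm_toReal hE0 ENNReal.ofReal_ne_top,
      ENNReal.toReal_ofReal hγ0.le, ← ENNReal.rpow_mul, one_div, inv_mul_cancel₀ hγ0.ne',
      ENNReal.rpow_one]
  calc _ ≤ (gnsConst n γ * eLpNorm Φ (ENNReal.ofReal γ) volume) ^ γ :=
        ENNReal.rpow_le_rpow hT hγ0.le
    _ = gnsConst n γ ^ γ * ∫⁻ x, ‖Φ x‖ₑ ^ γ := by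
        rw [ENNReal.mul_rpow_of_nonneg _ _ hγ0.le, hΦγ]
    _ ≤ gnsConst n γ ^ γ * (ENNReal.ofReal D₀ * (ENNReal.ofReal N *
          ∫⁻ x in Metric.closedBall y R, ENNReal.ofReal (H' x))) := by
        gcongr
        exact hkey.trans (by gcongr)
    _ = ENNReal.ofReal ((gnsConst n γ).toReal ^ γ * (D₀ * N)) *
          ∫⁻ x in Metric.closedBall y R, ENNReal.ofReal (H' x) := by
        rw [ENNReal.ofReal_mul (by positivity), ENNReal.ofReal_mul hD₀.le,
          ← ENNReal.ofReal_rpow_of_nonneg ENNReal.toReal_nonneg hγ0.le,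
          ENNReal.ofReal_toReal (gnsConst_ne_top n γ)]
        ring
    _ ≤ _ := by gcongr; linarith

end Energy

/-! ### One step of De Giorgi's iteration -/

/-- The relations between the exponents of the iteration: `s = q/γ'` is the integrability of `f`
and of `|F|^γ'`, the iteration runs in `L^m` with `m = γ s'`, and `α = 1 - m/γ* > 0` is the gain,
which scales like `δ`. -/
structure DeGiorgiExponents (n : ℕ) (γ γ' q s s' m δ α : ℝ) : Prop where
  dim_pos : (0 : ℝ) < n
  conj : γ.HolderConjugate γ'
  conj_s : s.HolderConjugate s'
  q_eq : q = s * γ'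
  m_eq : m = γ * s'
  m_lt : m < sobolevExponent n γ
  δ_eq : γ * δ = γ - n / s
  α_eq : α = 1 - m / sobolevExponent n γ
  δ_pos : 0 < δ
  α_mul : n / m * α = δ

/-- Membership of `u` in the De Giorgi class on the ball `B_R(y)`: on concentric balls, the
truncations of `u` satisfy the Caccioppoli-Sobolev inequality with data `F`, `f`. -/
def IsDeGiorgiClass {n : ℕ} (γ γ' C : ℝ) (u : EuclideanSpace ℝ (Fin n) → ℝ)
    (F : EuclideanSpace ℝ (Fin n) → EuclideanSpace ℝ (Fin n)) (f : EuclideanSpace ℝ (Fin n) → ℝ)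
    (y : EuclideanSpace ℝ (Fin n)) (R : ℝ) : Prop :=
  ∀ r R' : ℝ, 0 < r → r < R' → R' ≤ R → ∀ k d : ℝ, 0 < d →
    eLpNorm (fun x => max (u x - (k + d)) 0) (ENNReal.ofReal (sobolevExponent n γ))
        (volume.restrict (Metric.closedBall y r)) ^ γ ≤
      ENNReal.ofReal C * ∫⁻ x in Metric.closedBall y R', ENNReal.ofReal
        (((R' - r)⁻¹ * max (u x - k) 0) ^ γ + (if k < u x then ‖F x‖ ^ γ' else 0) +
          |f x| * max (u x - k) 0)

/-- `L^m` norms gain from the smallness of the support. -/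
theorem eLpNorm_le_eLpNorm_mul_measure_support {α V : Type*} [MeasurableSpace α]
    [NormedAddCommGroup V] {μ : Measure α} {m g : ℝ} (hm : 0 < m) (hmg : m ≤ g) {f : α → V}
    (hf : AEStronglyMeasurable f μ) :
    eLpNorm f (ENNReal.ofReal m) μ ≤
      eLpNorm f (ENNReal.ofReal g) μ * μ (Function.support f) ^ (1 / m - 1 / g) := by
  have h := eLpNorm_le_eLpNorm_mul_rpow_measure_univ (μ := μ.restrict (Function.support f))
    (ENNReal.ofReal_le_ofReal hmg) hf.restrict
  rwa [eLpNorm_restrict_eq_of_support_subset subset_rfl,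
    eLpNorm_restrict_eq_of_support_subset subset_rfl, Measure.restrict_apply_univ,
    ENNReal.toReal_ofReal hm.le, ENNReal.toReal_ofReal (hm.le.trans hmg)] at h

/-- The volume of the unit ball. -/
noncomputable def unitBallVolume (n : ℕ) : ℝ :=
  (volume (Metric.ball (0 : EuclideanSpace ℝ (Fin n)) 1)).toReal

theorem volume_closedBall_eq {n : ℕ} (y : EuclideanSpace ℝ (Fin n)) {R : ℝ} (hR : 0 ≤ R) :
    volume (Metric.closedBall y R) = ENNReal.ofReal (R ^ (n : ℝ) * unitBallVolume n) := by
  rw [Measure.addHaar_closedBall _ _ hR, finrank_euclideanSpace_fin, ← Real.rpow_natCast,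
    ENNReal.ofReal_mul (by positivity), unitBallVolume,
    ENNReal.ofReal_toReal measure_ball_lt_top.ne]

namespace DeGiorgiExponents

variable {n : ℕ} {γ γ' q s s' m δ α : ℝ}

theorem γ_pos (e : DeGiorgiExponents n γ γ' q s s' m δ α) : 0 < γ := e.conj.pos
theorem s_pos (e : DeGiorgiExponents n γ γ' q s s' m δ α) : 0 < s := e.conj_s.pos
theorem m_pos (e : DeGiorgiExponents n γ γ' q s s' m δ α) : 0 < m := by
  rw [e.m_eq]; exact mul_pos e.γ_pos e.conj_s.symm.pos
theorem α_pos (e : DeGiorgiExponents n γ γ' q s s' m δ α) : 0 < α := by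
  rw [e.α_eq, sub_pos, div_lt_one (e.m_pos.trans e.m_lt)]; exact e.m_lt

/-- The potential `b` that absorbs the right-hand side at levels comparable to `κ` is bounded in
`L^s` with the natural scaling. -/
theorem eLpNorm_potential_le (e : DeGiorgiExponents n γ γ' q s s' m δ α) {R κ : ℝ} (hR : 0 < R)
    (hκ : 0 < κ) {y : EuclideanSpace ℝ (Fin n)}
    {F : EuclideanSpace ℝ (Fin n) → EuclideanSpace ℝ (Fin n)} {f : EuclideanSpace ℝ (Fin n) → ℝ}
    (hFm : AEStronglyMeasurable F (volume.restrict (Metric.closedBall y R)))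
    (hfm : AEStronglyMeasurable f (volume.restrict (Metric.closedBall y R)))
    (hF : eLpNorm F (ENNReal.ofReal q) (volume.restrict (Metric.closedBall y R)) ≤
      ENNReal.ofReal (κ ^ (γ - 1) * R ^ (-δ * (γ - 1))))
    (hf : eLpNorm f (ENNReal.ofReal s) (volume.restrict (Metric.closedBall y R)) ≤
      ENNReal.ofReal (κ ^ (γ - 1) * R ^ (-δ * γ))) :
    eLpNorm (fun x => (R ^ γ)⁻¹ + (κ ^ γ)⁻¹ * ‖F x‖ ^ γ' + (κ ^ (γ - 1))⁻¹ * |f x|)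
        (ENNReal.ofReal s) (volume.restrict (Metric.closedBall y R)) ≤
      ENNReal.ofReal ((unitBallVolume n ^ (1 / s) + 2) * R ^ (-δ * γ)) := by
  set μ := volume.restrict (Metric.closedBall y R)
  have hs1 : 1 ≤ ENNReal.ofReal s := by simpa using e.conj_s.lt.le
  have hs0 : ENNReal.ofReal s ≠ 0 := (zero_lt_one.trans_le hs1).ne'
  have hω : 0 ≤ unitBallVolume n := ENNReal.toReal_nonneg
  have hγ' : 0 < γ' := e.conj.symm.pos
  have hγ1 : (γ - 1) * γ' = γ := by
    rw [e.conj.conjugate_eq, mul_div_cancel₀ _ (by linarith [e.conj.lt])]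
  have m1 : AEStronglyMeasurable (fun x => (κ ^ γ)⁻¹ * ‖F x‖ ^ γ') μ :=
    ((hFm.norm.aemeasurable.pow_const γ').const_mul _).aestronglyMeasurable
  have m2 : AEStronglyMeasurable (fun x => (κ ^ (γ - 1))⁻¹ * |f x|) μ :=
    hfm.norm.const_mul _
  have b0 : eLpNorm (fun _ : EuclideanSpace ℝ (Fin n) => (R ^ γ)⁻¹) (ENNReal.ofReal s) μ ≤
      ENNReal.ofReal (unitBallVolume n ^ (1 / s) * R ^ (-δ * γ)) := by
    rw [eLpNorm_const' _ hs0 ENNReal.ofReal_ne_top, Measure.restrict_apply_univ,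
      volume_closedBall_eq y hR.le, ENNReal.toReal_ofReal e.s_pos.le,
      ENNReal.ofReal_rpow_of_nonneg (by positivity) (by have := e.s_pos; positivity),
      Real.enorm_of_nonneg (by positivity), ← ENNReal.ofReal_mul (by positivity)]
    refine ENNReal.ofReal_le_ofReal (le_of_eq ?_)
    rw [Real.mul_rpow (by positivity) hω, ← Real.rpow_mul hR.le, ← Real.rpow_neg hR.le,
      ← mul_assoc, ← Real.rpow_add hR, mul_comm]
    congr 2
    have := e.δ_eq
    rw [mul_one_div]; linarith
  have b1 : eLpNorm (fun x => (κ ^ γ)⁻¹ * ‖F x‖ ^ γ') (ENNReal.ofReal s) μ ≤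
      ENNReal.ofReal (R ^ (-δ * γ)) := by
    have h1 := eLpNorm_const_smul (κ ^ γ)⁻¹ (fun x => ‖F x‖ ^ γ') (ENNReal.ofReal s) μ
    rw [eLpNorm_norm_rpow F hγ', ← ENNReal.ofReal_mul e.s_pos.le, ← e.q_eq] at h1
    refine (le_of_eq h1).trans ?_
    rw [Real.enorm_of_nonneg (by positivity)]
    refine (mul_le_mul_right (ENNReal.rpow_le_rpow hF hγ'.le) _).trans (le_of_eq ?_)
    rw [ENNReal.ofReal_rpow_of_nonneg (by positivity) hγ'.le, ← ENNReal.ofReal_mul (by positivity),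
      Real.mul_rpow (by positivity) (by positivity), ← Real.rpow_mul hκ.le, ← Real.rpow_mul hR.le,
      hγ1, mul_assoc (-δ), hγ1, inv_mul_cancel_left₀ (by positivity)]
  have b2 : eLpNorm (fun x => (κ ^ (γ - 1))⁻¹ * |f x|) (ENNReal.ofReal s) μ ≤
      ENNReal.ofReal (R ^ (-δ * γ)) := by
    have h1 := eLpNorm_const_smul (κ ^ (γ - 1))⁻¹ (fun x => ‖f x‖) (ENNReal.ofReal s) μ
    rw [eLpNorm_norm] at h1
    refine (le_of_eq h1).trans ?_
    rw [Real.enorm_of_nonneg (by positivity)]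
    refine (mul_le_mul_right hf _).trans (le_of_eq ?_)
    rw [← ENNReal.ofReal_mul (by positivity), inv_mul_cancel_left₀ (by positivity)]
  calc _ ≤ _ := (eLpNorm_add_le (aestronglyMeasurable_const.add m1) m2 hs1).trans
        (add_le_add_left (eLpNorm_add_le aestronglyMeasurable_const m1 hs1) _)
    _ ≤ ENNReal.ofReal (unitBallVolume n ^ (1 / s) * R ^ (-δ * γ)) +
        ENNReal.ofReal (R ^ (-δ * γ)) + ENNReal.ofReal (R ^ (-δ * γ)) :=
      add_le_add (add_le_add b0 b1) b2
    _ = _ := by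
      rw [← ENNReal.ofReal_add (by positivity) (by positivity),
        ← ENNReal.ofReal_add (by positivity) (by positivity)]
      congr 1; ring

/-- One step of De Giorgi's iteration, in scale-invariant form: passing from the level `l` to
`l + 2κθ` and from the radius `R'` to `R' - θR`, the normalized norm
`a = ‖(u - l)⁺‖_m / (κ R^{n/m})` becomes at most `C θ^{-(1+α)} a^{1+α}`. -/
theorem deGiorgi_step (e : DeGiorgiExponents n γ γ' q s s' m δ α) {C : ℝ} (hC : 0 < C) {R κ : ℝ}
    (hR : 0 < R) (hκ : 0 < κ) {y : EuclideanSpace ℝ (Fin n)} {u : EuclideanSpace ℝ (Fin n) → ℝ}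
    {F : EuclideanSpace ℝ (Fin n) → EuclideanSpace ℝ (Fin n)} {f : EuclideanSpace ℝ (Fin n) → ℝ}
    (hu : AEStronglyMeasurable u (volume.restrict (Metric.closedBall y R)))
    (hFm : AEStronglyMeasurable F (volume.restrict (Metric.closedBall y R)))
    (hfm : AEStronglyMeasurable f (volume.restrict (Metric.closedBall y R)))
    (hF : eLpNorm F (ENNReal.ofReal q) (volume.restrict (Metric.closedBall y R)) ≤
      ENNReal.ofReal (κ ^ (γ - 1) * R ^ (-δ * (γ - 1))))
    (hf : eLpNorm f (ENNReal.ofReal s) (volume.restrict (Metric.closedBall y R)) ≤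
      ENNReal.ofReal (κ ^ (γ - 1) * R ^ (-δ * γ)))
    (hE : IsDeGiorgiClass γ γ' C u F f y R) {r R' θ l a : ℝ} (hr : 0 < r) (hR' : R' ≤ R)
    (hθ : 0 < θ) (hθ1 : θ ≤ 1) (hrR : R' - r = R * θ) (ha : 0 ≤ a)
    (hZ : eLpNorm (fun x => max (u x - l) 0) (ENNReal.ofReal m)
      (volume.restrict (Metric.closedBall y R')) ≤ ENNReal.ofReal (κ * R ^ (n / m) * a)) :
    eLpNorm (fun x => max (u x - (l + 2 * (κ * θ))) 0) (ENNReal.ofReal m)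
      (volume.restrict (Metric.closedBall y r)) ≤
      ENNReal.ofReal (κ * R ^ (n / m) * ((C * (unitBallVolume n ^ (1 / s) + 2)) ^ (1 / γ) *
        (θ⁻¹ * a) ^ (1 + α))) := by
  have hγ0 := e.γ_pos
  have hγ1 : 1 < γ := e.conj.lt
  have hm0 := e.m_pos
  have hα0 := e.α_pos
  have hω : 0 ≤ unitBallVolume n := ENNReal.toReal_nonneg
  set N := unitBallVolume n ^ (1 / s) + 2 with hN
  have hN0 : 0 < N := by positivity
  have hrR' : r < R' := by have : 0 < R * θ := by positivity
                           linarith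
  set B' := Metric.closedBall y R' with hB'
  set τ : EuclideanSpace ℝ (Fin n) → ℝ := fun x => max (u x - l) 0 with hτ
  have hτ0 : ∀ x, 0 ≤ τ x := fun x => le_max_right _ _
  set b : EuclideanSpace ℝ (Fin n) → ℝ :=
    fun x => (R ^ γ)⁻¹ + (κ ^ γ)⁻¹ * ‖F x‖ ^ γ' + (κ ^ (γ - 1))⁻¹ * |f x| with hb
  have hb0 : ∀ x, 0 ≤ b x := fun x => by positivity
  have hmono : volume.restrict B' ≤ volume.restrict (Metric.closedBall y R) :=
    Measure.restrict_mono (Metric.closedBall_subset_closedBall hR') le_rfl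
  have hτm : AEStronglyMeasurable τ (volume.restrict B') :=
    (((hu.mono_measure hmono).aemeasurable.sub_const l).max
      aemeasurable_const).aestronglyMeasurable
  have hbm : AEMeasurable b (volume.restrict B') :=
    (aemeasurable_const.add (((hFm.mono_measure hmono).norm.aemeasurable.pow_const
      γ').const_mul _)).add ((hfm.mono_measure hmono).norm.aemeasurable.const_mul _)
  -- above the level `l + κθ` the truncation `τ` is at least `κθ`
  have hpt : ∀ x, ((R' - r)⁻¹ * max (u x - (l + κ * θ)) 0) ^ γ +
      (if l + κ * θ < u x then ‖F x‖ ^ γ' else 0) + |f x| * max (u x - (l + κ * θ)) 0 ≤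
      (θ ^ γ)⁻¹ * (b x * τ x ^ γ) := by
    intro x
    have hκθ : 0 < κ * θ := by positivity
    have hτle : max (u x - (l + κ * θ)) 0 ≤ τ x := max_le_max (by linarith) le_rfl
    have hτnn : 0 ≤ max (u x - (l + κ * θ)) 0 := le_max_right _ _
    have e1 : ((R' - r)⁻¹ * max (u x - (l + κ * θ)) 0) ^ γ ≤
        (θ ^ γ)⁻¹ * ((R ^ γ)⁻¹ * τ x ^ γ) := by
      rw [hrR, Real.mul_rpow (by positivity) hτnn, Real.inv_rpow (by positivity),
        Real.mul_rpow hR.le hθ.le, mul_inv, mul_comm (R ^ γ)⁻¹, mul_assoc]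
      gcongr
    have e2 : (if l + κ * θ < u x then ‖F x‖ ^ γ' else 0) ≤
        (θ ^ γ)⁻¹ * ((κ ^ γ)⁻¹ * ‖F x‖ ^ γ' * τ x ^ γ) := by
      split_ifs with hx
      · have hx' : κ * θ ≤ τ x := le_max_of_le_left (by linarith)
        have h1 : κ ^ γ * θ ^ γ ≤ τ x ^ γ := by
          rw [← Real.mul_rpow hκ.le hθ.le]; exact Real.rpow_le_rpow hκθ.le hx' hγ0.le
        calc ‖F x‖ ^ γ' = (θ ^ γ)⁻¹ * ((κ ^ γ)⁻¹ * ‖F x‖ ^ γ' * (κ ^ γ * θ ^ γ)) := by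
              field_simp
          _ ≤ _ := by gcongr
      · have := hτ0 x; positivity
    have e3 : |f x| * max (u x - (l + κ * θ)) 0 ≤
        (θ ^ γ)⁻¹ * ((κ ^ (γ - 1))⁻¹ * |f x| * τ x ^ γ) := by
      rcases le_or_gt (u x) (l + κ * θ) with hx | hx
      · rw [max_eq_right (by linarith), mul_zero]
        have := hτ0 x; positivity
      · have hx' : κ * θ ≤ τ x := le_max_of_le_left (by linarith)
        have hτpos : 0 < τ x := hκθ.trans_le hx'
        have h1 : κ ^ (γ - 1) * θ ^ γ ≤ τ x ^ (γ - 1) := by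
          calc κ ^ (γ - 1) * θ ^ γ ≤ κ ^ (γ - 1) * θ ^ (γ - 1) := by
                gcongr ?_ * ?_
                exact Real.rpow_le_rpow_of_exponent_ge hθ hθ1 (by linarith)
            _ = (κ * θ) ^ (γ - 1) := (Real.mul_rpow hκ.le hθ.le).symm
            _ ≤ _ := Real.rpow_le_rpow hκθ.le hx' (by linarith)
        have h2 : τ x ^ γ = τ x ^ (γ - 1) * τ x := by
          rw [Real.rpow_sub_one hτpos.ne', div_mul_cancel₀ _ hτpos.ne']
        calc _ ≤ |f x| * τ x := by gcongr
          _ = (θ ^ γ)⁻¹ * ((κ ^ (γ - 1))⁻¹ * |f x| * ((κ ^ (γ - 1) * θ ^ γ) * τ x)) := by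
              field_simp
          _ ≤ _ := by rw [h2]; gcongr
    have hsum : (θ ^ γ)⁻¹ * (b x * τ x ^ γ) = (θ ^ γ)⁻¹ * ((R ^ γ)⁻¹ * τ x ^ γ) +
        (θ ^ γ)⁻¹ * ((κ ^ γ)⁻¹ * ‖F x‖ ^ γ' * τ x ^ γ) +
        (θ ^ γ)⁻¹ * ((κ ^ (γ - 1))⁻¹ * |f x| * τ x ^ γ) := by
      simp only [hb]; ring
    rw [hsum]
    exact add_le_add (add_le_add e1 e2) e3
  set Z := eLpNorm τ (ENNReal.ofReal m) (volume.restrict B') with hZdef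
  have hm0' : ENNReal.ofReal m ≠ 0 := by simpa using hm0
  have hZγ : Z ^ γ = (∫⁻ x in B', (‖τ x‖ₑ ^ γ) ^ s') ^ (1 / s') := by
    rw [hZdef, eLpNorm_eq_lintegral_rpow_enorm_toReal hm0' ENNReal.ofReal_ne_top,
      ENNReal.toReal_ofReal hm0.le, ← ENNReal.rpow_mul]
    simp only [← ENNReal.rpow_mul, ← e.m_eq]
    congr 1
    rw [e.m_eq]
    have := e.conj_s.symm.pos
    field_simp
  have hint : ∫⁻ x in B', ENNReal.ofReal (((R' - r)⁻¹ * max (u x - (l + κ * θ)) 0) ^ γ +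
      (if l + κ * θ < u x then ‖F x‖ ^ γ' else 0) + |f x| * max (u x - (l + κ * θ)) 0) ≤
      ENNReal.ofReal ((θ ^ γ)⁻¹) * (ENNReal.ofReal (N * R ^ (-δ * γ)) * Z ^ γ) := by
    have hs0' : ENNReal.ofReal s ≠ 0 := by simpa using e.s_pos
    calc _ ≤ ∫⁻ x in B', ENNReal.ofReal ((θ ^ γ)⁻¹) * ((fun x => ‖b x‖ₑ) *
          fun x => ‖τ x‖ₑ ^ γ) x := by
          refine lintegral_mono fun x => ?_
          refine (ENNReal.ofReal_le_ofReal (hpt x)).trans (le_of_eq ?_)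
          rw [Pi.mul_apply, ENNReal.ofReal_mul (by positivity), ENNReal.ofReal_mul (hb0 x),
            Real.enorm_of_nonneg (hb0 x), Real.enorm_of_nonneg (hτ0 x),
            ENNReal.ofReal_rpow_of_nonneg (hτ0 x) hγ0.le]
      _ ≤ ENNReal.ofReal ((θ ^ γ)⁻¹) * ((∫⁻ x in B', ‖b x‖ₑ ^ s) ^ (1 / s) * Z ^ γ) := by
          rw [lintegral_const_mul' _ _ ENNReal.ofReal_ne_top, hZγ]
          gcongr
          exact ENNReal.lintegral_mul_le_Lp_mul_Lq _ e.conj_s hbm.enorm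
            (hτm.enorm.pow_const γ)
      _ ≤ _ := by
          gcongr
          have h1 := (eLpNorm_mono_measure b hmono).trans
            (e.eLpNorm_potential_le hR hκ hFm hfm hF hf)
          rwa [eLpNorm_eq_lintegral_rpow_enorm_toReal hs0' ENNReal.ofReal_ne_top,
            ENNReal.toReal_ofReal e.s_pos.le] at h1
  set D := (C * N) ^ (1 / γ) * θ⁻¹ * R ^ (-δ) with hD
  have hD0 : 0 ≤ D := by positivity
  set v : EuclideanSpace ℝ (Fin n) → ℝ := fun x => max (u x - (l + 2 * (κ * θ))) 0 with hv
  have hW : eLpNorm v (ENNReal.ofReal (sobolevExponent n γ))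
      (volume.restrict (Metric.closedBall y r)) ≤ ENNReal.ofReal (D * (κ * R ^ (n / m) * a)) := by
    have h1 := hE r R' hr hrR' hR' (l + κ * θ) (κ * θ) (by positivity)
    rw [show l + κ * θ + κ * θ = l + 2 * (κ * θ) by ring] at h1
    have h2 := h1.trans (mul_le_mul_right hint _)
    have hDγ : D ^ γ = C * ((θ ^ γ)⁻¹ * (N * R ^ (-δ * γ))) := by
      rw [hD, Real.mul_rpow (by positivity) (by positivity),
        Real.mul_rpow (by positivity) (by positivity), ← Real.rpow_mul (by positivity),
        ← Real.rpow_mul hR.le, one_div, inv_mul_cancel₀ hγ0.ne', Real.rpow_one,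
        Real.inv_rpow hθ.le]
      ring
    have h3 : ENNReal.ofReal C * (ENNReal.ofReal ((θ ^ γ)⁻¹) *
        (ENNReal.ofReal (N * R ^ (-δ * γ)) * Z ^ γ)) = (ENNReal.ofReal D * Z) ^ γ := by
      rw [ENNReal.mul_rpow_of_nonneg _ _ hγ0.le, ENNReal.ofReal_rpow_of_nonneg hD0 hγ0.le, hDγ,
        ENNReal.ofReal_mul hC.le, ENNReal.ofReal_mul (p := (θ ^ γ)⁻¹) (by positivity)]
      ring
    rw [h3] at h2
    refine ((ENNReal.rpow_le_rpow_iff hγ0).1 h2).trans ?_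
    rw [ENNReal.ofReal_mul hD0]
    gcongr
  have hsupp : volume.restrict (Metric.closedBall y r) (Function.support v) ≤
      ENNReal.ofReal ((R ^ (n / m) * a * θ⁻¹) ^ m) := by
    have hcheb := mul_meas_ge_le_pow_eLpNorm' (volume.restrict B') hm0' ENNReal.ofReal_ne_top hτm
      (ENNReal.ofReal (κ * θ))
    rw [ENNReal.toReal_ofReal hm0.le] at hcheb
    have hsub : Function.support v ⊆ {x | ENNReal.ofReal (κ * θ) ≤ ‖τ x‖ₑ} := by
      intro x hx
      have hx' : l + 2 * (κ * θ) < u x := by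
        by_contra hc
        exact hx (max_eq_right (by linarith))
      rw [mem_ofPred_eq, Real.enorm_of_nonneg (hτ0 x)]
      refine ENNReal.ofReal_le_ofReal (le_max_of_le_left ?_)
      have : 0 < κ * θ := by positivity
      linarith
    have h1 : volume.restrict (Metric.closedBall y r) (Function.support v) ≤
        volume.restrict B' {x | ENNReal.ofReal (κ * θ) ≤ ‖τ x‖ₑ} :=
      (Measure.restrict_mono (Metric.closedBall_subset_closedBall hrR'.le) le_rfl _).trans
        (measure_mono hsub)
    refine h1.trans ?_
    have hκθ : 0 < κ * θ := by positivity
    rw [ENNReal.ofReal_rpow_of_pos hκθ] at hcheb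
    have hp : 0 < (κ * θ) ^ m := by positivity
    have h2 := hcheb.trans (ENNReal.rpow_le_rpow hZ hm0.le)
    rw [ENNReal.ofReal_rpow_of_nonneg (by positivity) hm0.le] at h2
    rw [mul_comm, ← ENNReal.le_div_iff_mul_le (Or.inl (by simpa using hp))
      (Or.inl ENNReal.ofReal_ne_top), ← ENNReal.ofReal_div_of_pos hp] at h2
    refine h2.trans (ENNReal.ofReal_le_ofReal (le_of_eq ?_))
    rw [← Real.div_rpow (by positivity) hκθ.le]
    congr 1
    field_simp
  have hvm : AEStronglyMeasurable v (volume.restrict (Metric.closedBall y r)) :=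
    (((hu.mono_measure (Measure.restrict_mono (Metric.closedBall_subset_closedBall
      (hrR'.le.trans hR')) le_rfl)).aemeasurable.sub_const _).max
      aemeasurable_const).aestronglyMeasurable
  have hexp : m * (1 / m - 1 / sobolevExponent n γ) = α := by
    rw [e.α_eq]; field_simp
  have hexp0 : 0 ≤ 1 / m - 1 / sobolevExponent n γ := by
    rw [sub_nonneg]; exact one_div_le_one_div_of_le hm0 e.m_lt.le
  calc _ ≤ _ := eLpNorm_le_eLpNorm_mul_measure_support hm0 e.m_lt.le hvm
    _ ≤ ENNReal.ofReal (D * (κ * R ^ (n / m) * a)) *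
        ENNReal.ofReal ((R ^ (n / m) * a * θ⁻¹) ^ m) ^ (1 / m - 1 / sobolevExponent n γ) :=
      mul_le_mul' hW (ENNReal.rpow_le_rpow hsupp hexp0)
    _ = _ := by
      rw [ENNReal.ofReal_rpow_of_nonneg (by positivity) hexp0, ← ENNReal.ofReal_mul (by positivity),
        ← Real.rpow_mul (by positivity), hexp]
      congr 1
      have hRδ : R ^ (-δ) * R ^ δ = 1 := by
        rw [← Real.rpow_add hR, neg_add_cancel, Real.rpow_zero]
      rw [mul_assoc (R ^ (n / m)), Real.mul_rpow (by positivity) (by positivity),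
        ← Real.rpow_mul hR.le, e.α_mul, hD, mul_comm a,
        add_comm 1 α, Real.rpow_add_one' (by positivity) (by positivity)]
      calc _ = (C * N) ^ (1 / γ) * θ⁻¹ * (κ * R ^ (n / m) * a) * (θ⁻¹ * a) ^ α *
            (R ^ (-δ) * R ^ δ) := by ring
        _ = _ := by rw [hRδ]; ring

end DeGiorgiExponents

/-! ### The local maximum principle with an `L^m` norm -/

/-- The scale-invariant contribution of the right-hand side `(F, f)` on the ball `B_R(y)`. -/
noncomputable def sourceTerm {n : ℕ} (γ γ' q s δ : ℝ)
    (F : EuclideanSpace ℝ (Fin n) → EuclideanSpace ℝ (Fin n)) (f : EuclideanSpace ℝ (Fin n) → ℝ)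
    (y : EuclideanSpace ℝ (Fin n)) (R : ℝ) : ℝ≥0∞ :=
  ENNReal.ofReal (R ^ δ) *
      eLpNorm F (ENNReal.ofReal q) (volume.restrict (Metric.closedBall y R)) ^ (1 / (γ - 1)) +
    ENNReal.ofReal (R ^ (γ' * δ)) *
      eLpNorm f (ENNReal.ofReal s) (volume.restrict (Metric.closedBall y R)) ^ (1 / (γ - 1))

namespace DeGiorgiExponents

variable {n : ℕ} {γ γ' q s s' m δ α : ℝ}

/-- De Giorgi's iteration: if `u⁺` is small in `L^m(B_R)` relative to the level `κ`, then `u ≤ κ`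
on `B_{R/2}`. -/
theorem exists_deGiorgi_const (e : DeGiorgiExponents n γ γ' q s s' m δ α) {C : ℝ} (hC : 0 < C) :
    ∃ c : ℝ, 0 < c ∧ ∀ (R κ : ℝ), 0 < R → 0 < κ → ∀ (y : EuclideanSpace ℝ (Fin n))
      (u : EuclideanSpace ℝ (Fin n) → ℝ)
      (F : EuclideanSpace ℝ (Fin n) → EuclideanSpace ℝ (Fin n))
      (f : EuclideanSpace ℝ (Fin n) → ℝ),
      AEStronglyMeasurable u (volume.restrict (Metric.closedBall y R)) →
      AEStronglyMeasurable F (volume.restrict (Metric.closedBall y R)) →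
      AEStronglyMeasurable f (volume.restrict (Metric.closedBall y R)) →
      eLpNorm F (ENNReal.ofReal q) (volume.restrict (Metric.closedBall y R)) ≤
        ENNReal.ofReal (κ ^ (γ - 1) * R ^ (-δ * (γ - 1))) →
      eLpNorm f (ENNReal.ofReal s) (volume.restrict (Metric.closedBall y R)) ≤
        ENNReal.ofReal (κ ^ (γ - 1) * R ^ (-δ * γ)) →
      IsDeGiorgiClass γ γ' C u F f y R →
      eLpNorm (fun x => max (u x) 0) (ENNReal.ofReal m)
        (volume.restrict (Metric.closedBall y R)) ≤ ENNReal.ofReal (κ * R ^ (n / m) * c) →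
      ∀ᵐ x ∂(volume.restrict (Metric.closedBall y (R / 2))), u x ≤ κ := by
  have hα := e.α_pos
  have hm0 := e.m_pos
  have hω : 0 ≤ unitBallVolume n := ENNReal.toReal_nonneg
  set D := (C * (unitBallVolume n ^ (1 / s) + 2)) ^ (1 / γ) with hD
  have hD0 : 0 < D := by positivity
  -- the geometric rate `q₀` solves `(2 q₀)^(1+α) = q₀`
  set q₀ : ℝ := 2 ^ (-((1 + α) / α)) with hq₀
  have hq₀0 : 0 < q₀ := by positivity
  have hq₀1 : q₀ < 1 := Real.rpow_lt_one_of_one_lt_of_neg one_lt_two (by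
    rw [neg_lt_zero]; positivity)
  have hq₀2 : (2 * q₀) ^ (1 + α) = q₀ := by
    rw [hq₀]
    nth_rewrite 1 [← Real.rpow_one 2]
    rw [← Real.rpow_add two_pos, ← Real.rpow_mul two_pos.le]
    congr 1
    field_simp
    ring
  set c : ℝ := (q₀ / (D * 4 ^ (1 + α))) ^ (1 / α) with hc
  have hc0 : 0 < c := by positivity
  have hcα : D * 4 ^ (1 + α) * c ^ α = q₀ := by
    rw [hc, ← Real.rpow_mul (by positivity), one_div, inv_mul_cancel₀ hα.ne', Real.rpow_one]
    field_simp
  refine ⟨c, hc0, fun R κ hR hκ y u F f hu hFm hfm hF hf hE h0 => ?_⟩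
  -- radii decreasing to `R / 2` and levels increasing to `κ`
  set r : ℕ → ℝ := fun j => R / 2 * (1 + (1 / 2) ^ j) with hr
  set l : ℕ → ℝ := fun j => κ * (1 - (1 / 2) ^ j) with hl
  have hp : ∀ j : ℕ, 0 < ((1 : ℝ) / 2) ^ j ∧ ((1 : ℝ) / 2) ^ j ≤ 1 := fun j =>
    ⟨by positivity, pow_le_one₀ (by norm_num) (by norm_num)⟩
  have hr2 : ∀ j, R / 2 ≤ r j := fun j => by
    have := (hp j).1
    simp only [hr]; nlinarith
  have hrR : ∀ j, r j ≤ R := fun j => by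
    have := (hp j).2
    simp only [hr]; nlinarith
  have hiter : ∀ j : ℕ, eLpNorm (fun x => max (u x - l j) 0) (ENNReal.ofReal m)
      (volume.restrict (Metric.closedBall y (r j))) ≤
      ENNReal.ofReal (κ * R ^ (n / m) * (c * q₀ ^ j)) := by
    intro j
    induction j with
    | zero =>
      have e1 : r 0 = R := by simp only [hr]; ring
      have e2 : l 0 = 0 := by simp only [hl]; ring
      rw [e1, e2]
      simpa using h0
    | succ j ih =>
      have h1 := e.deGiorgi_step hC hR hκ hu hFm hfm hF hf hE (r := r (j + 1)) (R' := r j)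
        (θ := (1 / 2) ^ j / 4) (l := l j) (a := c * q₀ ^ j)
        ((half_pos hR).trans_le (hr2 _)) (hrR j) (by have := (hp j).1; positivity)
        (by have := (hp j).2; linarith) (by simp only [hr, pow_succ]; ring) (by positivity) ih
      have e1 : l j + 2 * (κ * ((1 / 2) ^ j / 4)) = l (j + 1) := by
        simp only [hl, pow_succ]; ring
      rw [e1, ← hD] at h1
      refine h1.trans (ENNReal.ofReal_le_ofReal (mul_le_mul_of_nonneg_left (le_of_eq ?_)
        (by positivity)))
      have e2 : ((1 / 2 : ℝ) ^ j / 4)⁻¹ * (c * q₀ ^ j) = 4 * c * (2 * q₀) ^ j := by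
        rw [mul_pow, inv_div, one_div, inv_pow]; field_simp
      have e3 : ((2 * q₀) ^ j) ^ (1 + α) = q₀ ^ j := by
        rw [← Real.rpow_natCast, ← Real.rpow_mul (by positivity), mul_comm (j : ℝ),
          Real.rpow_mul (by positivity), hq₀2, Real.rpow_natCast]
      rw [e2, Real.mul_rpow (by positivity) (by positivity), e3,
        Real.mul_rpow (by positivity) hc0.le, add_comm 1 α, Real.rpow_add_one hc0.ne',
        pow_succ, ← hcα, add_comm 1 α]
      ring
  set T : EuclideanSpace ℝ (Fin n) → ℝ := fun x => max (u x - κ) 0 with hT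
  have hTj : ∀ j : ℕ, eLpNorm T (ENNReal.ofReal m)
      (volume.restrict (Metric.closedBall y (R / 2))) ≤
      ENNReal.ofReal (κ * R ^ (n / m) * (c * q₀ ^ j)) := fun j =>
    ((eLpNorm_mono_real fun x => by
      rw [Real.norm_of_nonneg (le_max_right _ _)]
      refine max_le_max ?_ le_rfl
      have := (hp j).1
      simp only [hl]; nlinarith).trans (eLpNorm_mono_measure _ (Measure.restrict_mono
      (Metric.closedBall_subset_closedBall (hr2 j)) le_rfl))).trans (hiter j)
  have hlim : Tendsto (fun j : ℕ => ENNReal.ofReal (κ * R ^ (n / m) * (c * q₀ ^ j))) atTop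
      (𝓝 0) := by
    have := ((tendsto_pow_atTop_nhds_zero_of_lt_one hq₀0.le hq₀1).const_mul c).const_mul
      (κ * R ^ (n / m))
    simp only [mul_zero] at this
    have h := (ENNReal.continuous_ofReal.tendsto 0).comp this
    rw [ENNReal.ofReal_zero] at h
    exact h
  have hT0 : eLpNorm T (ENNReal.ofReal m) (volume.restrict (Metric.closedBall y (R / 2))) = 0 :=
    le_antisymm (ge_of_tendsto' hlim hTj) zero_le
  have hTm : AEStronglyMeasurable T (volume.restrict (Metric.closedBall y (R / 2))) :=
    (((hu.mono_measure (Measure.restrict_mono (Metric.closedBall_subset_closedBall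
      (by linarith)) le_rfl)).aemeasurable.sub_const _).max
      aemeasurable_const).aestronglyMeasurable
  have := (eLpNorm_eq_zero_iff hTm (by simpa using hm0)).1 hT0
  filter_upwards [this] with x hx
  have h1 : u x - κ ≤ max (u x - κ) 0 := le_max_left _ _
  have h2 : max (u x - κ) 0 = 0 := hx
  linarith

/-- The local maximum principle on a ball of the De Giorgi class, with the `L^m` norm of `u⁺`. -/
theorem exists_sup_bound_const (e : DeGiorgiExponents n γ γ' q s s' m δ α) {C : ℝ} (hC : 0 < C) :
    ∃ C₁ : ℝ, 0 < C₁ ∧ ∀ (R : ℝ), 0 < R → ∀ (y : EuclideanSpace ℝ (Fin n))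
      (u : EuclideanSpace ℝ (Fin n) → ℝ)
      (F : EuclideanSpace ℝ (Fin n) → EuclideanSpace ℝ (Fin n))
      (f : EuclideanSpace ℝ (Fin n) → ℝ),
      AEStronglyMeasurable u (volume.restrict (Metric.closedBall y R)) →
      AEStronglyMeasurable F (volume.restrict (Metric.closedBall y R)) →
      AEStronglyMeasurable f (volume.restrict (Metric.closedBall y R)) →
      IsDeGiorgiClass γ γ' C u F f y R →
      eLpNorm (fun x => max (u x) 0) ⊤ (volume.restrict (Metric.closedBall y (R / 2))) ≤
        ENNReal.ofReal C₁ * (ENNReal.ofReal (R ^ (-(n / m))) *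
          eLpNorm (fun x => max (u x) 0) (ENNReal.ofReal m)
            (volume.restrict (Metric.closedBall y R)) + sourceTerm γ γ' q s δ F f y R) := by
  obtain ⟨c, hc, hmain⟩ := e.exists_deGiorgi_const hC
  refine ⟨c⁻¹ + 1, by positivity, fun R hR y u F f hu hFm hfm hE => ?_⟩
  set Z := eLpNorm (fun x => max (u x) 0) (ENNReal.ofReal m)
            (volume.restrict (Metric.closedBall y R)) with hZ
  set X := ENNReal.ofReal (R ^ (-(n / m))) * Z + sourceTerm γ γ' q s δ F f y R with hX
  by_cases hXt : X = ⊤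
  · rw [hXt, ENNReal.mul_top (by simpa using (by positivity : 0 < c⁻¹ + 1))]
    exact le_top
  have hγ1 : 0 < γ - 1 := by linarith [e.conj.lt]
  have hγ'1 : γ' * (γ - 1) = γ := by
    rw [e.conj.conjugate_eq, div_mul_cancel₀ _ hγ1.ne']
  refine ENNReal.le_of_forall_pos_le_add fun ε hε _ => ?_
  have hε' : (0 : ℝ) < ε := hε
  set κ := X.toReal * (c⁻¹ + 1) + ε with hκ
  have hX0 : 0 ≤ X.toReal := ENNReal.toReal_nonneg
  have hκ0 : 0 < κ := by positivity
  have hXκ : X ≤ ENNReal.ofReal κ := by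
    rw [ENNReal.le_ofReal_iff_toReal_le hXt hκ0.le]
    have : 0 ≤ X.toReal * c⁻¹ := by positivity
    linarith
  have hXκc : X ≤ ENNReal.ofReal (κ * c) := by
    rw [ENNReal.le_ofReal_iff_toReal_le hXt (by positivity)]
    have : (X.toReal * (c⁻¹ + 1) + ε) * c = X.toReal + (X.toReal + ε) * c := by field_simp; ring
    rw [hκ, this]
    have : 0 ≤ (X.toReal + ε) * c := by positivity
    linarith
  -- inverting `a N^{1/(γ-1)} ≤ κ`
  have hinv : ∀ (t : ℝ) (N : ℝ≥0∞), ENNReal.ofReal (R ^ t) * N ^ (1 / (γ - 1)) ≤ X →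
      N ≤ ENNReal.ofReal (κ ^ (γ - 1) * R ^ (-t * (γ - 1))) := by
    intro t N hN
    have h1 := hN.trans hXκ
    rw [mul_comm, ← ENNReal.le_div_iff_mul_le (Or.inl (by simp; positivity))
      (Or.inl ENNReal.ofReal_ne_top), ← ENNReal.ofReal_div_of_pos (by positivity)] at h1
    have h2 := ENNReal.rpow_le_rpow h1 hγ1.le
    rw [← ENNReal.rpow_mul, one_div, inv_mul_cancel₀ hγ1.ne', ENNReal.rpow_one,
      ENNReal.ofReal_rpow_of_nonneg (by positivity) hγ1.le, div_eq_mul_inv, ← Real.rpow_neg hR.le,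
      Real.mul_rpow hκ0.le (by positivity), ← Real.rpow_mul hR.le] at h2
    exact h2
  have hFb := hinv δ _ (le_trans (le_trans le_self_add le_add_self) hX.ge)
  have hfb := hinv (γ' * δ) _ (le_trans (le_trans le_add_self le_add_self) hX.ge)
  rw [show -(γ' * δ) * (γ - 1) = -δ * (γ' * (γ - 1)) by ring, hγ'1] at hfb
  have hZb : Z ≤ ENNReal.ofReal (κ * R ^ (n / m) * c) := by
    have h1 : ENNReal.ofReal (R ^ (-(n / m))) * Z ≤ ENNReal.ofReal (κ * c) :=
      le_trans (le_trans le_self_add hX.ge) hXκc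
    rw [mul_comm, ← ENNReal.le_div_iff_mul_le (Or.inl (by simp; positivity))
      (Or.inl ENNReal.ofReal_ne_top), ← ENNReal.ofReal_div_of_pos (by positivity)] at h1
    refine h1.trans (ENNReal.ofReal_le_ofReal (le_of_eq ?_))
    rw [Real.rpow_neg hR.le, div_inv_eq_mul]; ring
  have hae := hmain R κ hR hκ0 y u F f hu hFm hfm hFb hfb hE hZb
  have hsup : eLpNorm (fun x => max (u x) 0) ⊤ (volume.restrict (Metric.closedBall y (R / 2))) ≤
      ENNReal.ofReal κ := by
    rw [eLpNorm_exponent_top]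
    refine eLpNormEssSup_le_of_ae_bound ?_
    filter_upwards [hae] with x hx
    rw [Real.norm_of_nonneg (le_max_right _ _)]
    exact max_le hx hκ0.le
  refine hsup.trans (le_of_eq ?_)
  rw [hκ, ENNReal.ofReal_add (by positivity) hε'.le, ENNReal.ofReal_mul hX0,
    ENNReal.ofReal_toReal hXt, mul_comm, ENNReal.ofReal_coe_nnreal]

end DeGiorgiExponents

/-! ### The local maximum principle with an `L^p` norm -/

/-- A bound on the essential supremum near every point of `S` holds on `S`. -/
theorem eLpNorm_top_restrict_le_of_forall_closedBall {E V : Type*} [PseudoMetricSpace E]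
    [SecondCountableTopology E] [MeasurableSpace E] [BorelSpace E] [NormedAddCommGroup V]
    {μ : Measure E} {f : E → V} {S : Set E} (hS : MeasurableSet S) {c : ℝ≥0∞}
    (h : ∀ z ∈ S, ∃ r > 0, eLpNorm f ⊤ (μ.restrict (Metric.closedBall z r)) ≤ c) :
    eLpNorm f ⊤ (μ.restrict S) ≤ c := by
  rw [eLpNorm_exponent_top]
  refine essSup_le_of_ae_le _ ?_
  rw [EventuallyLE, ae_restrict_iff' hS]
  have hnull : μ {x | ¬ (x ∈ S → ‖f x‖ₑ ≤ c)} = 0 := by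
    refine measure_null_of_locally_null _ fun z hz => ?_
    simp only [mem_ofPred_eq, Classical.not_imp] at hz
    obtain ⟨r, hr, hle⟩ := h z hz.1
    have h1 : ∀ᵐ x ∂(μ.restrict (Metric.closedBall z r)), ‖f x‖ₑ ≤ c := by
      rw [eLpNorm_exponent_top] at hle
      filter_upwards [enorm_ae_le_eLpNormEssSup f (μ.restrict (Metric.closedBall z r))] with x hx
      exact hx.trans hle
    rw [ae_restrict_iff' Metric.isClosed_closedBall.measurableSet] at h1
    refine ⟨{x | ¬ (x ∈ S → ‖f x‖ₑ ≤ c)} ∩ Metric.closedBall z r, inter_mem_nhdsWithin _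
      (Metric.closedBall_mem_nhds z hr), measure_mono_null (fun x hx => ?_) (ae_iff.1 h1)⟩
    obtain ⟨hx1, hx2⟩ := hx
    simp only [mem_ofPred_eq, Classical.not_imp] at hx1 ⊢
    exact ⟨hx2, hx1.2⟩
  exact ae_iff.2 hnull

/-- Interpolation of `L^m` between `L^p` and `L^∞`. -/
theorem eLpNorm_le_top_rpow_mul {α V : Type*} [MeasurableSpace α] [NormedAddCommGroup V]
    {μ : Measure α} {p m : ℝ} (hp : 0 < p) (hpm : p ≤ m) {f : α → V}
    (hf : AEStronglyMeasurable f μ) :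
    eLpNorm f (ENNReal.ofReal m) μ ≤
      eLpNorm f ⊤ μ ^ (1 - p / m) * eLpNorm f (ENNReal.ofReal p) μ ^ (p / m) := by
  have hm : 0 < m := hp.trans_le hpm
  have hp0 : ENNReal.ofReal p ≠ 0 := by simpa using hp
  have hm0 : ENNReal.ofReal m ≠ 0 := by simpa using hm
  rw [eLpNorm_eq_lintegral_rpow_enorm_toReal hp0 ENNReal.ofReal_ne_top,
    eLpNorm_eq_lintegral_rpow_enorm_toReal hm0 ENNReal.ofReal_ne_top,
    ENNReal.toReal_ofReal hp.le, ENNReal.toReal_ofReal hm.le]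
  set M := eLpNorm f ⊤ μ with hM
  have h1 : ∫⁻ x, ‖f x‖ₑ ^ m ∂μ ≤ M ^ (m - p) * ∫⁻ x, ‖f x‖ₑ ^ p ∂μ := by
    rw [← lintegral_const_mul'' _ (hf.enorm.pow_const p)]
    refine lintegral_mono_ae ?_
    filter_upwards [enorm_ae_le_eLpNormEssSup f μ] with x hx
    rw [← eLpNorm_exponent_top] at hx
    calc ‖f x‖ₑ ^ m = ‖f x‖ₑ ^ (m - p) * ‖f x‖ₑ ^ p := by
          rw [← ENNReal.rpow_add_of_nonneg _ _ (by linarith) hp.le, sub_add_cancel]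
      _ ≤ _ := by
          gcongr
  refine (ENNReal.rpow_le_rpow h1 (by positivity)).trans (le_of_eq ?_)
  rw [ENNReal.mul_rpow_of_nonneg _ _ (by positivity), ← ENNReal.rpow_mul, ← ENNReal.rpow_mul]
  congr 2 <;> field_simp

theorem sourceTerm_mono {n : ℕ} {γ γ' q s δ : ℝ} (hγ : 1 < γ) (hγ' : 0 < γ') (hδ : 0 < δ)
    (F : EuclideanSpace ℝ (Fin n) → EuclideanSpace ℝ (Fin n)) (f : EuclideanSpace ℝ (Fin n) → ℝ)
    {y z : EuclideanSpace ℝ (Fin n)} {r R : ℝ} (hr : 0 ≤ r) (hrR : r ≤ R)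
    (h : Metric.closedBall z r ⊆ Metric.closedBall y R) :
    sourceTerm γ γ' q s δ F f z r ≤ sourceTerm γ γ' q s δ F f y R := by
  have hmono := Measure.restrict_mono (μ := volume) h le_rfl
  have hγ1 : 0 ≤ 1 / (γ - 1) := one_div_nonneg.2 (by linarith)
  unfold sourceTerm
  gcongr

/-- The hypotheses under which the interior estimates are derived: `u` is locally in `L^m` from
above and belongs to the De Giorgi class on every closed ball in `Ω`. -/
structure IsLocalDeGiorgi {n : ℕ} (γ γ' m C : ℝ) (Ω : Set (EuclideanSpace ℝ (Fin n)))
    (u : EuclideanSpace ℝ (Fin n) → ℝ) (F : EuclideanSpace ℝ (Fin n) → EuclideanSpace ℝ (Fin n))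
    (f : EuclideanSpace ℝ (Fin n) → ℝ) : Prop where
  meas_u : ∀ y R, Metric.closedBall y R ⊆ Ω →
    AEStronglyMeasurable u (volume.restrict (Metric.closedBall y R))
  meas_F : ∀ y R, Metric.closedBall y R ⊆ Ω →
    AEStronglyMeasurable F (volume.restrict (Metric.closedBall y R))
  meas_f : ∀ y R, Metric.closedBall y R ⊆ Ω →
    AEStronglyMeasurable f (volume.restrict (Metric.closedBall y R))
  lt_top : ∀ y r R, 0 < r → r < R → Metric.closedBall y R ⊆ Ω →
    eLpNorm (fun x => max (u x) 0) (ENNReal.ofReal m) (volume.restrict (Metric.closedBall y r)) < ⊤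
  deGiorgi : ∀ y R, 0 < R → Metric.closedBall y R ⊆ Ω → IsDeGiorgiClass γ γ' C u F f y R

namespace DeGiorgiExponents

variable {n : ℕ} {γ γ' q s s' m δ α : ℝ}

theorem exists_sup_bound_concentric (e : DeGiorgiExponents n γ γ' q s s' m δ α) {C : ℝ}
    (hC : 0 < C) :
    ∃ C₁ : ℝ, 0 < C₁ ∧ ∀ (Ω : Set (EuclideanSpace ℝ (Fin n))) (u : EuclideanSpace ℝ (Fin n) → ℝ)
      (F : EuclideanSpace ℝ (Fin n) → EuclideanSpace ℝ (Fin n))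
      (f : EuclideanSpace ℝ (Fin n) → ℝ), IsLocalDeGiorgi γ γ' m C Ω u F f →
      ∀ (y : EuclideanSpace ℝ (Fin n)) (r R : ℝ), 0 < r → r < R → Metric.closedBall y R ⊆ Ω →
      eLpNorm (fun x => max (u x) 0) ⊤ (volume.restrict (Metric.closedBall y r)) ≤
        ENNReal.ofReal C₁ * (ENNReal.ofReal ((R - r) ^ (-(n / m))) *
          eLpNorm (fun x => max (u x) 0) (ENNReal.ofReal m)
            (volume.restrict (Metric.closedBall y R)) + sourceTerm γ γ' q s δ F f y R) := by
  obtain ⟨C₁, hC₁, hmain⟩ := e.exists_sup_bound_const hC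
  refine ⟨C₁, hC₁, fun Ω u F f hu y r R hr hrR hΩ => ?_⟩
  have hRr : 0 < R - r := by linarith
  refine eLpNorm_top_restrict_le_of_forall_closedBall Metric.isClosed_closedBall.measurableSet
    fun z hz => ⟨(R - r) / 2, half_pos hRr, ?_⟩
  have hsub : Metric.closedBall z (R - r) ⊆ Metric.closedBall y R :=
    Metric.closedBall_subset_closedBall' (by rw [Metric.mem_closedBall] at hz; linarith)
  have hzΩ := hsub.trans hΩ
  refine (hmain (R - r) hRr z u F f (hu.meas_u _ _ hzΩ) (hu.meas_F _ _ hzΩ) (hu.meas_f _ _ hzΩ)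
    (hu.deGiorgi _ _ hRr hzΩ)).trans ?_
  gcongr
  exact sourceTerm_mono e.conj.lt e.conj.symm.pos e.δ_pos F f hRr.le (by linarith) hsub

/-- The local maximum principle with the `L^p` norm of `u⁺` for small `p`: the `L^m` norm is
interpolated between `L^p` and `L^∞`, and the `L^∞` norm is absorbed by taking the supremum over all
concentric balls, weighted by a power of the distance to the boundary. -/
theorem exists_sup_bound_of_lt (e : DeGiorgiExponents n γ γ' q s s' m δ α) {C : ℝ} (hC : 0 < C)
    {p : ℝ} (hp : 0 < p) (hpm : p < m) :
    ∃ C₂ : ℝ, 0 < C₂ ∧ ∀ (Ω : Set (EuclideanSpace ℝ (Fin n))) (u : EuclideanSpace ℝ (Fin n) → ℝ)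
      (F : EuclideanSpace ℝ (Fin n) → EuclideanSpace ℝ (Fin n))
      (f : EuclideanSpace ℝ (Fin n) → ℝ), IsLocalDeGiorgi γ γ' m C Ω u F f →
      ∀ (y : EuclideanSpace ℝ (Fin n)) (R : ℝ), 0 < R → Metric.closedBall y R ⊆ Ω →
      eLpNorm (fun x => max (u x) 0) ⊤ (volume.restrict (Metric.closedBall y (R / 2))) ≤
        ENNReal.ofReal C₂ * (ENNReal.ofReal (R ^ (-(n / p))) *
          eLpNorm (fun x => max (u x) 0) (ENNReal.ofReal p)
            (volume.restrict (Metric.closedBall y R)) + sourceTerm γ γ' q s δ F f y R) := by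
  obtain ⟨C₁, hC₁, hmain⟩ := e.exists_sup_bound_concentric hC
  have hm0 := e.m_pos
  have hn := e.dim_pos
  set β := p / m with hβ
  have hβ0 : 0 < β := div_pos hp hm0
  have hβ1 : β < 1 := (div_lt_one hm0).2 hpm
  have hconj : ((1 - β)⁻¹).HolderConjugate β⁻¹ :=
    Real.HolderConjugate.inv_inv (by linarith) hβ0 (by ring)
  obtain ⟨C', hC', hyoung⟩ := exists_young_const hconj
    (ε := 1 / (2 * (C₁ * 2 ^ ((n : ℝ) / p)))) (by positivity)
  set B := C₁ * 2 ^ ((n : ℝ) / p) with hB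
  have hB0 : 0 < B := by positivity
  refine ⟨4 ^ ((n : ℝ) / p) * (2 * (B * C' + C₁)), by positivity, fun Ω u F f hu y R hR hΩ => ?_⟩
  set S := sourceTerm γ γ' q s δ F f y R with hS
  set A := eLpNorm (fun x => max (u x) 0) (ENNReal.ofReal p)
            (volume.restrict (Metric.closedBall y R)) with hA
  have hRp : 0 < R ^ (-((n : ℝ) / p)) := by positivity
  by_cases hSt : S = ⊤
  · rw [hSt, add_top, ENNReal.mul_top (by simp; positivity)]; exact le_top
  by_cases hAt : A = ⊤
  · rw [hAt, ENNReal.mul_top (by simpa using hRp), top_add, ENNReal.mul_top (by simp; positivity)]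
    exact le_top
  -- `u⁺` is bounded on the ball of radius `R₁`, but possibly not on that of radius `R`
  set R₁ := 3 / 4 * R with hR₁
  set M : ℝ → ℝ≥0∞ := fun r =>
    eLpNorm (fun x => max (u x) 0) ⊤ (volume.restrict (Metric.closedBall y r)) with hM
  have hMmono : ∀ {r r' : ℝ}, r ≤ r' → M r ≤ M r' := fun h =>
    eLpNorm_mono_measure _ (Measure.restrict_mono (Metric.closedBall_subset_closedBall h) le_rfl)
  have hMfin : M R₁ ≠ ⊤ := by
    have hsub : Metric.closedBall y (7 / 8 * R) ⊆ Metric.closedBall y R :=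
      Metric.closedBall_subset_closedBall (by linarith)
    refine ne_top_of_le_ne_top ?_ (hmain Ω u F f hu y R₁ (7 / 8 * R) (by positivity)
      (by rw [hR₁]; linarith) (hsub.trans hΩ))
    refine ENNReal.mul_ne_top ENNReal.ofReal_ne_top (ENNReal.add_ne_top.2
      ⟨ENNReal.mul_ne_top ENNReal.ofReal_ne_top
        (hu.lt_top y _ R (by positivity) (by linarith) hΩ).ne, ne_top_of_le_ne_top hSt
        (sourceTerm_mono e.conj.lt e.conj.symm.pos e.δ_pos F f (by positivity) (by linarith)
          hsub)⟩)
  -- the weighted supremum, a finite quantity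
  set N : ℝ≥0∞ := ⨆ r : Ioo 0 R₁, ENNReal.ofReal ((R₁ - r) ^ ((n : ℝ) / p)) * M r with hN
  have hNfin : N ≠ ⊤ := by
    refine ne_top_of_le_ne_top (ENNReal.mul_ne_top (ENNReal.ofReal_ne_top
      (r := R₁ ^ ((n : ℝ) / p))) hMfin) (iSup_le fun r => ?_)
    have h1 := r.2.1
    have h2 := r.2.2
    gcongr
    · linarith
    · exact hMmono h2.le
  have hMN : ∀ r, 0 < r → r < R₁ → ENNReal.ofReal ((R₁ - r) ^ ((n : ℝ) / p)) * M r ≤ N :=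
    fun r h1 h2 => le_iSup (fun r : Ioo 0 R₁ => ENNReal.ofReal ((R₁ - r) ^ ((n : ℝ) / p)) * M r)
      ⟨r, h1, h2⟩
  set Nr := N.toReal with hNr
  set Ar := A.toReal with hAr
  set Sr := S.toReal with hSr
  have hNr0 : 0 ≤ Nr := ENNReal.toReal_nonneg
  have hAr0 : 0 ≤ Ar := ENNReal.toReal_nonneg
  have hSr0 : 0 ≤ Sr := ENNReal.toReal_nonneg
  have hkey : N ≤ ENNReal.ofReal (B * (Nr ^ (1 - β) * Ar ^ β) + C₁ * R ^ ((n : ℝ) / p) * Sr) := by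
    refine iSup_le fun ⟨r, hr0, hr1⟩ => ?_
    set t := R₁ - r with ht
    have ht0 : 0 < t := by rw [ht]; linarith
    have htR : t ≤ R := by rw [ht, hR₁]; linarith
    set r' := (r + R₁) / 2 with hr'
    have hr'1 : R₁ - r' = t / 2 := by rw [hr', ht]; ring
    have hr'2 : r' - r = t / 2 := by rw [hr', ht]; ring
    have hr'R : r' ≤ R := by rw [hr', hR₁]; linarith
    have hsub : Metric.closedBall y r' ⊆ Metric.closedBall y R :=
      Metric.closedBall_subset_closedBall hr'R
    have h1 := hmain Ω u F f hu y r r' hr0 (by linarith) (hsub.trans hΩ)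
    rw [hr'2] at h1
    have hMr' : M r' ≤ ENNReal.ofReal ((t / 2) ^ (-((n : ℝ) / p)) * Nr) := by
      have h2 := hMN r' (by linarith) (by linarith)
      rw [hr'1, mul_comm, ← ENNReal.le_div_iff_mul_le (Or.inl (by simp; positivity))
        (Or.inl ENNReal.ofReal_ne_top), ← ENNReal.ofReal_toReal hNfin,
        ← ENNReal.ofReal_div_of_pos (by positivity)] at h2
      refine h2.trans (ENNReal.ofReal_le_ofReal (le_of_eq ?_))
      rw [Real.rpow_neg (by positivity), div_eq_inv_mul]
    have hum : AEStronglyMeasurable (fun x => max (u x) 0)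
        (volume.restrict (Metric.closedBall y r')) :=
      ((hu.meas_u y r' (hsub.trans hΩ)).aemeasurable.max aemeasurable_const).aestronglyMeasurable
    have hmr : eLpNorm (fun x => max (u x) 0) (ENNReal.ofReal m)
        (volume.restrict (Metric.closedBall y r')) ≤
        ENNReal.ofReal (((t / 2) ^ (-((n : ℝ) / p)) * Nr) ^ (1 - β) * Ar ^ β) := by
      refine (eLpNorm_le_top_rpow_mul hp hpm.le hum).trans ?_
      rw [ENNReal.ofReal_mul (by positivity), ← ENNReal.ofReal_rpow_of_nonneg (by positivity)
        (by linarith), ← ENNReal.ofReal_rpow_of_nonneg hAr0 hβ0.le, hAr, ENNReal.ofReal_toReal hAt]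
      refine mul_le_mul' (ENNReal.rpow_le_rpow hMr' (by linarith)) (ENNReal.rpow_le_rpow
        (eLpNorm_mono_measure _ (Measure.restrict_mono hsub le_rfl)) hβ0.le)
    have hSr' : sourceTerm γ γ' q s δ F f y r' ≤ ENNReal.ofReal Sr := by
      rw [hSr, ENNReal.ofReal_toReal hSt]
      exact sourceTerm_mono e.conj.lt e.conj.symm.pos e.δ_pos F f (by linarith) hr'R hsub
    calc ENNReal.ofReal (t ^ ((n : ℝ) / p)) * M r ≤ ENNReal.ofReal (t ^ ((n : ℝ) / p)) *
          (ENNReal.ofReal C₁ * (ENNReal.ofReal ((t / 2) ^ (-((n : ℝ) / m))) *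
          ENNReal.ofReal (((t / 2) ^ (-((n : ℝ) / p)) * Nr) ^ (1 - β) * Ar ^ β) +
          ENNReal.ofReal Sr)) := by
          refine mul_le_mul_right (h1.trans ?_) _
          gcongr
      _ = ENNReal.ofReal (t ^ ((n : ℝ) / p) * (C₁ * ((t / 2) ^ (-((n : ℝ) / m)) *
          (((t / 2) ^ (-((n : ℝ) / p)) * Nr) ^ (1 - β) * Ar ^ β) + Sr))) := by
          rw [ENNReal.ofReal_mul (p := t ^ ((n : ℝ) / p)) (by positivity),
            ENNReal.ofReal_mul (p := C₁) hC₁.le, ENNReal.ofReal_add (by positivity) hSr0,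
            ENNReal.ofReal_mul (p := (t / 2) ^ (-((n : ℝ) / m))) (by positivity)]
      _ ≤ _ := by
          refine ENNReal.ofReal_le_ofReal ?_
          have ht2 : 0 < t / 2 := half_pos ht0
          have e1 : t ^ ((n : ℝ) / p) * ((t / 2) ^ (-((n : ℝ) / m)) *
              ((t / 2) ^ (-((n : ℝ) / p))) ^ (1 - β)) = 2 ^ ((n : ℝ) / p) := by
            rw [← Real.rpow_mul ht2.le, ← Real.rpow_add ht2]
            have : -((n : ℝ) / m) + -((n : ℝ) / p) * (1 - β) = -((n : ℝ) / p) := by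
              rw [hβ]; field_simp; ring
            rw [this, Real.rpow_neg ht2.le, Real.div_rpow ht0.le two_pos.le]
            field_simp
          have e2 : t ^ ((n : ℝ) / p) ≤ R ^ ((n : ℝ) / p) :=
            Real.rpow_le_rpow ht0.le htR (by positivity)
          rw [Real.mul_rpow (by positivity) hNr0]
          calc _ = C₁ * (t ^ ((n : ℝ) / p) * ((t / 2) ^ (-((n : ℝ) / m)) *
              ((t / 2) ^ (-((n : ℝ) / p))) ^ (1 - β))) * (Nr ^ (1 - β) * Ar ^ β) +
              C₁ * t ^ ((n : ℝ) / p) * Sr := by ring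
            _ ≤ _ := by
              rw [e1, ← hB]
              gcongr
  have hreal : Nr ≤ 2 * (B * C' * Ar + C₁ * R ^ ((n : ℝ) / p) * Sr) := by
    have h1 : Nr ≤ B * (Nr ^ (1 - β) * Ar ^ β) + C₁ * R ^ ((n : ℝ) / p) * Sr :=
      ENNReal.toReal_le_of_le_ofReal (by positivity) hkey
    have h2 := hyoung (Nr ^ (1 - β)) (Ar ^ β) (by positivity) (by positivity)
    rw [← Real.rpow_mul hNr0, ← Real.rpow_mul hAr0, mul_inv_cancel₀ (by linarith),
      mul_inv_cancel₀ hβ0.ne', Real.rpow_one, Real.rpow_one] at h2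
    have h3 := mul_le_mul_of_nonneg_left h2 hB0.le
    have h4 : B * (1 / (2 * B) * Nr + C' * Ar) = Nr / 2 + B * C' * Ar := by field_simp
    rw [h4] at h3
    linarith
  have hfinal := hMN (R / 2) (half_pos hR) (by rw [hR₁]; linarith)
  have hR4 : R₁ - R / 2 = R / 4 := by rw [hR₁]; ring
  rw [hR4, mul_comm, ← ENNReal.le_div_iff_mul_le (Or.inl (by simp; positivity))
    (Or.inl ENNReal.ofReal_ne_top), ← ENNReal.ofReal_toReal hNfin,
    ← ENNReal.ofReal_div_of_pos (by positivity)] at hfinal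
  refine hfinal.trans ?_
  rw [← ENNReal.ofReal_toReal hAt, ← ENNReal.ofReal_toReal hSt,
    ← ENNReal.ofReal_mul hRp.le, ← ENNReal.ofReal_add (by positivity) hSr0,
    ← ENNReal.ofReal_mul (by positivity)]
  refine ENNReal.ofReal_le_ofReal ?_
  rw [div_le_iff₀ (by positivity), Real.div_rpow hR.le (by norm_num)]
  refine hreal.trans ?_
  have e1 : R ^ (-((n : ℝ) / p)) * R ^ ((n : ℝ) / p) = 1 := by
    rw [← Real.rpow_add hR, neg_add_cancel, Real.rpow_zero]
  calc 2 * (B * C' * Ar + C₁ * R ^ ((n : ℝ) / p) * Sr)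
      ≤ 2 * (B * C' + C₁) * (Ar + R ^ ((n : ℝ) / p) * Sr) := by
        have p1 : 0 ≤ C₁ * Ar := by positivity
        have p2 : 0 ≤ B * C' * (R ^ ((n : ℝ) / p) * Sr) := by positivity
        linarith only [p1, p2, show 2 * (B * C' + C₁) * (Ar + R ^ ((n : ℝ) / p) * Sr) =
          2 * (B * C' * Ar + C₁ * R ^ ((n : ℝ) / p) * Sr) + 2 * (C₁ * Ar) +
          2 * (B * C' * (R ^ ((n : ℝ) / p) * Sr)) by ring]
    _ = 2 * (B * C' + C₁) * ((R ^ (-((n : ℝ) / p)) * R ^ ((n : ℝ) / p)) * Ar +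
          R ^ ((n : ℝ) / p) * Sr) := by rw [e1, one_mul]
    _ = _ := by
        rw [← mul_div_assoc, eq_div_iff (by positivity)]
        ring

/-- The local maximum principle with the `L^p` norm of `u⁺`, for every `p > 0`. -/
theorem exists_sup_bound (e : DeGiorgiExponents n γ γ' q s s' m δ α) {C : ℝ} (hC : 0 < C)
    {p : ℝ} (hp : 0 < p) :
    ∃ C₂ : ℝ, 0 < C₂ ∧ ∀ (Ω : Set (EuclideanSpace ℝ (Fin n))) (u : EuclideanSpace ℝ (Fin n) → ℝ)
      (F : EuclideanSpace ℝ (Fin n) → EuclideanSpace ℝ (Fin n))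
      (f : EuclideanSpace ℝ (Fin n) → ℝ), IsLocalDeGiorgi γ γ' m C Ω u F f →
      ∀ (y : EuclideanSpace ℝ (Fin n)) (R : ℝ), 0 < R → Metric.closedBall y R ⊆ Ω →
      eLpNorm (fun x => max (u x) 0) ⊤ (volume.restrict (Metric.closedBall y (R / 2))) ≤
        ENNReal.ofReal C₂ * (ENNReal.ofReal (R ^ (-(n / p))) *
          eLpNorm (fun x => max (u x) 0) (ENNReal.ofReal p)
            (volume.restrict (Metric.closedBall y R)) + sourceTerm γ γ' q s δ F f y R) := by
  rcases lt_or_ge p m with hpm | hpm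
  · exact e.exists_sup_bound_of_lt hC hp hpm
  have hm0 := e.m_pos
  have hω : 0 ≤ unitBallVolume n := ENNReal.toReal_nonneg
  have hexp : 0 ≤ 1 / m - 1 / p := sub_nonneg.2 (one_div_le_one_div_of_le hm0 hpm)
  obtain ⟨C₁, hC₁, hmain⟩ := e.exists_sup_bound_const hC
  set W := unitBallVolume n ^ (1 / m - 1 / p) with hW
  have hW0 : 0 ≤ W := by positivity
  refine ⟨C₁ * (W + 1), by positivity, fun Ω u F f hu y R hR hΩ => ?_⟩
  refine (hmain R hR y u F f (hu.meas_u _ _ hΩ) (hu.meas_F _ _ hΩ) (hu.meas_f _ _ hΩ)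
    (hu.deGiorgi _ _ hR hΩ)).trans ?_
  rw [ENNReal.ofReal_mul hC₁.le, mul_assoc]
  refine mul_le_mul_right ?_ _
  rw [mul_add]
  refine add_le_add ?_ ?_
  · have hum : AEStronglyMeasurable (fun x => max (u x) 0)
        (volume.restrict (Metric.closedBall y R)) :=
      ((hu.meas_u y R hΩ).aemeasurable.max aemeasurable_const).aestronglyMeasurable
    have h1 := eLpNorm_le_eLpNorm_mul_rpow_measure_univ (ENNReal.ofReal_le_ofReal hpm) hum
    rw [Measure.restrict_apply_univ, ENNReal.toReal_ofReal hm0.le, ENNReal.toReal_ofReal hp.le,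
      volume_closedBall_eq y hR.le, ENNReal.ofReal_rpow_of_nonneg (by positivity) hexp,
      Real.mul_rpow (by positivity) hω, ← hW, ← Real.rpow_mul hR.le] at h1
    calc _ ≤ ENNReal.ofReal (R ^ (-((n : ℝ) / m))) *
          (eLpNorm (fun x => max (u x) 0) (ENNReal.ofReal p)
            (volume.restrict (Metric.closedBall y R)) *
            ENNReal.ofReal (R ^ ((n : ℝ) * (1 / m - 1 / p)) * W)) := by gcongr
      _ = ENNReal.ofReal W * (ENNReal.ofReal (R ^ (-((n : ℝ) / p))) *
          eLpNorm (fun x => max (u x) 0) (ENNReal.ofReal p)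
            (volume.restrict (Metric.closedBall y R))) := by
          have e1 : R ^ (-((n : ℝ) / p)) = R ^ (-((n : ℝ) / m)) *
              R ^ ((n : ℝ) * (1 / m - 1 / p)) := by
            rw [← Real.rpow_add hR]; congr 1; ring
          rw [e1, ENNReal.ofReal_mul (by positivity), ENNReal.ofReal_mul (by positivity)]
          ring
      _ ≤ _ := by gcongr; linarith
  · calc sourceTerm γ γ' q s δ F f y R = ENNReal.ofReal 1 * sourceTerm γ γ' q s δ F f y R := by
          rw [ENNReal.ofReal_one, one_mul]
      _ ≤ _ := by gcongr; linarith

end DeGiorgiExponents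

/-! ### Subsolutions and the choice of exponents -/

/-- The exponents of the iteration exist as soon as `q > n / (γ - 1)`. -/
theorem exists_deGiorgiExponents {n : ℕ} {γ q : ℝ} (hγ : 1 < γ) (hγn : γ < n)
    (hq : (n : ℝ) / (γ - 1) < q) :
    ∃ s' m α : ℝ, DeGiorgiExponents n γ γ.conjExponent q (q / γ.conjExponent) s' m
      (1 - (n : ℝ) / (q * (γ - 1))) α := by
  have hγ0 : 0 < γ := by linarith
  have hγ1 : 0 < γ - 1 := by linarith
  have hn : (0 : ℝ) < n := hγ0.trans hγn
  have hnq : (n : ℝ) < q * (γ - 1) := (div_lt_iff₀ hγ1).1 hq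
  have hq0 : 0 < q := (div_pos hn hγ1).trans hq
  have hconj := Real.HolderConjugate.conjExponent hγ
  have hγ'0 : 0 < γ.conjExponent := hconj.symm.pos
  have hs : γ * (q / γ.conjExponent) = q * (γ - 1) := by
    rw [Real.conjExponent]; field_simp
  set s := q / γ.conjExponent with hs_def
  have hs0 : 0 < s := div_pos hq0 hγ'0
  have hs1 : 1 < s := by
    by_contra! h
    nlinarith
  have hconj_s := Real.HolderConjugate.conjExponent hs1
  set s' := s.conjExponent
  have hs'0 : 0 < s' := hconj_s.symm.pos
  have hs'inv : s'⁻¹ = 1 - s⁻¹ := by linarith [hconj_s.inv_add_inv_eq_one]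
  have hminv : (γ * s')⁻¹ = γ⁻¹ - (q * (γ - 1))⁻¹ := by
    rw [mul_inv, hs'inv, ← hs, mul_inv]; ring
  have hstar : 0 < sobolevExponent n γ := hγ0.trans (lt_sobolevExponent hγ hγn)
  have hinv : (q * (γ - 1))⁻¹ < (n : ℝ)⁻¹ := inv_strictAnti₀ hn hnq
  have hδ : 0 < 1 - (n : ℝ) / (q * (γ - 1)) := by
    rw [sub_pos, div_lt_one (hn.trans hnq)]; exact hnq
  refine ⟨s', γ * s', 1 - γ * s' / sobolevExponent n γ, hn, hconj, hconj_s,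
    (div_mul_cancel₀ q hγ'0.ne').symm, rfl, ?_, ?_, rfl, hδ, ?_⟩
  · rw [← inv_lt_inv₀ hstar (by positivity), hminv, sobolevExponent_inv]
    linarith
  · rw [← hs]; field_simp
  · have h1 : (n : ℝ) / (γ * s') * (1 - γ * s' / sobolevExponent n γ) =
        n * ((γ * s')⁻¹ - (sobolevExponent n γ)⁻¹) := by
      have : γ * s' ≠ 0 := by positivity
      field_simp
    rw [h1, hminv, sobolevExponent_inv, div_eq_mul_inv]
    have : (n : ℝ) * (n : ℝ)⁻¹ = 1 := mul_inv_cancel₀ hn.ne'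
    linear_combination this

/-- Subsolutions satisfy the hypotheses of the De Giorgi iteration, with a constant that depends
only on the structure. -/
theorem exists_isLocalDeGiorgi {n : ℕ} {γ γ' q s s' m δ α ν Λ : ℝ}
    (e : DeGiorgiExponents n γ γ' q s s' m δ α) (hγn : γ < n) (hν : 0 < ν) (hΛ : 0 < Λ) :
    ∃ C : ℝ, 0 < C ∧ ∀ (Ω : Set (EuclideanSpace ℝ (Fin n))), IsOpen Ω →
      ∀ (ρ : EuclideanSpace ℝ (Fin n) → EuclideanSpace ℝ (Fin n) → ℝ),
        IsAnisotropicIntegrand Ω ν Λ ρ →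
      ∀ (u : EuclideanSpace ℝ (Fin n) → ℝ)
        (F : EuclideanSpace ℝ (Fin n) → EuclideanSpace ℝ (Fin n))
        (f : EuclideanSpace ℝ (Fin n) → ℝ), IsSubsolution Ω γ ρ F f u →
        MemLpLoc F (ENNReal.ofReal q) Ω → MemLpLoc f (ENNReal.ofReal s) Ω →
        IsLocalDeGiorgi γ γ' m C Ω u F f := by
  have hγ := e.conj.lt
  have hstar := lt_sobolevExponent hγ hγn
  have hstar1 : 1 < sobolevExponent n γ := hγ.trans hstar
  have hσ := Real.HolderConjugate.conjExponent hstar1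
  set σ := (sobolevExponent n γ).conjExponent
  have hσs : σ ≤ s := by
    rw [← inv_le_inv₀ e.s_pos hσ.symm.pos]
    -- `s' ≤ m < γ*`
    have h1 : s' < sobolevExponent n γ := by
      have := e.m_lt
      rw [e.m_eq] at this
      nlinarith [e.conj_s.symm.pos]
    have h2 := inv_strictAnti₀ e.conj_s.symm.pos h1
    linarith [e.conj_s.inv_add_inv_eq_one, hσ.inv_add_inv_eq_one]
  have hγ'q : γ' ≤ q := by
    rw [e.q_eq]
    exact le_mul_of_one_le_left e.conj.symm.nonneg e.conj_s.lt.le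
  obtain ⟨C, hC, hmain⟩ := exists_energy_const n hγn e.conj hσ.symm hν hΛ
  refine ⟨C, hC, fun Ω hΩ ρ hρ u F f hu hF hf => ?_⟩
  have hcpt (y : EuclideanSpace ℝ (Fin n)) (R : ℝ) : IsCompact (Metric.closedBall y R) :=
    isCompact_closedBall y R
  have ⟨G, hG, _⟩ := hu
  refine ⟨fun y R h => (hG.memLp.1.mono_measure (Measure.restrict_mono h le_rfl)),
    fun y R h => (hF _ h (hcpt y R)).1, fun y R h => (hf _ h (hcpt y R)).1,
    fun y r R hr hrR h => ?_, fun y R hR h r R' hr hrR' hR' k d hd => ?_⟩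
  · have h1 := hG.eLpNorm_pos_part_lt_top hΩ hγ hγn hr hrR h
    have hm : AEStronglyMeasurable (fun x => max (u x) 0)
        (volume.restrict (Metric.closedBall y r)) :=
      ((hG.memLp.1.mono_measure (Measure.restrict_mono
        ((Metric.closedBall_subset_closedBall hrR.le).trans h) le_rfl)).aemeasurable.max
        aemeasurable_const).aestronglyMeasurable
    have : IsFiniteMeasure (volume.restrict (Metric.closedBall y r)) :=
      ⟨by simpa using (hcpt y r).measure_lt_top⟩
    exact (MemLp.mono_exponent ⟨hm, h1⟩ (ENNReal.ofReal_le_ofReal e.m_lt.le)).2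
  · have hsub := (Metric.closedBall_subset_closedBall (x := y) hR').trans h
    have : IsFiniteMeasure (volume.restrict (Metric.closedBall y R')) :=
      ⟨by simpa using (hcpt y R').measure_lt_top⟩
    exact hmain Ω hΩ ρ hρ u F f hu y r R' hr hrR' hsub
      ((hF _ hsub (hcpt y R')).mono_exponent (ENNReal.ofReal_le_ofReal hγ'q))
      ((hf _ hsub (hcpt y R')).mono_exponent (ENNReal.ofReal_le_ofReal hσs)) k d hd

/-- The Euclidean `L^q` norm of `F` is controlled by that of `ρ_*(·, F)`. -/
theorem IsAnisotropicIntegrand.eLpNorm_le_convexDual {n : ℕ} {Ω : Set (EuclideanSpace ℝ (Fin n))}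
    {ν Λ : ℝ} {ρ : EuclideanSpace ℝ (Fin n) → EuclideanSpace ℝ (Fin n) → ℝ}
    (h : IsAnisotropicIntegrand Ω ν Λ ρ) (hν : 0 < ν) (hΛ : 0 < Λ)
    (F : EuclideanSpace ℝ (Fin n) → EuclideanSpace ℝ (Fin n)) (q : ℝ≥0∞)
    {S : Set (EuclideanSpace ℝ (Fin n))} (hS : MeasurableSet S) (hSΩ : S ⊆ Ω) :
    eLpNorm F q (volume.restrict S) ≤
      ENNReal.ofReal (2 * Λ) * eLpNorm (fun x => convexDual ρ x (F x)) q (volume.restrict S) := by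
  refine eLpNorm_le_mul_eLpNorm_of_ae_le_mul ((ae_restrict_iff' hS).2 (ae_of_all _
    fun x hx => (h.norm_le_convexDual hν hΛ (hSΩ hx) (F x)).trans ?_)) q
  gcongr
  exact le_abs_self _

end

/-! ### The estimate between concentric balls -/

theorem theoremt (n : ℕ) (γ q p ν Λ : ℝ) (hγ : 1 < γ) (hγn : γ < n)
    (hq : (n : ℝ) / (γ - 1) < q) (hp : 0 < p) (hν : 0 < ν) (hνΛ : ν ≤ Λ) :
    0 < 1 - (n : ℝ) / (q * (γ - 1)) ∧
    ∃ C : ℝ, 0 < C ∧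
      ∀ (Ω : Set (EuclideanSpace ℝ (Fin n))), IsOpen Ω →
      ∀ (ρ : EuclideanSpace ℝ (Fin n) → EuclideanSpace ℝ (Fin n) → ℝ),
        IsAnisotropicIntegrand Ω ν Λ ρ →
      ∀ (F : EuclideanSpace ℝ (Fin n) → EuclideanSpace ℝ (Fin n)),
        MemLpLoc F (ENNReal.ofReal q) Ω →
      ∀ (f : EuclideanSpace ℝ (Fin n) → ℝ),
        MemLpLoc f (ENNReal.ofReal (q / γ.conjExponent)) Ω →
      ∀ (u : EuclideanSpace ℝ (Fin n) → ℝ), IsSubsolution Ω γ ρ F f u →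
      ∀ (x₀ : EuclideanSpace ℝ (Fin n)) (r R : ℝ), 0 < r → r < R → R < 1 →
        Metric.ball x₀ R ⊆ Ω →
        eLpNorm (fun x => max (u x) 0) ∞ (volume.restrict (Metric.ball x₀ r)) ≤
          ENNReal.ofReal C *
            (ENNReal.ofReal ((R - r) ^ (-((n : ℝ) / p))) *
                eLpNorm (fun x => max (u x) 0) (ENNReal.ofReal p)
                  (volume.restrict (Metric.ball x₀ R))
              + ENNReal.ofReal (R ^ (1 - (n : ℝ) / (q * (γ - 1)))) *
                (eLpNorm (fun x => convexDual ρ x (F x)) (ENNReal.ofReal q)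
                  (volume.restrict (Metric.ball x₀ R))) ^ (1 / (γ - 1))
              + ENNReal.ofReal (R ^ (γ.conjExponent * (1 - (n : ℝ) / (q * (γ - 1))))) *
                (eLpNorm f (ENNReal.ofReal (q / γ.conjExponent))
                  (volume.restrict (Metric.ball x₀ R))) ^ (1 / (γ - 1))) := by

  have hΛ : 0 < Λ := hν.trans_le hνΛ
  have hγ1 : 0 < γ - 1 := by linarith
  obtain ⟨s', m, α, e⟩ := exists_deGiorgiExponents hγ hγn hq
  refine ⟨e.δ_pos, ?_⟩
  set s := q / γ.conjExponent
  set δ := 1 - (n : ℝ) / (q * (γ - 1))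
  obtain ⟨C, hC, hclass⟩ := exists_isLocalDeGiorgi e hγn hν hΛ
  obtain ⟨C₂, hC₂, hsup⟩ := e.exists_sup_bound hC hp
  have hγ'δ : 0 < γ.conjExponent * δ := mul_pos e.conj.symm.pos e.δ_pos
  set a := (2 : ℝ) ^ ((n : ℝ) / p) with ha
  set b := (2 * Λ) ^ (1 / (γ - 1)) with hb
  have ha0 : 0 < a := by positivity
  have hb0 : 0 < b := by positivity
  -- `a` accounts for the radius `(R - r) / 2`, `b` for passing from `|F|` to `ρ_*(·, F)`
  refine ⟨C₂ * (a + b + 1), by positivity, fun Ω hΩ ρ hρ F hF f hf u hu x₀ r R hr hrR _ hB => ?_⟩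
  have hRr : 0 < (R - r) / 2 := by linarith
  have hR0 : 0 < R := hr.trans hrR
  refine eLpNorm_top_restrict_le_of_forall_closedBall measurableSet_ball
    fun z hz => ⟨(R - r) / 2 / 2, half_pos hRr, ?_⟩
  have hsub : Metric.closedBall z ((R - r) / 2) ⊆ Metric.ball x₀ R := by
    refine Metric.closedBall_subset_ball' ?_
    rw [Metric.mem_ball] at hz
    linarith
  have hmono := Measure.restrict_mono (μ := volume) hsub le_rfl
  refine (hsup Ω u F f (hclass Ω hΩ ρ hρ u F f hu hF hf) z _ hRr (hsub.trans hB)).trans ?_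
  rw [ENNReal.ofReal_mul hC₂.le, mul_assoc, sourceTerm, ← add_assoc]
  refine mul_le_mul_right ?_ _
  rw [mul_add, mul_add]
  have hle {t : ℝ} (ht : 0 < t) : ((R - r) / 2) ^ t ≤ R ^ t :=
    Real.rpow_le_rpow hRr.le (by linarith) ht.le
  refine add_le_add (add_le_add ?_ ?_) ?_
  · have h1 : ((R - r) / 2) ^ (-((n : ℝ) / p)) = a * (R - r) ^ (-((n : ℝ) / p)) := by
      rw [Real.div_rpow (by linarith) two_pos.le, Real.rpow_neg two_pos.le, div_inv_eq_mul,
        mul_comm]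
    rw [h1, ENNReal.ofReal_mul ha0.le, mul_assoc]
    gcongr
    linarith
  · have h1 : eLpNorm F (ENNReal.ofReal q)
        (volume.restrict (Metric.closedBall z ((R - r) / 2))) ^ (1 / (γ - 1)) ≤
        ENNReal.ofReal b * eLpNorm (fun x => convexDual ρ x (F x)) (ENNReal.ofReal q)
          (volume.restrict (Metric.ball x₀ R)) ^ (1 / (γ - 1)) := by
      rw [hb, ← ENNReal.ofReal_rpow_of_nonneg (by positivity) (by positivity),
        ← ENNReal.mul_rpow_of_nonneg _ _ (by positivity)]
      refine ENNReal.rpow_le_rpow ((eLpNorm_mono_measure _ hmono).trans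
        (hρ.eLpNorm_le_convexDual hν hΛ F _ measurableSet_ball hB)) (by positivity)
    calc _ ≤ ENNReal.ofReal (R ^ δ) * (ENNReal.ofReal b *
          eLpNorm (fun x => convexDual ρ x (F x)) (ENNReal.ofReal q)
            (volume.restrict (Metric.ball x₀ R)) ^ (1 / (γ - 1))) :=
          mul_le_mul' (ENNReal.ofReal_le_ofReal (hle e.δ_pos)) h1
      _ = ENNReal.ofReal b * (ENNReal.ofReal (R ^ δ) *
          eLpNorm (fun x => convexDual ρ x (F x)) (ENNReal.ofReal q)
            (volume.restrict (Metric.ball x₀ R)) ^ (1 / (γ - 1))) := by ring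
      _ ≤ _ := by
          gcongr
          linarith
  · refine le_trans ?_ (le_mul_of_one_le_left' (ENNReal.one_le_ofReal.2 (by linarith)))
    gcongr ENNReal.ofReal ?_ * ?_ ^ (1 / (γ - 1))
    · exact hle hγ'δ
    · exact eLpNorm_mono_measure _ hmono
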